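/- **Setting.** Let $K$ be a field and let $A=K[a_1,\dots,a_n]$ be a solvable polynomial algebra. That is, $A$ is an associative $K$-algebra for which the ordered monomials $a^\alpha=a_1^{\alpha_1}\cdots a_n^{\alpha_n}$ ($\alpha\in\mathbb N^n$) form a $K$-basis $\mathcal B$, together with a well-ordering $\prec$ of $\mathcal B$ such that (i) $a^\gamma=\mathrm{LM}(a^\alpha a^\beta a^\eta)$, $a^\gamma\ne1$, $a^\beta\neq a^\gamma$ imply $a^\beta\prec a^\gamma$; (ii) $a^\alpha\prec a^\beta$, $a^\gamma a^\alpha a^\eta\ne0$ and $\mathrm{LM}(a^\gamma a^\beta a^\eta)\notin\{0,1\}$ imply $\mathrm{LM}(a^\gamma a^\alpha a^\eta)\prec\mathrm{LM}(a^\gamma a^\beta a^\eta)$; (iii) $a^\alpha a^\beta=\lambda a^{\alpha+\beta}+f$ with $\lambda\in K^*$ and $f=0$ or $\mathrm{LM}(f)\prec a^{\alpha+\beta}$. Here $\mathrm{LM}$ and $\mathrm{LC}$ denote the leading monomial and its coefficient. Let $A=\bigoplus_{p\in\mathbb N}A_p$ be $\mathbb N$-graded with $A_0=K$ with respect to positive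 degrees $d(a_i)=m_i>0$: $A_p$ is the $K$-span of the $a^\alpha$ with $d(a^\alpha):=\sum_i\alpha_im_i=p$, and $A_pA_q\subseteq A_{p+q}$. Modules are left modules. A graded free module is $L=\bigoplus_{i=1}^sAe_i$ with degrees $b_i\in\mathbb N$ of the $e_i$, $L_q$ being the $K$-span of the $a^\alpha e_i$ with $d(a^\alpha)+b_i=q$. A homogeneous generating set is minimal if no proper subset (subfamily) generates. A left monomial ordering $\prec_e$ on $L$ is a total ordering of the monomials $a^\alpha e_i$ such that $a^\alpha e_i\prec_e a^\beta e_j$ implies $\mathrm{LM}(a^\gamma a^\alpha e_i)\prec_e\mathrm{LM}(a^\gamma a^\beta e_j)$ for all $\gamma$, and $a^\alpha\prec a^\beta$ implies $a^\alpha e_i\prec_e a^\beta e_i$. A monomial $u$ of $L$ left divides a monomial $w$ if $w=\mathrm{LM}(a^\gamma u)$ for some $\gamma$; a left Gröbner basis of a submodule $N\subseteq L$ is a set of nonzero elements of $N$ such that the leading monomial of every nonzero element of $N$ is left divisible by that of a member of the set. A minimal graded free resolution of a graded module $M$ is an exact sequence $\cdots\to L_1\xrightarrow{\varphi_1}L_0\xrightarrow{\varphi_0}M\to0$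 of graded free modules of finite rank and graded ($=$ degree-preserving) homomorphisms such that $\varphi_0$ maps the basis of $L_0$ to a minimal homogeneous generating set of $M$ and, for $i\ge1$, $\varphi_i$ maps the basis of $L_i$ to a minimal homogeneous generating set of $\ker\varphi_{i-1}$. It has length $d$ if $L_i=0$ for $i>d$, and $L_d\neq0$ unless $d=0$. **Theorem.** Let $M=\bigoplus_{q\in\mathbb N}M_q$ be a finitely generated graded $A$-module. Then $M$ has a minimal graded free resolution of some length $d\le n$. Moreover, let $v_1,\dots,v_s$ generate $M$ with $v_i\in M_{b_i}$, let $L=\bigoplus_{i=1}^sAe_i$ with $\deg e_i=b_i$, let $N$ be the kernel of $e_i\mapsto v_i$ (so that $M=L/N$), and let $U$ be a finite set of nonzero homogeneous generators of $N$. Then such a resolution is constructed as follows, whatever choices are made. *Procedure 1 (minimal homogeneous generating set of $M$).* Start with $E=\{e_1,\dots,e_s\}$ and $V=U$. As long as some $w\in V$ has a coefficient in $K^*$ at a member of $E$, choose such a $w$, let $e_i$ be the first member of $E$ at which its coefficient $c$ lies in $K^*$, replace $V$ by the set of nonzero elements among $u-c^{-1}u_iw$, $u\in V\setminus\{w\}$,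 where $u_i$ is the coefficient of $u$ at $e_i$, and delete $e_i$ from $E$. This stops after finitely many steps, and then: $\{v_i : e_i\in E\}$ is a minimal homogeneous generating set of $M$; $V$ consists of nonzero homogeneous elements of $N\cap L_0$, where $L_0=\bigoplus_{e_i\in E}Ae_i$, without coefficients in $K^*$; the map $\varphi_0:L_0\to M$, $e_i\mapsto v_i$, is onto, and $V$ generates its kernel $N_0$. Put $U_0=V$. *Procedure 2 (minimal homogeneous generating set of $N_i$).* Given the finite set $U_i$ of nonzero homogeneous generators of $N_i\subseteq L_i$, choose a left monomial ordering on $L_i$ (one exists) and start with empty lists $U_{\min}$, $G$, an empty set $\mathcal S$ and $W=U_i$. As long as $\mathcal S\cup W\ne\emptyset$, let $q$ be the least degree of its elements and move the elements of degree $q$ to $\mathcal S_q$ and $W_q$. First, one after the other, remove the elements of $\mathcal S_q$ and divide each by $G$; then remove the elements of $W_q$ and divide each by $G$. Whenever the remainder $\eta$ is nonzero, append $\eta$ to $G$, add to $\mathcal S$ the nonzero left S-polynomials $S(g,\eta)$ of the earlier $g\in G$ whose leading monomial involves the same basis vector as $\mathrm{LM}(\eta)$, and, if $\eta$ came from $\xi\in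 W_q$, append $\xi$ to $U_{\min}$. Here, if $\mathrm{LM}(g)=a^\alpha e_k$, $\mathrm{LM}(h)=a^\beta e_k$ and $\gamma=\max(\alpha,\beta)$ componentwise, then $S(g,h)=\mathrm{LC}(a^{\gamma-\alpha}g)^{-1}a^{\gamma-\alpha}g-\mathrm{LC}(a^{\gamma-\beta}h)^{-1}a^{\gamma-\beta}h$. Division of $\omega$ by the list $G$ means: while $\omega\ne0$, if $\mathrm{LM}(\omega)=\mathrm{LM}(a^\gamma\,\mathrm{LM}(g))$ for some $g\in G$ and some $\gamma$, take the first such $g$, subtract $\mathrm{LC}(a^\gamma g)^{-1}\mathrm{LC}(\omega)a^\gamma g$ from $\omega$ and add $\mathrm{LC}(a^\gamma g)^{-1}\mathrm{LC}(\omega)a^\gamma$ to the quotient at $g$; otherwise move the leading term of $\omega$ to the remainder. By keeping track of these divisions one records a matrix $\mathcal V$ with $G=\mathcal V\,U_{\min}$ and the set $\mathcal Z$ of the syzygies of $G$ given by all the S-polynomials formed (including those that vanish). This stops after finitely many steps, and then $U_{\min}\subseteq U_i$ is a minimal homogeneous generating set of $N_i$, and $G$ is a homogeneous left Gröbner basis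 of $N_i$ whose degrees are nondecreasing. *Procedure 3 (syzygies).* Let $L_{i+1}$ be the graded free module with one basis vector $\varepsilon_k$ for each member $\xi_k$ of $U_{\min}$, of the same degree. Divide the members of $U_{\min}$ by $G$ to obtain a matrix $\mathcal Q$ with $U_{\min}=\mathcal Q\,G$, and let $U_{i+1}\subset L_{i+1}$ be the set of nonzero elements among the rows $z\mathcal V$ ($z\in\mathcal Z$) and the rows of $\mathcal Q\mathcal V-1$. Then $U_{i+1}$ is a finite homogeneous generating set of the syzygy module $N_{i+1}=\mathrm{Syz}(U_{\min})$. *Procedure 4.* Let $\varphi_{i+1}:L_{i+1}\to L_i$ be given by $\varepsilon_k\mapsto\xi_k$; its image is $N_i$ and its kernel is $N_{i+1}$. Repeat Procedures 2–4 for $i=0,1,2,\dots$ until $N_i=0$. This happens for the first time at some $i=d\le n$, and $0\to L_d\xrightarrow{\varphi_d}\cdots\xrightarrow{\varphi_1}L_0\xrightarrow{\varphi_0}M\to0$ is a minimal graded free resolution of $M$ of length $d$. -/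

import Mathlib

/-- `p` is the leading index of the coefficient function `c` for the order `lt`. -/
def IsLeading {ι K : Type*} [Zero K] (lt : ι → ι → Prop) (c : ι → K) (p : ι) : Prop :=
  c p ≠ 0 ∧ ∀ q, c q ≠ 0 → q ≠ p → lt q p

/-- A solvable polynomial algebra `A = K[a₁, …, aₙ]` with a fixed admissible system: the ordered
monomials `a₁^α₁ ⋯ aₙ^αₙ` form a `K`-basis, and `lt` is a (two-sided) monomial ordering such that
`a^α a^β = λ a^(α+β) + f` with `λ ≠ 0` and `LM f ≺ a^(α+β)` whenever `f ≠ 0`.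
Monomials are represented by their exponents. -/
structure SolvablePolynomialAlgebra (K A : Type*) [Field K] [Ring A] [Algebra K A] (n : ℕ) where
  gen : Fin n → A
  basis : Module.Basis (Fin n → ℕ) K A
  basis_eq : ∀ α, basis α = (List.ofFn fun i => gen i ^ α i).prod
  lt : (Fin n → ℕ) → (Fin n → ℕ) → Prop
  lt_wellOrder : IsWellOrder (Fin n → ℕ) lt
  lt_of_leading : ∀ α β η γ, γ ≠ 0 → β ≠ γ →
    IsLeading lt (basis.repr (basis α * basis β * basis η)) γ → lt β γ
  lt_mul : ∀ γ α β η μ ν, lt α β →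
    IsLeading lt (basis.repr (basis γ * basis α * basis η)) μ →
    IsLeading lt (basis.repr (basis γ * basis β * basis η)) ν → ν ≠ 0 → lt μ ν
  mul_eq : ∀ α β, ∃ c : K, c ≠ 0 ∧ ∃ f : A,
    basis α * basis β = c • basis (α + β) + f ∧
      ∀ δ, IsLeading lt (basis.repr f) δ → lt δ (α + β)

/-- An `ℕ`-graded solvable polynomial algebra with degree-zero part `K`, with respect to the
positive-degree function determined by `d aᵢ = wt i`: the degree-`p` part is the `K`-span of the
monomials of weighted degree `p`. -/
structure GradedSolvablePolynomialAlgebra (K A : Type*) [Field K] [Ring A] [Algebra K A] (n : ℕ)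
    extends SolvablePolynomialAlgebra K A n where
  wt : Fin n → ℕ
  wt_pos : ∀ i, 0 < wt i
  mul_mem : ∀ p q f g,
    f ∈ Submodule.span K {x | ∃ α : Fin n → ℕ, ∑ i, α i * wt i = p ∧ x = basis α} →
    g ∈ Submodule.span K {x | ∃ α : Fin n → ℕ, ∑ i, α i * wt i = q ∧ x = basis α} →
    f * g ∈ Submodule.span K {x | ∃ α : Fin n → ℕ, ∑ i, α i * wt i = p + q ∧ x = basis α}

/-- `v` is a minimal generating family of `N`: it generates `N`, and no subfamily indexed by a
proper subset does. -/
def IsMinGen {A M ι : Type*} [Ring A] [AddCommGroup M] [Module A M] (N : Submodule A M)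
    (v : ι → M) : Prop :=
  Submodule.span A (Set.range v) = N ∧
    ∀ S : Set ι, S ≠ Set.univ → Submodule.span A (v '' S) ≠ N

/-- Every execution of the (nondeterministic) step relation `R` from `x` is finite, and each state
in which an execution stops satisfies `Out`. -/
def HaltsWith {σ : Type*} (R : σ → σ → Prop) (Out : σ → Prop) (x : σ) : Prop :=
  Acc (fun y z => R z y) x ∧
    ∀ y, Relation.ReflTransGen R x y → (∀ z, ¬ R y z) → Out y

/-- A free module `A^rank`, with degrees of its basis vectors, and a finite set of its elements
(generating the submodule to be resolved next). -/
structure Stage (A : Type*) where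
  rank : ℕ
  deg : Fin rank → ℕ
  gens : Finset (Fin rank → A)

/-- The state of the computation of a minimal homogeneous generating set together with a left
Gröbner basis. A pair `(i, j)` stands for the left S-polynomial of the `i`-th and `j`-th elements
of the basis computed so far. -/
structure MinState (A : Type*) [Ring A] (r : ℕ) where
  /-- S-polynomials still to be treated -/
  pairs : Finset (ℕ × ℕ)
  /-- S-polynomials of the current degree -/
  curPairs : Finset (ℕ × ℕ)
  /-- generators still to be treated -/
  todo : Finset (Fin r → A)
  /-- generators of the current degree -/
  curTodo : Finset (Fin r → A)
  /-- the minimal generators selected so far -/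
  umin : List (Fin r → A)
  /-- the basis elements `g` found so far, each with the row of coefficients that expresses it
  through the members of `umin` -/
  basis : List ((Fin r → A) × (ℕ →₀ A))
  /-- the syzygies of the basis elements recorded so far -/
  syz : Set (ℕ →₀ A)

namespace MinState

variable {A : Type*} [Ring A] {r : ℕ}

/-- The list of the basis elements found so far. -/
def groebner (T : MinState A r) : List (Fin r → A) := T.basis.map Prod.fst

/-- The product of a row vector with the matrix of coefficients that express the basis elements
through the selected generators. -/
noncomputable def rowMul (T : MinState A r) (c : ℕ →₀ A) : ℕ →₀ A :=
  c.sum fun k f => f • (T.basis.map Prod.snd).getD k 0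

/-- Nothing is left to be treated. -/
def Done (T : MinState A r) : Prop :=
  T.pairs = ∅ ∧ T.curPairs = ∅ ∧ T.todo = ∅ ∧ T.curTodo = ∅

/-- The initial state. -/
def init (U : Finset (Fin r → A)) : MinState A r := ⟨∅, ∅, U, ∅, [], [], ∅⟩

end MinState

namespace GradedSolvablePolynomialAlgebra

variable {K A : Type*} [Field K] [Ring A] [Algebra K A] {n : ℕ}
  (P : GradedSolvablePolynomialAlgebra K A n)

/-- The weighted degree of a monomial. -/
def weight (α : Fin n → ℕ) : ℕ := ∑ i, α i * P.wt i

/-- The degree-`p` part of `A`. -/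
def part (p : ℕ) : Submodule K A := Submodule.span K {x | ∃ α, P.weight α = p ∧ x = P.basis α}

/-- `ℳ` is an `ℕ`-grading of the left `A`-module `M` (the parts are automatically `K`-subspaces,
since `K` is the degree-zero part of `A`). -/
structure IsGradedModule {M : Type*} [AddCommGroup M] [Module A M] (ℳ : ℕ → AddSubgroup M) :
    Prop where
  internal : DirectSum.IsInternal ℳ
  smul_mem : ∀ p q (f : A) (x : M), f ∈ P.part p → x ∈ ℳ q → f • x ∈ ℳ (p + q)

/-! ### Graded free modules `A^r` -/

/-- The monomial `a^α eᵢ` of `A^r`. -/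
noncomputable def monE {r : ℕ} (p : (Fin n → ℕ) × Fin r) : Fin r → A := Pi.single p.2 (P.basis p.1)

/-- The coefficient of an element of `A^r` at a monomial. -/
noncomputable def coeff {r : ℕ} (ξ : Fin r → A) (p : (Fin n → ℕ) × Fin r) : K :=
  P.basis.repr (ξ p.2) p.1

/-- The degree-`q` part of `A^r`, where the `i`-th basis vector has degree `b i`. -/
def freePart {r : ℕ} (b : Fin r → ℕ) (q : ℕ) : Submodule K (Fin r → A) :=
  Submodule.span K {x | ∃ p : (Fin n → ℕ) × Fin r, P.weight p.1 + b p.2 = q ∧ x = P.monE p}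

/-- `ξ` is a (nonzero) homogeneous element of `A^r`. -/
def IsHomog {r : ℕ} (b : Fin r → ℕ) (ξ : Fin r → A) : Prop := ξ ≠ 0 ∧ ∃ q, ξ ∈ P.freePart b q

/-- `p` is the leading monomial of `ξ`. -/
def IsLM {r : ℕ} (ltE : (Fin n → ℕ) × Fin r → (Fin n → ℕ) × Fin r → Prop) (ξ : Fin r → A)
    (p : (Fin n → ℕ) × Fin r) : Prop :=
  IsLeading ltE (P.coeff ξ) p

/-- Left monomial orderings on `A^r`. -/
structure IsLeftMonomialOrder {r : ℕ}
    (ltE : (Fin n → ℕ) × Fin r → (Fin n → ℕ) × Fin r → Prop) : Prop where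
  total : IsStrictTotalOrder _ ltE
  smul : ∀ γ p q p' q', ltE p q → P.IsLM ltE (P.basis γ • P.monE p) p' →
    P.IsLM ltE (P.basis γ • P.monE q) q' → ltE p' q'
  compat : ∀ α β i, P.lt α β → ltE (α, i) (β, i)

/-- Left divisibility of monomials of `A^r`. -/
def LeftDvd {r : ℕ} (ltE : (Fin n → ℕ) × Fin r → (Fin n → ℕ) × Fin r → Prop)
    (p q : (Fin n → ℕ) × Fin r) : Prop :=
  ∃ γ, P.IsLM ltE (P.basis γ • P.monE p) q

/-- `G` is a left Gröbner basis of the submodule `N`. -/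
def IsLeftGroebner {r : ℕ} (ltE : (Fin n → ℕ) × Fin r → (Fin n → ℕ) × Fin r → Prop)
    (N : Submodule A (Fin r → A)) (G : List (Fin r → A)) : Prop :=
  (∀ g ∈ G, g ∈ N ∧ g ≠ 0) ∧
    ∀ ξ ∈ N, ξ ≠ 0 → ∃ g ∈ G, ∃ p q, P.IsLM ltE g p ∧ P.IsLM ltE ξ q ∧ P.LeftDvd ltE p q

/-- The left division algorithm: `DivL ltE G ω q η` means that dividing `ω` by the list `G`
produces the quotients `q` and the remainder `η`. If the leading monomial of `ω` is left divisible
by that of some member of `G`, the first such member is used to cancel the leading term; otherwise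
the leading term is moved to the remainder. (In the first case the leading monomial of `a^γ g` is
`p`, so its leading coefficient is its coefficient at `p`.) -/
inductive DivL {r : ℕ} (ltE : (Fin n → ℕ) × Fin r → (Fin n → ℕ) × Fin r → Prop)
    (G : List (Fin r → A)) : (Fin r → A) → (ℕ →₀ A) → (Fin r → A) → Prop
  | zero : DivL ltE G 0 0 0
  | reduce (ω : Fin r → A) (p : (Fin n → ℕ) × Fin r) (i : ℕ) (g : Fin r → A)
      (p' : (Fin n → ℕ) × Fin r) (γ : Fin n → ℕ) (f : A) (q : ℕ →₀ A) (η : Fin r → A)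
      (hp : P.IsLM ltE ω p) (hg : G[i]? = some g) (hp' : P.IsLM ltE g p')
      (hdvd : P.IsLM ltE (P.basis γ • P.monE p') p)
      (hleast : ∀ j < i, ∀ h, G[j]? = some h → ∀ p'', P.IsLM ltE h p'' → ¬ P.LeftDvd ltE p'' p)
      (hf : f = ((P.coeff (P.basis γ • g) p)⁻¹ * P.coeff ω p) • P.basis γ)
      (rest : DivL ltE G (ω - f • g) q η) :
      DivL ltE G ω (Finsupp.single i f + q) η
  | move (ω : Fin r → A) (p : (Fin n → ℕ) × Fin r) (q : ℕ →₀ A) (η : Fin r → A)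
      (hp : P.IsLM ltE ω p)
      (hnone : ∀ g ∈ G, ∀ p', P.IsLM ltE g p' → ¬ P.LeftDvd ltE p' p)
      (rest : DivL ltE G (ω - P.coeff ω p • P.monE p) q η) :
      DivL ltE G ω q (P.coeff ω p • P.monE p + η)

/-- The leading monomials of `g` and `h` involve the same basis vector, `f` and `f'` are the
multipliers of `g` and `h` in their left S-polynomial, and `s = f g - f' h` is that
S-polynomial. -/
def IsSPoly {r : ℕ} (ltE : (Fin n → ℕ) × Fin r → (Fin n → ℕ) × Fin r → Prop)
    (g h : Fin r → A) (f f' : A) (s : Fin r → A) : Prop :=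
  ∃ (α β : Fin n → ℕ) (i : Fin r), P.IsLM ltE g (α, i) ∧ P.IsLM ltE h (β, i) ∧
    f = (P.coeff (P.basis (α ⊔ β - α) • g) (α ⊔ β, i))⁻¹ • P.basis (α ⊔ β - α) ∧
    f' = (P.coeff (P.basis (α ⊔ β - β) • h) (α ⊔ β, i))⁻¹ • P.basis (α ⊔ β - β) ∧
    s = f • g - f' • h

/-! ### Minimal homogeneous generating sets of submodules -/

/-- `IsSPoly` for the `ij.1`-th and the `ij.2`-th member of the list `G`. -/
def PairSPoly {r : ℕ} (ltE : (Fin n → ℕ) × Fin r → (Fin n → ℕ) × Fin r → Prop)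
    (G : List (Fin r → A)) (ij : ℕ × ℕ) (f f' : A) (s : Fin r → A) : Prop :=
  ∃ g h, G[ij.1]? = some g ∧ G[ij.2]? = some h ∧ P.IsSPoly ltE g h f f' s

/-- The S-polynomial of the pair `ij` has degree `q`. -/
def PairDeg {r : ℕ} (b : Fin r → ℕ) (ltE : (Fin n → ℕ) × Fin r → (Fin n → ℕ) × Fin r → Prop)
    (G : List (Fin r → A)) (q : ℕ) (ij : ℕ × ℕ) : Prop :=
  ∃ f f' s, P.PairSPoly ltE G ij f f' s ∧ s ≠ 0 ∧ s ∈ P.freePart b q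

open scoped Classical in
/-- Append a new basis element `η` (with coefficient row `ρ`); add the nonzero S-polynomials that
it forms with the previous basis elements to those still to be treated, and record the syzygies
given by the vanishing ones. -/
noncomputable def adjoin {r : ℕ} (ltE : (Fin n → ℕ) × Fin r → (Fin n → ℕ) × Fin r → Prop)
    (T : MinState A r) (η : Fin r → A) (ρ : ℕ →₀ A) : MinState A r :=
  let t := T.basis.length
  let G := T.groebner ++ [η]
  { T with
    basis := T.basis ++ [(η, ρ)]
    pairs := T.pairs ∪ ((Finset.range t).image fun i => (i, t)).filter
      fun ij => ∃ f f' s, P.PairSPoly ltE G ij f f' s ∧ s ≠ 0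
    syz := T.syz ∪ {σ | ∃ i < t, ∃ f f', P.PairSPoly ltE G (i, t) f f' 0 ∧
      σ = Finsupp.single t f' - Finsupp.single i f} }

open scoped Classical in
/-- One step of the computation. `next`: pass to the least degree of the S-polynomials and
generators still to be treated. `pairZero`, `pairNew`: divide an S-polynomial of the current degree
by the basis elements found so far. `genZero`, `genNew`: once no S-polynomial of the current degree
is left, do the same with a generator of the current degree, and select it if its remainder is
nonzero. The reductions are kept track of in the coefficient rows and in the syzygies. -/
inductive MinStep {r : ℕ} (b : Fin r → ℕ)
    (ltE : (Fin n → ℕ) × Fin r → (Fin n → ℕ) × Fin r → Prop) :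
    MinState A r → MinState A r → Prop
  | next (T : MinState A r) (q : ℕ) (h₁ : T.curPairs = ∅) (h₂ : T.curTodo = ∅)
      (hq : IsLeast {q | (∃ ξ ∈ T.todo, ξ ∈ P.freePart b q) ∨
        ∃ ij ∈ T.pairs, P.PairDeg b ltE T.groebner q ij} q) :
      MinStep b ltE T
        { T with
          curPairs := T.pairs.filter fun ij => P.PairDeg b ltE T.groebner q ij
          pairs := T.pairs.filter fun ij => ¬ P.PairDeg b ltE T.groebner q ij
          curTodo := T.todo.filter fun ξ => ξ ∈ P.freePart b q
          todo := T.todo.filter fun ξ => ξ ∉ P.freePart b q }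
  | pairZero (T : MinState A r) (i j : ℕ) (f f' : A) (s : Fin r → A) (c : ℕ →₀ A)
      (hij : (i, j) ∈ T.curPairs) (hs : P.PairSPoly ltE T.groebner (i, j) f f' s)
      (hdiv : P.DivL ltE T.groebner s c 0) :
      MinStep b ltE T
        { T with
          curPairs := T.curPairs.erase (i, j)
          syz := T.syz ∪ {c - Finsupp.single i f + Finsupp.single j f'} }
  | pairNew (T : MinState A r) (i j : ℕ) (f f' : A) (s : Fin r → A) (c : ℕ →₀ A)
      (η : Fin r → A)
      (hij : (i, j) ∈ T.curPairs) (hs : P.PairSPoly ltE T.groebner (i, j) f f' s)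
      (hdiv : P.DivL ltE T.groebner s c η) (hη : η ≠ 0) :
      MinStep b ltE T
        (P.adjoin ltE
          { T with
            curPairs := T.curPairs.erase (i, j)
            syz := T.syz ∪ {c + Finsupp.single T.basis.length 1
              - Finsupp.single i f + Finsupp.single j f'} }
          η (T.rowMul (Finsupp.single i f - Finsupp.single j f' - c)))
  | genZero (T : MinState A r) (ξ : Fin r → A) (c : ℕ →₀ A)
      (h₁ : T.curPairs = ∅) (hξ : ξ ∈ T.curTodo) (hdiv : P.DivL ltE T.groebner ξ c 0) :
      MinStep b ltE T { T with curTodo := T.curTodo.erase ξ }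
  | genNew (T : MinState A r) (ξ : Fin r → A) (c : ℕ →₀ A) (η : Fin r → A)
      (h₁ : T.curPairs = ∅) (hξ : ξ ∈ T.curTodo) (hdiv : P.DivL ltE T.groebner ξ c η)
      (hη : η ≠ 0) :
      MinStep b ltE T
        (P.adjoin ltE
          { T with
            curTodo := T.curTodo.erase ξ
            umin := T.umin ++ [ξ] }
          η (Finsupp.single T.umin.length 1 - T.rowMul c))

/-- What the computation is to return for the submodule generated by `U`: a minimal homogeneous
generating set contained in `U`, and a homogeneous left Gröbner basis with nondecreasing
degrees. -/
def MinOutput {r : ℕ} (b : Fin r → ℕ)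
    (ltE : (Fin n → ℕ) × Fin r → (Fin n → ℕ) × Fin r → Prop) (U : Finset (Fin r → A))
    (T : MinState A r) : Prop :=
  T.Done ∧ (∀ ξ ∈ T.umin, ξ ∈ U) ∧
    IsMinGen (Submodule.span A (U : Set (Fin r → A))) T.umin.get ∧
    P.IsLeftGroebner ltE (Submodule.span A (U : Set (Fin r → A))) T.groebner ∧
    (∀ g ∈ T.groebner, P.IsHomog b g) ∧
    T.groebner.Pairwise fun g h =>
      ∀ q q', g ∈ P.freePart b q → h ∈ P.freePart b q' → q ≤ q'

/-! ### Minimal homogeneous generating sets of quotient modules -/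

open scoped Classical in
/-- One step of the computation of a minimal homogeneous generating set of a quotient of `A^s`.
A state consists of the set of remaining basis vectors and a set of relations. If some relation `w`
has its first coefficient in `K^*` at `eᵢ`, then `w` is used to eliminate `eᵢ`. -/
def QuotStep (K : Type*) {A : Type*} [Field K] [Ring A] [Algebra K A] {s : ℕ}
    (X Y : Finset (Fin s) × Finset (Fin s → A)) : Prop :=
  ∃ w ∈ X.2, ∃ i ∈ X.1, ∃ c : K, c ≠ 0 ∧ w i = algebraMap K A c ∧
    (∀ k ∈ X.1, k < i → ∀ c' : K, c' ≠ 0 → w k ≠ algebraMap K A c') ∧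
    Y.1 = X.1.erase i ∧
    Y.2 = ((X.2.erase w).image fun u => u - (c⁻¹ • u i) • w).erase 0

open scoped Classical in
/-- The free module on the basis vectors in `E`, with the relations `V`, its basis being numbered
in increasing order. -/
noncomputable def quotStage {s : ℕ} (b : Fin s → ℕ) (X : Finset (Fin s) × Finset (Fin s → A)) :
    Stage A where
  rank := X.1.card
  deg k := b (X.1.orderEmbOfFin rfl k)
  gens := X.2.image fun ξ k => ξ (X.1.orderEmbOfFin rfl k)

/-- The map from the free module on the basis vectors in `E` to `M` that sends each `eᵢ` to
`v i`. -/
noncomputable def quotMap {s : ℕ} {M : Type*} [AddCommGroup M] [Module A M] (v : Fin s → M)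
    (E : Finset (Fin s)) : (Fin E.card → A) →ₗ[A] M :=
  Fintype.linearCombination A fun k => v (E.orderEmbOfFin rfl k)

/-- What the computation is to return for a quotient `M` of `A^s` with relations `U`, where `eᵢ`
has image `v i`: a subset `E` of the basis vectors whose images form a minimal generating set of
`M` (homogeneous, as `v i` is), and homogeneous relations `V` in the submodule generated by `U` that involve only the basis
vectors in `E` and have no coefficient in `K^*`, such that `M` is the quotient of the free module
on `E` by the submodule generated by `V`. -/
def QuotOutput {s : ℕ} {M : Type*} [AddCommGroup M] [Module A M] (b : Fin s → ℕ) (v : Fin s → M)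
    (U : Finset (Fin s → A)) (X : Finset (Fin s) × Finset (Fin s → A)) : Prop :=
  (∀ ξ ∈ X.2, ξ ∈ Submodule.span A (U : Set (Fin s → A)) ∧ P.IsHomog b ξ ∧
    (∀ i ∉ X.1, ξ i = 0) ∧ ∀ i, ∀ c : K, c ≠ 0 → ξ i ≠ algebraMap K A c) ∧
  IsMinGen (⊤ : Submodule A M) (fun i : X.1 => v i) ∧
  Function.Surjective (quotMap (A := A) v X.1) ∧
  LinearMap.ker (quotMap (A := A) v X.1) =
    Submodule.span A ((quotStage b X).gens : Set (Fin (quotStage b X).rank → A))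

/-! ### Resolutions -/

/-- From a final state `T` of the computation for the submodule `N` of `X` generated by `X.gens`,
pass to the free module on the selected generators, with the map `φ` onto `N`, and to the
generators of the syzygy module `ker φ` that are computed from the syzygies of the Gröbner basis,
the matrix `V` (the coefficient rows) and the matrix `Q` that expresses the selected generators
through the Gröbner basis by division: the rows of `S V` and of `Q V - 1`, without zeros. -/
def SyzStep (X : Stage A) (ltE : (Fin n → ℕ) × Fin X.rank → (Fin n → ℕ) × Fin X.rank → Prop)
    (T : MinState A X.rank) (Y : Stage A)
    (φ : (Fin Y.rank → A) →ₗ[A] (Fin X.rank → A)) : Prop :=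
  Y.rank = T.umin.length ∧
  (∀ k : Fin Y.rank, T.umin[(k : ℕ)]? = some (φ (Pi.single k 1)) ∧
    φ (Pi.single k 1) ∈ P.freePart X.deg (Y.deg k)) ∧
  ∃ Q : Fin Y.rank → (ℕ →₀ A),
    (∀ k, P.DivL ltE T.groebner (φ (Pi.single k 1)) (Q k) 0) ∧
    (Y.gens : Set (Fin Y.rank → A)) =
      {ξ | ξ ≠ 0 ∧ ((∃ σ ∈ T.syz, ξ = fun j : Fin Y.rank => T.rowMul σ (j : ℕ)) ∨
        ∃ k : Fin Y.rank,
          ξ = fun j : Fin Y.rank => T.rowMul (Q k) (j : ℕ) - Finsupp.single (k : ℕ) (1 : A) (j : ℕ))}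

/-- `T` is a state in which the computation for the submodule generated by `X.gens` stops. -/
def IsMinResult (X : Stage A)
    (ltE : (Fin n → ℕ) × Fin X.rank → (Fin n → ℕ) × Fin X.rank → Prop)
    (T : MinState A X.rank) : Prop :=
  Relation.ReflTransGen (P.MinStep X.deg ltE) (MinState.init X.gens) T ∧ T.Done

/-- One round of the construction of a resolution: choose a left monomial ordering, compute a
minimal homogeneous generating set, and compute generators of its syzygy module. -/
def ResStep (X Y : Stage A) (φ : (Fin Y.rank → A) →ₗ[A] (Fin X.rank → A)) : Prop :=
  ∃ ltE, P.IsLeftMonomialOrder ltE ∧ ∃ T, P.IsMinResult X ltE T ∧ P.SyzStep X ltE T Y φ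

/-- A minimal graded free resolution `⋯ → A^(r 1) → A^(r 0) → M → 0`. -/
structure IsMinimalGradedFreeResolution {M : Type*} [AddCommGroup M] [Module A M]
    (ℳ : ℕ → AddSubgroup M) (r : ℕ → ℕ) (b : ∀ i, Fin (r i) → ℕ)
    (ε : (Fin (r 0) → A) →ₗ[A] M)
    (φ : ∀ i, (Fin (r (i + 1)) → A) →ₗ[A] (Fin (r i) → A)) : Prop where
  aug_graded : ∀ q, ∀ ξ ∈ P.freePart (b 0) q, ε ξ ∈ ℳ q
  map_graded : ∀ i q, ∀ ξ ∈ P.freePart (b (i + 1)) q, φ i ξ ∈ P.freePart (b i) q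
  surjective : Function.Surjective ε
  exact_zero : LinearMap.range (φ 0) = LinearMap.ker ε
  exact_succ : ∀ i, LinearMap.range (φ (i + 1)) = LinearMap.ker (φ i)
  aug_min : IsMinGen (⊤ : Submodule A M) fun k => ε (Pi.single k 1)
  min_zero : IsMinGen (LinearMap.ker ε) fun k => φ 0 (Pi.single k 1)
  min_succ : ∀ i, IsMinGen (LinearMap.ker (φ i)) fun k => φ (i + 1) (Pi.single k 1)

end GradedSolvablePolynomialAlgebra

/-- The complex of free modules of ranks `r 0, r 1, …` has length `d`. -/
def HasLength (r : ℕ → ℕ) (d : ℕ) : Prop :=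
  (∀ i, d < i → r i = 0) ∧ (d ≠ 0 → r d ≠ 0)

/-! Multiplying by `a^γ` shifts leading exponents: `LM(a^γ ξ)` is `LM(ξ)` with `γ` added to its
exponent. Leading monomials of a free left module therefore behave as over a commutative polynomial
ring. Dickson's lemma makes every left monomial ordering well-founded and every strictly growing
chain of sets of multiples of leading monomials finite, which yields division, Gröbner bases, finite
generation of submodules and termination.

The computations rest on Schreyer's argument (`schreyer_dichotomy`). Order the free module on `g_1,
…, g_t` by the leading monomials of the images, the larger index winning ties. The syzygy coming
from the S-polynomial of `g_i` and `g_j`, `i < j`, then leads at the `j`-th basis vector with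
exponent `lcm / LM(g_j)`. A vector that is reduced modulo these syzygies cannot lose its leading
term on evaluation. Hence a vector either lies in their span, or has a nonzero value whose leading
monomial is divisible by some `LM(g_j)`. This gives both the Gröbner property and the generation of
all syzygies (`schreyer_theorem`). Its truncation to one degree (`schreyer_theorem_degree`) shows
that a generator of degree `q` with nonzero remainder, met after all S-polynomials of degree `q`, is
not in the span of the generators selected before. So each selected generator is independent of its
predecessors, and the degrees are nondecreasing. The last nonzero entry of a homogeneous syzygy with
a nonzero constant term would be a scalar and would contradict this, so syzygies have no constant
terms; that property implies minimality (`constant_eq_zero`, `isMinGen_of_ker`). The matrix identity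
`y = (yQ)V - y(QV - 1)` transports syzygies of `G` to syzygies of the selected generators
(`syzStep_spec`).

The bound `n` on the length is independent of the algorithm. Sorting a Gröbner basis by the exponent
of one variable frees the leading monomials of its syzygies from that variable (`leadingFree_ker`).
After `n` such steps no variable is left, and the quotient is projective (`projective_quotient`).
Thus every finitely presented module has projective dimension at most `n`. By dimension shifting,
the `n`-th syzygy module of the constructed sequence has a projective quotient. Since it has no
constant terms, the splitting pushes its elements into arbitrarily high degrees, so it vanishes
(`eq_bot_of_projective`). -/

theorem exists_isLeading {ι K : Type*} [Zero K] {lt : ι → ι → Prop} [IsStrictTotalOrder ι lt]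
    {c : ι → K} (hfin : {p | c p ≠ 0}.Finite) (hne : ∃ p, c p ≠ 0) : ∃ p, IsLeading lt c p := by
  classical
  let := linearOrderOfSTO lt
  obtain ⟨p, hp⟩ := hne
  have hn : hfin.toFinset.Nonempty := ⟨p, by simpa using hp⟩
  refine ⟨hfin.toFinset.max' hn, by simpa using hfin.toFinset.max'_mem hn, fun q hq hqp => ?_⟩
  exact lt_of_le_of_ne (hfin.toFinset.le_max' q (by simpa using hq)) hqp

theorem IsLeading.eq {ι K : Type*} [Zero K] {lt : ι → ι → Prop} [IsStrictOrder ι lt]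
    {c : ι → K} {p q : ι} (hp : IsLeading lt c p) (hq : IsLeading lt c q) : p = q := by
  by_contra hne
  exact asymm_of lt (hp.2 q hq.1 (Ne.symm hne)) (hq.2 p hp.1 hne)

namespace GradedSolvablePolynomialAlgebra

variable {K A : Type*} [Field K] [Ring A] [Algebra K A] {n : ℕ}
  (P : GradedSolvablePolynomialAlgebra K A n)

/-! ### The monomial ordering of the algebra -/

theorem lt_isStrictTotalOrder : IsStrictTotalOrder (Fin n → ℕ) P.lt :=
  have := P.lt_wellOrder
  { }

theorem basis_zero : P.basis 0 = 1 := by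
  rw [P.basis_eq]
  apply List.prod_eq_one
  intro x hx
  obtain ⟨i, rfl⟩ := (List.mem_ofFn' _ _).1 hx
  simp

/-- The axiom bounds only the leading monomial of `f`; all other monomials of `f` lie below that
one. -/
theorem exists_mul_eq (α β : Fin n → ℕ) : ∃ c : K, c ≠ 0 ∧ ∃ f : A,
    P.basis α * P.basis β = c • P.basis (α + β) + f ∧
      ∀ δ, P.basis.repr f δ ≠ 0 → P.lt δ (α + β) := by
  have := P.lt_isStrictTotalOrder
  obtain ⟨c, hc, f, hf, hlead⟩ := P.mul_eq α β
  refine ⟨c, hc, f, hf, fun δ hδ => ?_⟩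
  obtain ⟨p, hp⟩ := exists_isLeading (lt := P.lt) (c := P.basis.repr f)
    (P.basis.repr f).hasFiniteSupport ⟨δ, hδ⟩
  rcases eq_or_ne δ p with rfl | h
  · exact hlead _ hp
  · exact trans_of P.lt (hp.2 δ hδ h) (hlead _ hp)

theorem isLeading_mul (α β : Fin n → ℕ) :
    IsLeading P.lt (P.basis.repr (P.basis α * P.basis β)) (α + β) := by
  have := P.lt_isStrictTotalOrder
  obtain ⟨c, hc, f, hf, hlt⟩ := P.exists_mul_eq α β
  have h0 : P.basis.repr f (α + β) = 0 := by
    by_contra h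
    exact irrefl_of P.lt _ (hlt _ h)
  rw [hf]
  refine ⟨by simpa [h0] using hc, fun q hq hne => hlt q ?_⟩
  simpa [Finsupp.single_apply, hne.symm] using hq

/-- The monomial `1` is a factor of `a^α = a^α · 1 · 1`, so axiom (i) applies. -/
theorem zero_lt {α : Fin n → ℕ} (h : α ≠ 0) : P.lt 0 α := by
  refine P.lt_of_leading α 0 0 α h h.symm ?_
  have := P.isLeading_mul α 0
  simpa [basis_zero] using this

theorem lt_add_left {α β : Fin n → ℕ} (γ : Fin n → ℕ) (h : P.lt α β) :
    P.lt (γ + α) (γ + β) := by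
  have := P.lt_isStrictTotalOrder
  refine P.lt_mul γ α β 0 _ _ h (by simpa [basis_zero] using P.isLeading_mul γ α)
    -- Axiom (ii) excludes the leading monomial `1`. Here that would force `β = 0`, and nothing lies
    -- below `1`.
    (by simpa [basis_zero] using P.isLeading_mul γ β) fun h0 => ?_
  have hβ : β = 0 := by
    funext i
    have := congrFun h0 i
    simp at this
    simp [this.2]
  subst hβ
  rcases eq_or_ne α 0 with rfl | hα
  · exact irrefl_of P.lt _ h
  · exact asymm_of P.lt h (P.zero_lt hα)

/-! ### Coefficients -/

/-- The monomials `a^α eᵢ` form a `K`-basis of `A^r`. -/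
noncomputable def basisE (r : ℕ) : Module.Basis ((Fin n → ℕ) × Fin r) K (Fin r → A) :=
  (Pi.basis fun _ : Fin r => P.basis).reindex
    ((Equiv.sigmaEquivProd _ _).trans (Equiv.prodComm _ _))

variable {r : ℕ}

theorem basisE_apply (p : (Fin n → ℕ) × Fin r) : P.basisE r p = P.monE p := by
  simp [basisE, monE, Pi.basis_apply]

theorem basisE_repr (ξ : Fin r → A) (p : (Fin n → ℕ) × Fin r) :
    (P.basisE r).repr ξ p = P.coeff ξ p := by
  rw [basisE, Module.Basis.repr_reindex_apply, Pi.basis_repr]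
  rfl

@[simp] theorem coeff_zero (p : (Fin n → ℕ) × Fin r) : P.coeff 0 p = 0 := by simp [coeff]

@[simp] theorem coeff_add (ξ η : Fin r → A) (p : (Fin n → ℕ) × Fin r) :
    P.coeff (ξ + η) p = P.coeff ξ p + P.coeff η p := by simp [coeff]

@[simp] theorem coeff_sub (ξ η : Fin r → A) (p : (Fin n → ℕ) × Fin r) :
    P.coeff (ξ - η) p = P.coeff ξ p - P.coeff η p := by simp [coeff]

@[simp] theorem coeff_smul (c : K) (ξ : Fin r → A) (p : (Fin n → ℕ) × Fin r) :
    P.coeff (c • ξ) p = c * P.coeff ξ p := by simp [coeff]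

theorem coeff_monE (p q : (Fin n → ℕ) × Fin r) [Decidable (p = q)] :
    P.coeff (P.monE p) q = if p = q then 1 else 0 := by
  rw [← basisE_repr, ← basisE_apply, Module.Basis.repr_self, Finsupp.single_apply]

@[simp] theorem coeff_monE_self (p : (Fin n → ℕ) × Fin r) : P.coeff (P.monE p) p = 1 := by
  classical simp [coeff_monE]

theorem coeff_monE_ne {p q : (Fin n → ℕ) × Fin r} (h : q ≠ p) : P.coeff (P.monE p) q = 0 := by
  classical simp [coeff_monE, h.symm]

theorem ext_coeff {ξ η : Fin r → A} (h : ∀ p, P.coeff ξ p = P.coeff η p) : ξ = η :=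
  (P.basisE r).ext_elem fun p => by simpa only [basisE_repr] using h p

theorem exists_coeff_ne {ξ : Fin r → A} (h : ξ ≠ 0) : ∃ p, P.coeff ξ p ≠ 0 := by
  by_contra! h'
  exact h (P.ext_coeff fun p => by simp [h' p])

theorem finite_coeff (ξ : Fin r → A) : {p | P.coeff ξ p ≠ 0}.Finite := by
  have := ((P.basisE r).repr ξ).hasFiniteSupport
  refine this.subset fun p hp => ?_
  simpa [basisE_repr] using hp

/-- Reduces linear claims about an element to its monomials: the claim is phrased as membership in a
`K`-subspace, such as a preimage, a kernel or an equalizer. -/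
theorem mem_of_monE_mem {S : Submodule K (Fin r → A)} {ξ : Fin r → A}
    (h : ∀ p, P.coeff ξ p ≠ 0 → P.monE p ∈ S) : ξ ∈ S := by
  rw [← (P.basisE r).linearCombination_repr ξ, Finsupp.linearCombination_apply]
  refine S.sum_mem fun p hp => S.smul_mem _ ?_
  rw [basisE_apply]
  apply h
  simpa [basisE_repr] using hp

/-- The elements all of whose monomials satisfy `s`. -/
def supportedIn (s : Set ((Fin n → ℕ) × Fin r)) : Submodule K (Fin r → A) where
  carrier := {ξ | ∀ p, P.coeff ξ p ≠ 0 → p ∈ s}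
  zero_mem' := by simp
  add_mem' {ξ η} hξ hη p hp := by
    by_cases h : P.coeff ξ p = 0
    · exact hη p (by simpa [h] using hp)
    · exact hξ p h
  smul_mem' c ξ hξ p hp := hξ p fun h => hp (by simp [h])

theorem monE_mem_supportedIn {s : Set ((Fin n → ℕ) × Fin r)} {p : (Fin n → ℕ) × Fin r}
    (h : p ∈ s) : P.monE p ∈ P.supportedIn s := fun q hq => by
  by_cases hqp : q = p
  · exact hqp ▸ h
  · exact absurd (P.coeff_monE_ne hqp) hq

theorem smul_smulK (f : A) (c : K) (ξ : Fin r → A) : f • c • ξ = c • f • ξ := by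
  ext i; simp

theorem smulK_smul (c : K) (f : A) (ξ : Fin r → A) : (c • f) • ξ = c • f • ξ := by
  ext i; simp

theorem algebraMap_smul' (c : K) (ξ : Fin r → A) : algebraMap K A c • ξ = c • ξ := by
  ext i; simp [Algebra.smul_def]

/-- Left multiplication by an element of `A`, as a `K`-linear map. -/
def lmul (r : ℕ) (f : A) : (Fin r → A) →ₗ[K] (Fin r → A) where
  toFun ξ := f • ξ
  map_add' := smul_add f
  map_smul' c ξ := smul_smulK f c ξ

/-- An `A`-linear map between free modules is `K`-linear. -/
def restrictK {s : ℕ} (φ : (Fin r → A) →ₗ[A] (Fin s → A)) : (Fin r → A) →ₗ[K] (Fin s → A) where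
  toFun := φ
  map_add' := map_add φ
  map_smul' c ξ := by
    rw [← algebraMap_smul', map_smul, algebraMap_smul']; rfl

/-! ### Left monomial orderings -/

/-- The monomial `a^(γ+α) eᵢ`, for `p = a^α eᵢ`. -/
def shift (γ : Fin n → ℕ) (p : (Fin n → ℕ) × Fin r) : (Fin n → ℕ) × Fin r := (γ + p.1, p.2)

@[simp] theorem shift_zero (p : (Fin n → ℕ) × Fin r) : shift 0 p = p := by simp [shift]

theorem shift_shift (γ δ : Fin n → ℕ) (p : (Fin n → ℕ) × Fin r) :
    shift γ (shift δ p) = shift (γ + δ) p := by simp [shift, add_assoc]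

theorem shift_left_cancel {γ δ : Fin n → ℕ} {p : (Fin n → ℕ) × Fin r}
    (h : shift γ p = shift δ p) : γ = δ := by
  simpa [shift] using h

variable {P}
variable {ltE : (Fin n → ℕ) × Fin r → (Fin n → ℕ) × Fin r → Prop}

theorem IsLM.eq (h : P.IsLeftMonomialOrder ltE) {ξ : Fin r → A} {p q : (Fin n → ℕ) × Fin r}
    (hp : P.IsLM ltE ξ p) (hq : P.IsLM ltE ξ q) : p = q :=
  have := h.total
  IsLeading.eq hp hq

theorem IsLM.ne_zero {ξ : Fin r → A} {p : (Fin n → ℕ) × Fin r}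
    (hp : P.IsLM ltE ξ p) : ξ ≠ 0 := by
  rintro rfl
  exact hp.1 (by simp)

theorem exists_isLM (h : P.IsLeftMonomialOrder ltE) {ξ : Fin r → A} (hξ : ξ ≠ 0) :
    ∃ p, P.IsLM ltE ξ p :=
  have := h.total
  exists_isLeading (P.finite_coeff ξ) (P.exists_coeff_ne hξ)

theorem isLM_iff (h : P.IsLeftMonomialOrder ltE) {ξ : Fin r → A} {p : (Fin n → ℕ) × Fin r} :
    P.IsLM ltE ξ p ↔ P.coeff ξ p ≠ 0 ∧ ξ - P.coeff ξ p • P.monE p ∈ P.supportedIn {q | ltE q p} := by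
  have := h.total
  constructor
  · intro hp
    refine ⟨hp.1, fun q hq => ?_⟩
    rcases eq_or_ne q p with rfl | hqp
    · simp at hq
    · exact hp.2 q (by simpa [P.coeff_monE_ne hqp] using hq) hqp
  · rintro ⟨h1, h2⟩
    refine ⟨h1, fun q hq hqp => h2 q ?_⟩
    simpa [P.coeff_monE_ne hqp] using hq

theorem coeff_eq_zero_of_below (h : P.IsLeftMonomialOrder ltE) {ξ : Fin r → A}
    {p : (Fin n → ℕ) × Fin r} (hξ : ξ ∈ P.supportedIn {q | ltE q p}) : P.coeff ξ p = 0 := by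
  have := h.total
  by_contra h'
  exact irrefl_of ltE p (hξ p h')

theorem IsLM.add (h : P.IsLeftMonomialOrder ltE) {ξ η : Fin r → A} {p : (Fin n → ℕ) × Fin r}
    (hp : P.IsLM ltE ξ p) (hη : η ∈ P.supportedIn {q | ltE q p}) : P.IsLM ltE (ξ + η) p := by
  refine ⟨by simpa [coeff_eq_zero_of_below h hη] using hp.1, fun q hq hqp => ?_⟩
  by_cases h' : P.coeff ξ q = 0
  · exact hη q (by simpa [h'] using hq)
  · exact hp.2 q h' hqp

theorem IsLM.smulK {ξ : Fin r → A} {p : (Fin n → ℕ) × Fin r}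
    (hp : P.IsLM ltE ξ p) {c : K} (hc : c ≠ 0) : P.IsLM ltE (c • ξ) p :=
  ⟨by simpa [hc] using hp.1, fun q hq hqp => hp.2 q (by simp_all) hqp⟩

theorem isLM_monE (p : (Fin n → ℕ) × Fin r) : P.IsLM ltE (P.monE p) p :=
  ⟨by simp, fun _ hq hqp => absurd (P.coeff_monE_ne hqp) hq⟩

theorem IsLM.mem_below (h : P.IsLeftMonomialOrder ltE) {ξ : Fin r → A}
    {p q : (Fin n → ℕ) × Fin r} (hp : P.IsLM ltE ξ p) (hpq : ltE p q) :
    ξ ∈ P.supportedIn {u | ltE u q} := fun u hu => by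
  have := h.total
  rcases eq_or_ne u p with rfl | hup
  · exact hpq
  · exact trans_of ltE (hp.2 u hu hup) hpq

theorem smul_monE_apply (γ : Fin n → ℕ) (p : (Fin n → ℕ) × Fin r) :
    P.basis γ • P.monE p = Pi.single p.2 (P.basis γ * P.basis p.1) := by
  ext i
  rcases eq_or_ne i p.2 with rfl | hi
  · simp [monE]
  · simp [monE, hi]

theorem coeff_single_ne_zero {i : Fin r} {f : A} {p : (Fin n → ℕ) × Fin r}
    (h : P.coeff (Pi.single i f) p ≠ 0) : p.2 = i ∧ P.basis.repr f p.1 ≠ 0 := by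
  unfold coeff at h
  rcases eq_or_ne p.2 i with hi | hi
  · rw [hi, Pi.single_eq_same] at h
    exact ⟨hi, h⟩
  · rw [Pi.single_eq_of_ne hi] at h
    simp at h

/-- All monomials of the product involve one basis vector, so compatibility with the ordering of `A`
suffices. The lemma is thus available while a relation is still being shown to be a left monomial
ordering. -/
theorem isLM_smul_monE_of_compat (compat : ∀ α β i, P.lt α β → ltE (α, i) (β, i)) (γ : Fin n → ℕ)
    (p : (Fin n → ℕ) × Fin r) : P.IsLM ltE (P.basis γ • P.monE p) (shift γ p) := by
  rw [smul_monE_apply]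
  have hl := P.isLeading_mul γ p.1
  refine ⟨by simpa [coeff, shift] using hl.1, fun q hq hqp => ?_⟩
  obtain ⟨h1, h2⟩ := coeff_single_ne_zero hq
  obtain ⟨α, i⟩ := q
  simp only at h1 h2
  subst h1
  refine compat _ _ _ (hl.2 α h2 ?_)
  rintro rfl
  exact hqp rfl

theorem isLM_smul_monE (h : P.IsLeftMonomialOrder ltE) (γ : Fin n → ℕ)
    (p : (Fin n → ℕ) × Fin r) : P.IsLM ltE (P.basis γ • P.monE p) (shift γ p) :=
  isLM_smul_monE_of_compat h.compat γ p

theorem lt_shift (h : P.IsLeftMonomialOrder ltE) (γ : Fin n → ℕ) {p q : (Fin n → ℕ) × Fin r}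
    (hpq : ltE p q) : ltE (shift γ p) (shift γ q) :=
  h.smul γ p q _ _ hpq (isLM_smul_monE h γ p) (isLM_smul_monE h γ q)

theorem lt_shift_self (h : P.IsLeftMonomialOrder ltE) {γ : Fin n → ℕ} (hγ : γ ≠ 0)
    (p : (Fin n → ℕ) × Fin r) : ltE p (shift γ p) := by
  have := h.compat (p.1 + 0) (p.1 + γ) p.2 (P.lt_add_left p.1 (P.zero_lt hγ))
  simpa [shift, add_comm] using this

theorem smul_mem_below (h : P.IsLeftMonomialOrder ltE) (γ : Fin n → ℕ) {ξ : Fin r → A}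
    {p : (Fin n → ℕ) × Fin r} (hξ : ξ ∈ P.supportedIn {q | ltE q p}) :
    P.basis γ • ξ ∈ P.supportedIn {q | ltE q (shift γ p)} := by
  suffices ξ ∈ (P.supportedIn {q | ltE q (shift γ p)}).comap (lmul r (P.basis γ)) from this
  refine P.mem_of_monE_mem fun q hq => ?_
  exact (isLM_smul_monE h γ q).mem_below h (lt_shift h γ (hξ q hq))

theorem IsLM.smul (h : P.IsLeftMonomialOrder ltE) {ξ : Fin r → A} {p : (Fin n → ℕ) × Fin r}
    (hp : P.IsLM ltE ξ p) (γ : Fin n → ℕ) : P.IsLM ltE (P.basis γ • ξ) (shift γ p) := by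
  have h1 := (isLM_iff h).1 hp
  have h2 := ((isLM_smul_monE h γ p).smulK h1.1).add h (smul_mem_below h γ h1.2)
  rwa [← smul_smulK, ← smul_add, add_sub_cancel] at h2

theorem leftDvd_iff (h : P.IsLeftMonomialOrder ltE) {p q : (Fin n → ℕ) × Fin r} :
    P.LeftDvd ltE p q ↔ ∃ γ, q = shift γ p :=
  ⟨fun ⟨γ, hγ⟩ => ⟨γ, hγ.eq h (isLM_smul_monE h γ p)⟩,
    fun ⟨γ, hγ⟩ => ⟨γ, hγ ▸ isLM_smul_monE h γ p⟩⟩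

theorem leftDvd_iff_le (h : P.IsLeftMonomialOrder ltE) {p q : (Fin n → ℕ) × Fin r} :
    P.LeftDvd ltE p q ↔ p.2 = q.2 ∧ p.1 ≤ q.1 := by
  rw [leftDvd_iff h]
  constructor
  · rintro ⟨γ, rfl⟩
    exact ⟨rfl, fun i => by simp [shift]⟩
  · rintro ⟨h1, h2⟩
    refine ⟨q.1 - p.1, Prod.ext ?_ h1.symm⟩
    exact (tsub_add_cancel_of_le h2).symm

/-- By Dickson's lemma an infinite sequence of monomials contains an earlier one dividing a later
one, and a monomial is never larger than its multiples. A strictly descending sequence is therefore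
impossible, although the definition asks only for a total ordering. -/
theorem wellFounded_ltE (h : P.IsLeftMonomialOrder ltE) : WellFounded ltE := by
  have := h.total
  have wqo : WellQuasiOrdered fun p q : (Fin n → ℕ) × Fin r => p.1 ≤ q.1 ∧ p.2 = q.2 :=
    WellQuasiOrdered.prod (wellQuasiOrdered_le) (Finite.wellQuasiOrdered (· = ·))
  rw [RelEmbedding.wellFounded_iff_isEmpty]
  refine ⟨fun f => ?_⟩
  obtain ⟨i, j, hij, h1, h2⟩ := wqo f
  have hlt : ltE (f j) (f i) := f.map_rel_iff.2 hij
  obtain ⟨γ, hγ⟩ := (leftDvd_iff h).1 ((leftDvd_iff_le h).2 ⟨h2, h1⟩)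
  rcases eq_or_ne γ 0 with rfl | h0
  · rw [hγ, shift_zero] at hlt
    exact irrefl_of ltE _ hlt
  · rw [hγ] at hlt
    exact asymm_of ltE hlt (lt_shift_self h h0 _)

theorem IsLeftMonomialOrder.of_shift (total : IsStrictTotalOrder _ ltE)
    (compat : ∀ α β i, P.lt α β → ltE (α, i) (β, i))
    (hshift : ∀ γ p q, ltE p q → ltE (shift γ p) (shift γ q)) : P.IsLeftMonomialOrder ltE := by
  have hmon : ∀ γ (p q : (Fin n → ℕ) × Fin r), P.IsLM ltE (P.basis γ • P.monE p) q →
      q = shift γ p := fun γ p q hq => IsLeading.eq hq (isLM_smul_monE_of_compat compat γ p)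
  refine ⟨total, fun γ p q p' q' hpq hp' hq' => ?_, compat⟩
  rw [hmon _ _ _ hp', hmon _ _ _ hq']
  exact hshift γ p q hpq

theorem exists_isLeftMonomialOrder (P : GradedSolvablePolynomialAlgebra K A n) (r : ℕ) :
    ∃ ltE : (Fin n → ℕ) × Fin r → (Fin n → ℕ) × Fin r → Prop, P.IsLeftMonomialOrder ltE := by
  have := P.lt_isStrictTotalOrder
  -- Position over term: basis vectors are compared first, exponents second.
  let ltE : (Fin n → ℕ) × Fin r → (Fin n → ℕ) × Fin r → Prop :=
    fun p q => p.2 < q.2 ∨ p.2 = q.2 ∧ P.lt p.1 q.1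
  refine ⟨ltE, .of_shift ?_ (fun α β i h => Or.inr ⟨rfl, h⟩) ?_⟩
  · exact
    { trichotomous := by
        rintro ⟨a, i⟩ ⟨b, j⟩ h1 h2
        simp only [ltE, not_or, not_and] at h1 h2
        obtain rfl : i = j := le_antisymm (not_lt.1 h2.1) (not_lt.1 h1.1)
        rcases trichotomous_of P.lt a b with h | h | h
        · exact absurd h (h1.2 rfl)
        · rw [h]
        · exact absurd h (h2.2 rfl)
      irrefl := by
        rintro ⟨a, i⟩ (h | ⟨-, h⟩)
        · exact lt_irrefl _ h
        · exact irrefl_of P.lt _ h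
      trans := by
        rintro ⟨a, i⟩ ⟨b, j⟩ ⟨c, k⟩ (h | ⟨h, h'⟩) (g | ⟨g, g'⟩)
        · exact Or.inl (lt_trans h g)
        · simp only at h g; subst g; exact Or.inl h
        · simp only at h g; subst h; exact Or.inl g
        · simp only at h g; subst h; subst g; exact Or.inr ⟨rfl, trans_of P.lt h' g'⟩ }
  · rintro γ p q (h | ⟨h, h'⟩)
    · exact Or.inl h
    · exact Or.inr ⟨h, P.lt_add_left γ h'⟩

/-! ### Degrees -/

variable (P)

theorem weight_add (α β : Fin n → ℕ) : P.weight (α + β) = P.weight α + P.weight β := by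
  simp [weight, add_mul, Finset.sum_add_distrib]

@[simp] theorem weight_zero : P.weight 0 = 0 := by simp [weight]

theorem weight_eq_zero {α : Fin n → ℕ} (h : P.weight α = 0) : α = 0 := by
  funext i
  have := (Finset.sum_eq_zero_iff.1 h) i (Finset.mem_univ i)
  simpa [(P.wt_pos i).ne'] using this

theorem mem_part {f : A} {p : ℕ} :
    f ∈ P.part p ↔ ∀ α, P.basis.repr f α ≠ 0 → P.weight α = p := by
  have : {x | ∃ α, P.weight α = p ∧ x = P.basis α} = P.basis '' {α | P.weight α = p} := by
    ext x; simp [eq_comm]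
  rw [part, this, Module.Basis.mem_span_image]
  simp [Set.subset_def]

theorem mul_mem_part {f g : A} {p q : ℕ} (hf : f ∈ P.part p) (hg : g ∈ P.part q) :
    f * g ∈ P.part (p + q) := P.mul_mem p q f g hf hg

theorem basis_mem_part (α : Fin n → ℕ) : P.basis α ∈ P.part (P.weight α) :=
  Submodule.subset_span ⟨α, rfl, rfl⟩

theorem one_mem_part : (1 : A) ∈ P.part 0 := by
  simpa [basis_zero] using P.basis_mem_part 0

/-- As all variables have positive degree, `1` is the only monomial of degree zero. -/
theorem eq_algebraMap_of_mem_part_zero {f : A} (h : f ∈ P.part 0) :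
    f = algebraMap K A (P.basis.repr f 0) := by
  apply P.basis.ext_elem
  intro α
  rw [Algebra.algebraMap_eq_smul_one, ← P.basis_zero]
  rcases eq_or_ne α 0 with rfl | hα
  · simp
  · have : P.basis.repr f α = 0 := by
      by_contra h'
      exact hα (P.weight_eq_zero (P.mem_part.1 h α h'))
    simp [this, hα.symm]

theorem repr_algebraMap_zero (c : K) : P.basis.repr (algebraMap K A c) 0 = c := by
  rw [Algebra.algebraMap_eq_smul_one, ← P.basis_zero]
  simp

variable (b : Fin r → ℕ)

theorem mem_freePart {ξ : Fin r → A} {q : ℕ} :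
    ξ ∈ P.freePart b q ↔ ∀ p, P.coeff ξ p ≠ 0 → P.weight p.1 + b p.2 = q := by
  have : {x | ∃ p : (Fin n → ℕ) × Fin r, P.weight p.1 + b p.2 = q ∧ x = P.monE p} =
      P.basisE r '' {p | P.weight p.1 + b p.2 = q} := by
    ext x; simp [basisE_apply, eq_comm]
  rw [freePart, this, Module.Basis.mem_span_image]
  simp [Set.subset_def, basisE_repr]

theorem monE_mem_freePart (p : (Fin n → ℕ) × Fin r) :
    P.monE p ∈ P.freePart b (P.weight p.1 + b p.2) :=
  Submodule.subset_span ⟨p, rfl, rfl⟩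

theorem apply_mem_part {ξ : Fin r → A} {q : ℕ} (h : ξ ∈ P.freePart b q) {i : Fin r}
    (hi : b i ≤ q) : ξ i ∈ P.part (q - b i) :=
  P.mem_part.2 fun α hα => by
    have := (P.mem_freePart b).1 h (α, i) hα
    simp only at this
    omega

theorem apply_eq_zero {ξ : Fin r → A} {q : ℕ} (h : ξ ∈ P.freePart b q) {i : Fin r}
    (hi : q < b i) : ξ i = 0 := by
  by_contra h0
  obtain ⟨α, hα⟩ := Finsupp.ne_iff.1 fun h' => h0 (P.basis.repr.map_eq_zero_iff.1 h')
  have := (P.mem_freePart b).1 h (α, i) hα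
  simp only at this
  omega

theorem mem_freePart_of_apply {ξ : Fin r → A} {q : ℕ}
    (h : ∀ i, ξ i ≠ 0 → ∃ p, ξ i ∈ P.part p ∧ p + b i = q) : ξ ∈ P.freePart b q := by
  refine (P.mem_freePart b).2 fun p hp => ?_
  have h0 : ξ p.2 ≠ 0 := fun h' => hp (by simp [coeff, h'])
  obtain ⟨d, h1, h2⟩ := h _ h0
  rw [P.mem_part.1 h1 _ hp, h2]

variable {b}

theorem smul_mem_freePart {f : A} {ξ : Fin r → A} {p q : ℕ} (hf : f ∈ P.part p)
    (hξ : ξ ∈ P.freePart b q) : f • ξ ∈ P.freePart b (p + q) := by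
  refine P.mem_freePart_of_apply b fun i hi => ?_
  by_cases hb : b i ≤ q
  · exact ⟨_, P.mul_mem_part hf (P.apply_mem_part b hξ hb), by omega⟩
  · rw [Pi.smul_apply, P.apply_eq_zero b hξ (not_le.1 hb), smul_zero] at hi
    exact absurd rfl hi

theorem freePart_degree_unique {ξ : Fin r → A} (h0 : ξ ≠ 0) {p q : ℕ}
    (hp : ξ ∈ P.freePart b p) (hq : ξ ∈ P.freePart b q) : p = q := by
  obtain ⟨u, hu⟩ := P.exists_coeff_ne h0
  rw [← (P.mem_freePart b).1 hp u hu, (P.mem_freePart b).1 hq u hu]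

variable (b) in
/-- The homogeneous component of degree `q`. -/
noncomputable def component (q : ℕ) : (Fin r → A) →ₗ[K] (Fin r → A) :=
  (P.basisE r).constr K fun p =>
    open scoped Classical in if P.weight p.1 + b p.2 = q then P.monE p else 0

theorem component_of_mem {ξ : Fin r → A} {q : ℕ} (h : ξ ∈ P.freePart b q) :
    P.component b q ξ = ξ := by
  suffices ξ ∈ LinearMap.eqLocus (P.component b q) LinearMap.id from this
  refine P.mem_of_monE_mem fun p hp => ?_
  rw [LinearMap.mem_eqLocus, ← basisE_apply, component, Module.Basis.constr_basis,
    if_pos ((P.mem_freePart b).1 h p hp), basisE_apply]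
  rfl

theorem component_of_mem_ne {ξ : Fin r → A} {q q' : ℕ} (h : ξ ∈ P.freePart b q') (hq : q' ≠ q) :
    P.component b q ξ = 0 := by
  suffices ξ ∈ LinearMap.ker (P.component b q) from this
  refine P.mem_of_monE_mem fun p hp => ?_
  rw [LinearMap.mem_ker, ← basisE_apply, component, Module.Basis.constr_basis,
    if_neg fun h' => hq (((P.mem_freePart b).1 h p hp).symm.trans h')]

theorem component_mem (ξ : Fin r → A) (q : ℕ) : P.component b q ξ ∈ P.freePart b q := by
  suffices ξ ∈ (P.freePart b q).comap (P.component b q) from this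
  refine P.mem_of_monE_mem fun p _ => ?_
  rw [Submodule.mem_comap, ← basisE_apply, component, Module.Basis.constr_basis]
  split_ifs with h
  · exact h ▸ P.monE_mem_freePart b p
  · exact zero_mem _

theorem coeff_component (ξ : Fin r → A) {q : ℕ} {p : (Fin n → ℕ) × Fin r}
    (h : P.weight p.1 + b p.2 = q) : P.coeff (P.component b q ξ) p = P.coeff ξ p := by
  let f : (Fin r → A) →ₗ[K] K := (Finsupp.lapply p).comp (P.basisE r).repr.toLinearMap
  have hf : ∀ η, f η = P.coeff η p := fun η => P.basisE_repr η p
  suffices ξ ∈ LinearMap.eqLocus (f.comp (P.component b q)) f by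
    simpa [hf] using this
  refine P.mem_of_monE_mem fun u _ => ?_
  rw [LinearMap.mem_eqLocus, LinearMap.comp_apply]
  by_cases hu : P.weight u.1 + b u.2 = q
  · rw [P.component_of_mem (hu ▸ P.monE_mem_freePart b u)]
  · rw [P.component_of_mem_ne (P.monE_mem_freePart b u) hu, map_zero, hf, P.coeff_monE_ne]
    rintro rfl
    exact hu h

theorem exists_sum_component (ξ : Fin r → A) :
    ∃ s : Finset ℕ, ∀ t, s ⊆ t → ∑ q ∈ t, P.component b q ξ = ξ := by
  refine ⟨(P.finite_coeff ξ).toFinset.image fun p => P.weight p.1 + b p.2, fun t ht => ?_⟩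
  suffices ξ ∈ LinearMap.eqLocus (∑ q ∈ t, P.component b q) LinearMap.id by
    simpa using this
  refine P.mem_of_monE_mem fun p hp => ?_
  have hpt := ht (Finset.mem_image_of_mem _ ((P.finite_coeff ξ).mem_toFinset.2 hp))
  rw [LinearMap.mem_eqLocus, LinearMap.sum_apply, Finset.sum_eq_single _ _ fun h => absurd hpt h]
  · exact P.component_of_mem (P.monE_mem_freePart b p)
  · exact fun q _ hq => P.component_of_mem_ne (P.monE_mem_freePart b p) hq.symm

theorem component_map {s : ℕ} {b' : Fin s → ℕ} (φ : (Fin r → A) →ₗ[A] (Fin s → A))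
    (hφ : ∀ q, ∀ ξ ∈ P.freePart b q, φ ξ ∈ P.freePart b' q) (q : ℕ) (ξ : Fin r → A) :
    P.component b' q (φ ξ) = φ (P.component b q ξ) := by
  suffices ξ ∈ LinearMap.eqLocus ((P.component b' q).comp (restrictK φ))
      ((restrictK φ).comp (P.component b q)) from this
  refine P.mem_of_monE_mem fun p _ => ?_
  have hp := P.monE_mem_freePart b p
  have hp' : restrictK (K := K) φ (P.monE p) ∈ P.freePart b' _ := hφ _ _ hp
  rw [LinearMap.mem_eqLocus, LinearMap.comp_apply, LinearMap.comp_apply]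
  by_cases h : P.weight p.1 + b p.2 = q
  · subst h
    rw [P.component_of_mem hp, P.component_of_mem hp']
  · rw [P.component_of_mem_ne hp h, P.component_of_mem_ne hp' h, map_zero]

theorem map_mem_freePart {s : ℕ} {b' : Fin s → ℕ} (φ : (Fin r → A) →ₗ[A] (Fin s → A))
    (hφ : ∀ i, φ (Pi.single i 1) ∈ P.freePart b' (b i)) {q : ℕ} {ξ : Fin r → A}
    (hξ : ξ ∈ P.freePart b q) : φ ξ ∈ P.freePart b' q := by
  suffices ξ ∈ (P.freePart b' q).comap (restrictK φ) from this
  refine P.mem_of_monE_mem fun p hp => ?_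
  have : P.monE p = P.basis p.1 • Pi.single p.2 1 := by
    rw [monE, ← Pi.single_smul', smul_eq_mul, mul_one]
  rw [Submodule.mem_comap, this]
  change φ _ ∈ _
  rw [map_smul, ← (P.mem_freePart b).1 hξ p hp]
  exact P.smul_mem_freePart (P.basis_mem_part _) (hφ _)

end GradedSolvablePolynomialAlgebra

namespace GradedSolvablePolynomialAlgebra

variable {K A : Type*} [Field K] [Ring A] [Algebra K A] {n : ℕ}
  (P : GradedSolvablePolynomialAlgebra K A n) {r : ℕ}
  {ltE : (Fin n → ℕ) × Fin r → (Fin n → ℕ) × Fin r → Prop}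

/-! ### Row vectors -/

/-- The combination of the members of a list with the coefficients given by a row vector. -/
noncomputable def rowEval {M : Type*} [AddCommGroup M] [Module A M] (L : List M) :
    (ℕ →₀ A) →ₗ[A] M :=
  Finsupp.linearCombination A fun k => L.getD k 0

theorem rowEval_single {M : Type*} [AddCommGroup M] [Module A M] {L : List M} {i : ℕ} {x : M}
    (h : L[i]? = some x) (f : A) : rowEval L (Finsupp.single i f) = f • x := by
  simp [rowEval, List.getD_eq_getElem?_getD, h]

theorem rowEval_mem_span {M : Type*} [AddCommGroup M] [Module A M] (L : List M) (c : ℕ →₀ A) :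
    rowEval L c ∈ Submodule.span A {x | x ∈ L} := by
  rw [rowEval, Finsupp.linearCombination_apply]
  refine Submodule.sum_mem _ fun k _ => Submodule.smul_mem _ _ ?_
  simp only [List.getD_eq_getElem?_getD]
  rcases h : L[k]? with _ | x
  · simp
  · exact Submodule.subset_span (List.mem_of_getElem? h)

/-- The degree of a nonzero homogeneous element. -/
noncomputable def degOf (b : Fin r → ℕ) (ξ : Fin r → A) : ℕ := sInf {d | ξ ∈ P.freePart b d}

variable {P}

theorem degOf_eq {b : Fin r → ℕ} {ξ : Fin r → A} {d : ℕ} (h0 : ξ ≠ 0)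
    (h : ξ ∈ P.freePart b d) : P.degOf b ξ = d :=
  P.freePart_degree_unique h0 (Nat.sInf_mem (s := {d | ξ ∈ P.freePart b d}) ⟨d, h⟩) h

theorem IsHomog.mem_degOf {b : Fin r → ℕ} {ξ : Fin r → A} (h : P.IsHomog b ξ) :
    ξ ∈ P.freePart b (P.degOf b ξ) :=
  Nat.sInf_mem (s := {d | ξ ∈ P.freePart b d}) h.2

variable (P) in
/-- The row vector `c` is homogeneous of degree `d`, where the `k`-th unit vector has the degree of
the `k`-th member of `L`. -/
def HomogRow (b : Fin r → ℕ) (L : List (Fin r → A)) (d : ℕ) (c : ℕ →₀ A) : Prop :=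
  ∀ k α, P.basis.repr (c k) α ≠ 0 → k < L.length ∧ P.weight α + P.degOf b (L.getD k 0) = d

namespace HomogRow

variable {b : Fin r → ℕ} {L : List (Fin r → A)} {d : ℕ} {c c' : ℕ →₀ A}

theorem zero : P.HomogRow b L d 0 := fun k α h => by simp at h

theorem add (h : P.HomogRow b L d c) (h' : P.HomogRow b L d c') :
    P.HomogRow b L d (c + c') := fun k α hα => by
  by_cases h0 : P.basis.repr (c k) α = 0
  · exact h' k α (by simpa [h0] using hα)
  · exact h k α h0

theorem neg (h : P.HomogRow b L d c) : P.HomogRow b L d (-c) := fun k α hα =>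
  h k α (by simpa using hα)

theorem sub (h : P.HomogRow b L d c) (h' : P.HomogRow b L d c') :
    P.HomogRow b L d (c - c') := sub_eq_add_neg c c' ▸ h.add h'.neg

theorem sum {ι : Type*} {s : Finset ι} {c : ι → ℕ →₀ A} (h : ∀ i ∈ s, P.HomogRow b L d (c i)) :
    P.HomogRow b L d (∑ i ∈ s, c i) := by
  classical
  induction s using Finset.induction_on with
  | empty => simpa using zero
  | insert i s hi ih =>
    rw [Finset.sum_insert hi]
    exact (h i (by simp)).add (ih fun j hj => h j (by simp [hj]))

theorem single {i p : ℕ} {f : A} {x : Fin r → A} (hi : L[i]? = some x) (hf : f ∈ P.part p)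
    (hd : p + P.degOf b x = d) : P.HomogRow b L d (Finsupp.single i f) := fun k α hα => by
  rcases eq_or_ne i k with rfl | hik
  · obtain ⟨hlt, -⟩ := List.getElem?_eq_some_iff.1 hi
    refine ⟨hlt, ?_⟩
    rw [Finsupp.single_eq_same] at hα
    rw [List.getD_eq_getElem?_getD, hi, Option.getD_some, P.mem_part.1 hf α hα, hd]
  · simp [hik] at hα

theorem apply_mem (h : P.HomogRow b L d c) {k : ℕ} (hk : c k ≠ 0) :
    k < L.length ∧ ∃ p, p + P.degOf b (L.getD k 0) = d ∧ c k ∈ P.part p := by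
  obtain ⟨α, hα⟩ := Finsupp.ne_iff.1 fun h' => hk (P.basis.repr.map_eq_zero_iff.1 h')
  refine ⟨(h k α hα).1, P.weight α, (h k α hα).2, P.mem_part.2 fun β hβ => ?_⟩
  have h1 := (h k α hα).2
  have h2 := (h k β hβ).2
  omega

theorem of_apply (h : ∀ k, c k ≠ 0 → k < L.length ∧
    ∃ p, p + P.degOf b (L.getD k 0) = d ∧ c k ∈ P.part p) : P.HomogRow b L d c := fun k α hα => by
  have hk : c k ≠ 0 := fun h' => hα (by simp [h'])
  obtain ⟨h1, p, h2, h3⟩ := h k hk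
  exact ⟨h1, by rw [P.mem_part.1 h3 α hα, h2]⟩

theorem smul {f : A} {p : ℕ} (hf : f ∈ P.part p) (h : P.HomogRow b L d c) :
    P.HomogRow b L (p + d) (f • c) := by
  refine of_apply fun k hk => ?_
  have hk' : c k ≠ 0 := fun h' => hk (by simp [h'])
  obtain ⟨h1, q, h2, h3⟩ := h.apply_mem hk'
  exact ⟨h1, p + q, by omega, by simpa using P.mul_mem_part hf h3⟩

/-- The bound `k < L.length` in `HomogRow` makes the property, and the value of the row, stable when
the list grows during the computation. -/
theorem append (h : P.HomogRow b L d c) (L' : List (Fin r → A)) :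
    P.HomogRow b (L ++ L') d c := fun k α hα => by
  obtain ⟨h1, h2⟩ := h k α hα
  refine ⟨by simp; omega, ?_⟩
  rwa [List.getD_append _ _ _ _ h1]

end HomogRow

/-! ### Division -/

theorem IsLM.sub_mem_below {ξ η : Fin r → A}
    {p : (Fin n → ℕ) × Fin r} (hξ : P.IsLM ltE ξ p) (hη : P.IsLM ltE η p)
    (heq : P.coeff ξ p = P.coeff η p) : ξ - η ∈ P.supportedIn {q | ltE q p} := fun q hq => by
  rcases eq_or_ne q p with rfl | hqp
  · simp [heq] at hq
  · by_cases h0 : P.coeff ξ q = 0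
    · exact hη.2 q (by simpa [h0] using hq) hqp
    · exact hξ.2 q h0 hqp

/-- The properties of the multiplier that cancels a leading term. -/
theorem isLM_multiplier (h : P.IsLeftMonomialOrder ltE) {g : Fin r → A}
    {p p' : (Fin n → ℕ) × Fin r} {γ : Fin n → ℕ} (hg : P.IsLM ltE g p') (hp : shift γ p' = p)
    {c : K} (hc : c ≠ 0) :
    P.IsLM ltE (((P.coeff (P.basis γ • g) p)⁻¹ * c) • P.basis γ • g) p ∧
      P.coeff (((P.coeff (P.basis γ • g) p)⁻¹ * c) • P.basis γ • g) p = c := by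
  subst hp
  have h1 := hg.smul h γ
  have h2 : P.coeff (P.basis γ • g) (shift γ p') ≠ 0 := h1.1
  refine ⟨h1.smulK (mul_ne_zero (inv_ne_zero h2) hc), ?_⟩
  rw [coeff_smul]
  field_simp

namespace DivL

variable {G : List (Fin r → A)} {ω η : Fin r → A} {q : ℕ →₀ A}

theorem eval (hd : P.DivL ltE G ω q η) : rowEval G q + η = ω := by
  induction hd with
  | zero => simp
  | reduce ω p i g p' γ f q η hp hg hp' hdvd hleast hf rest ih =>
    rw [map_add, rowEval_single hg, add_assoc, ih]
    abel
  | move ω p q η hp hnone rest ih =>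
    rw [add_left_comm, ih]
    abel

theorem irreducible (hd : P.DivL ltE G ω q η) :
    ∀ u, P.coeff η u ≠ 0 → ∀ g ∈ G, ∀ p, P.IsLM ltE g p → ¬ P.LeftDvd ltE p u := by
  induction hd with
  | zero => simp
  | reduce ω p i g p' γ f q η hp hg hp' hdvd hleast hf rest ih => exact ih
  | move ω p q η hp hnone rest ih =>
    intro u hu
    rcases eq_or_ne u p with rfl | hup
    · exact hnone
    · exact ih u (by simpa [P.coeff_monE_ne hup] using hu)

/-- Division only subtracts multiples whose leading monomial is the current one of `ω`, so nothing
in the quotients or the remainder reaches a monomial above `ω`. This locates the leading monomials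
of the recorded syzygies. -/
theorem bound (h : P.IsLeftMonomialOrder ltE) (hd : P.DivL ltE G ω q η)
    {p : (Fin n → ℕ) × Fin r} (hω : ω ∈ P.supportedIn {u | ltE u p}) :
    η ∈ P.supportedIn {u | ltE u p} ∧ ∀ l α, P.basis.repr (q l) α ≠ 0 →
      ∃ g m, G[l]? = some g ∧ P.IsLM ltE g m ∧ ltE (shift α m) p := by
  induction hd with
  | zero => exact ⟨zero_mem _, by simp⟩
  | reduce ω u i g p' γ f q η hp hg hp' hdvd hleast hf rest ih =>
    have hu := hdvd.eq h (isLM_smul_monE h γ p')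
    subst hu
    have hlt : ltE (shift γ p') p := hω _ hp.1
    have h1 := isLM_multiplier h (γ := γ) hp' rfl hp.1
    have h2 : ω - f • g ∈ P.supportedIn {u | ltE u p} := by
      rw [hf, smulK_smul]
      exact sub_mem hω (h1.1.mem_below h hlt)
    obtain ⟨h3, h4⟩ := ih h2
    refine ⟨h3, fun l α hα => ?_⟩
    by_cases h0 : P.basis.repr (q l) α = 0
    · rw [Finsupp.add_apply, map_add, Finsupp.add_apply, h0, add_zero] at hα
      rcases eq_or_ne i l with rfl | hil
      · rw [Finsupp.single_eq_same, hf, map_smul, Module.Basis.repr_self, Finsupp.smul_apply] at hα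
        rcases eq_or_ne γ α with rfl | hγ
        · exact ⟨g, p', hg, hp', hlt⟩
        · simp [hγ] at hα
      · simp [hil] at hα
    · exact h4 l α h0
  | move ω u q η hp hnone rest ih =>
    have hu : P.coeff ω u • P.monE u ∈ P.supportedIn {u | ltE u p} :=
      Submodule.smul_mem _ _ (P.monE_mem_supportedIn (hω u hp.1))
    obtain ⟨h3, h4⟩ := ih (sub_mem hω hu)
    exact ⟨add_mem hu h3, h4⟩

/-- A multiple `a^γ g` sharing a leading monomial with `ω` has the degree of `ω`, so every
subtraction stays in that degree. -/
theorem homog (h : P.IsLeftMonomialOrder ltE) {b : Fin r → ℕ} (hG : ∀ g ∈ G, P.IsHomog b g)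
    (hd : P.DivL ltE G ω q η) {d : ℕ} (hω : ω ∈ P.freePart b d) :
    η ∈ P.freePart b d ∧ P.HomogRow b G d q := by
  induction hd with
  | zero => exact ⟨zero_mem _, HomogRow.zero⟩
  | reduce ω u i g p' γ f q η hp hg hp' hdvd hleast hf rest ih =>
    have hu := hdvd.eq h (isLM_smul_monE h γ p')
    subst hu
    have hgG := hG g (List.mem_of_getElem? hg)
    have hfp : f ∈ P.part (P.weight γ) := by
      rw [hf]
      exact Submodule.smul_mem _ _ (P.basis_mem_part γ)
    have hfg := P.smul_mem_freePart hfp hgG.mem_degOf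
    have hdeg : P.weight γ + P.degOf b g = d := by
      have h1 := (P.mem_freePart b).1 hgG.mem_degOf p' hp'.1
      have h2 := (P.mem_freePart b).1 hω _ hp.1
      simp only [shift, weight_add] at h2
      omega
    rw [hdeg] at hfg
    obtain ⟨h1, h2⟩ := ih (sub_mem hω hfg)
    exact ⟨h1, (HomogRow.single hg hfp hdeg).add h2⟩
  | move ω u q η hp hnone rest ih =>
    have hu : P.coeff ω u • P.monE u ∈ P.freePart b d := by
      refine Submodule.smul_mem _ _ ?_
      rw [← (P.mem_freePart b).1 hω u hp.1]
      exact P.monE_mem_freePart b u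
    obtain ⟨h3, h4⟩ := ih (sub_mem hω hu)
    exact ⟨add_mem hu h3, h4⟩

theorem exists_divL (h : P.IsLeftMonomialOrder ltE) (G : List (Fin r → A)) (ω : Fin r → A) :
    ∃ q η, P.DivL ltE G ω q η := by
  classical
  suffices ∀ p ω, P.IsLM ltE ω p → ∃ q η, P.DivL ltE G ω q η by
    rcases eq_or_ne ω 0 with rfl | h0
    · exact ⟨0, 0, DivL.zero⟩
    · obtain ⟨p, hp⟩ := exists_isLM h h0
      exact this p ω hp
  intro p
  induction p using (wellFounded_ltE h).induction with | _ p ih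
  intro ω hp
  -- Both ways of continuing remove the leading term and leave only smaller monomials, so the
  -- induction hypothesis covers the rest of the division.
  have key : ∀ ω' ∈ P.supportedIn {u | ltE u p}, ∃ q η, P.DivL ltE G ω' q η := by
    intro ω' hω'
    rcases eq_or_ne ω' 0 with rfl | h0
    · exact ⟨0, 0, DivL.zero⟩
    · obtain ⟨p', hp'⟩ := exists_isLM h h0
      exact ih p' (hω' p' hp'.1) ω' hp'
  by_cases hex : ∃ (i : ℕ) (g : Fin r → A) (p' : _), G[i]? = some g ∧ P.IsLM ltE g p' ∧ P.LeftDvd ltE p' p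
  · obtain ⟨g, p', hg, hp', γ, hγ⟩ := Nat.find_spec hex
    have hleast : ∀ j < Nat.find hex, ∀ h, G[j]? = some h → ∀ p'', P.IsLM ltE h p'' →
        ¬ P.LeftDvd ltE p'' p :=
      fun j hj h hh p'' hp'' hdvd => Nat.find_min hex hj ⟨h, p'', hh, hp'', hdvd⟩
    have hu := hγ.eq h (isLM_smul_monE h γ p')
    have h1 := isLM_multiplier h hp' hu.symm hp.1
    obtain ⟨q, η, hq⟩ := key
      (ω - (((P.coeff (P.basis γ • g) p)⁻¹ * P.coeff ω p) • P.basis γ) • g) (by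
        rw [smulK_smul]
        exact hp.sub_mem_below h1.1 h1.2.symm)
    exact ⟨_, η, DivL.reduce ω p _ g p' γ _ q η hp hg hp' hγ hleast rfl hq⟩
  · push Not at hex
    obtain ⟨q, η, hq⟩ := key (ω - P.coeff ω p • P.monE p)
      ((isLM_iff h).1 hp).2
    refine ⟨q, _, DivL.move ω p q η hp (fun g hg p' hp' => ?_) hq⟩
    obtain ⟨i, hi⟩ := List.mem_iff_getElem?.1 hg
    exact hex i g p' hi hp'

theorem eq_zero_of_groebner {N : Submodule A (Fin r → A)}
    (hG : P.IsLeftGroebner ltE N G) (hω : ω ∈ N) (hd : P.DivL ltE G ω q η) : η = 0 := by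
  by_contra h0
  have hη : η ∈ N := by
    have h1 : rowEval G q ∈ N :=
      Submodule.span_le.2 (fun x hx => (hG.1 x hx).1) (rowEval_mem_span G q)
    rw [← hd.eval] at hω
    exact (N.add_mem_iff_right h1).1 hω
  obtain ⟨g, hg, p, u, hp, hu, hdvd⟩ := hG.2 η hη h0
  exact hd.irreducible u hu.1 g hg p hp hdvd

end DivL

end GradedSolvablePolynomialAlgebra

namespace GradedSolvablePolynomialAlgebra

variable {K A : Type*} [Field K] [Ring A] [Algebra K A] {n : ℕ}
  {P : GradedSolvablePolynomialAlgebra K A n} {r : ℕ}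
  {ltE : (Fin n → ℕ) × Fin r → (Fin n → ℕ) × Fin r → Prop} {t : ℕ}

/-! ### Schreyer orderings -/

/-- The Schreyer ordering on `A^t` given by a family of leading monomials. -/
def schreyer (ltE : (Fin n → ℕ) × Fin r → (Fin n → ℕ) × Fin r → Prop)
    (m : Fin t → (Fin n → ℕ) × Fin r) (p q : (Fin n → ℕ) × Fin t) : Prop :=
  ltE (shift p.1 (m p.2)) (shift q.1 (m q.2)) ∨
    shift p.1 (m p.2) = shift q.1 (m q.2) ∧ p.2 < q.2

/-- Totality comes from cancellation: for a fixed index the exponent can be recovered from the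
shifted monomial, so equal images at the same index mean equal monomials. -/
theorem schreyer_isLeftMonomialOrder (h : P.IsLeftMonomialOrder ltE)
    (m : Fin t → (Fin n → ℕ) × Fin r) : P.IsLeftMonomialOrder (schreyer ltE m) := by
  have := h.total
  refine .of_shift ?_ (fun α β i hαβ => Or.inl ?_) ?_
  · exact
    { trichotomous := by
        rintro ⟨a, i⟩ ⟨b, j⟩ h1 h2
        simp only [schreyer, not_or, not_and] at h1 h2
        have heq : shift a (m i) = shift b (m j) := by
          rcases trichotomous_of ltE (shift a (m i)) (shift b (m j)) with h | h | h
          · exact absurd h h1.1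
          · exact h
          · exact absurd h h2.1
        obtain rfl : i = j := le_antisymm (not_lt.1 (h2.2 heq.symm)) (not_lt.1 (h1.2 heq))
        rw [shift_left_cancel heq]
      irrefl := by
        rintro ⟨a, i⟩ (h | ⟨-, h⟩)
        · exact irrefl_of ltE _ h
        · exact lt_irrefl _ h
      trans := by
        rintro ⟨a, i⟩ ⟨b, j⟩ ⟨c, k⟩ (h | ⟨h, h'⟩) (g | ⟨g, g'⟩)
        · exact Or.inl (trans_of ltE h g)
        · exact Or.inl (g ▸ h)
        · exact Or.inl (h ▸ g)
        · exact Or.inr ⟨h.trans g, lt_trans h' g'⟩ }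
  · have := h.compat _ _ (m i).2 (P.lt_add_left (m i).1 hαβ)
    simpa [shift, add_comm] using this
  · rintro γ ⟨a, i⟩ ⟨b, j⟩ (h1 | ⟨h1, h2⟩)
    · have := lt_shift h γ h1
      rw [shift_shift, shift_shift] at this
      exact Or.inl this
    · have := congrArg (shift γ) h1
      rw [shift_shift, shift_shift] at this
      exact Or.inr ⟨this, h2⟩

variable {g : Fin t → Fin r → A} {m : Fin t → (Fin n → ℕ) × Fin r}

theorem linearCombination_monE (g : Fin t → Fin r → A) (p : (Fin n → ℕ) × Fin t) :
    Fintype.linearCombination A g (P.monE p) = P.basis p.1 • g p.2 := by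
  simp [monE]

/-- A monomial of `f` below `u` has a smaller image, or the same image at a smaller index. The
hypothesis `hdist` excludes the second case, so the image of the leading term is not cancelled. -/
theorem isLM_linearCombination (h : P.IsLeftMonomialOrder ltE)
    (hm : ∀ l, P.IsLM ltE (g l) (m l)) {f : Fin t → A} {u : (Fin n → ℕ) × Fin t}
    (hu : P.IsLM (schreyer ltE m) f u)
    (hdist : ∀ v, P.coeff f v ≠ 0 → v.2 < u.2 → shift v.1 (m v.2) ≠ shift u.1 (m u.2)) :
    P.IsLM ltE (Fintype.linearCombination A g f) (shift u.1 (m u.2)) := by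
  let Φ : (Fin t → A) →ₗ[K] (Fin r → A) := restrictK (Fintype.linearCombination A g)
  have hΦ : ∀ v, P.IsLM ltE (Φ (P.monE v)) (shift v.1 (m v.2)) := fun v => by
    change P.IsLM ltE (Fintype.linearCombination A g _) _
    rw [linearCombination_monE]
    exact (hm v.2).smul h v.1
  have hsplit : Φ f = P.coeff f u • Φ (P.monE u) + Φ (f - P.coeff f u • P.monE u) := by
    rw [map_sub, map_smul, add_sub_cancel]
  change P.IsLM ltE (Φ f) _
  rw [hsplit]
  refine ((hΦ u).smulK hu.1).add h ?_
  suffices f - P.coeff f u • P.monE u ∈ (P.supportedIn {q | ltE q (shift u.1 (m u.2))}).comap Φ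
    from this
  refine P.mem_of_monE_mem fun v hv => ?_
  refine (hΦ v).mem_below h ?_
  rcases eq_or_ne v u with rfl | hvu
  · simp at hv
  · have hv' : P.coeff f v ≠ 0 := by simpa [P.coeff_monE_ne hvu] using hv
    rcases hu.2 v hv' hvu with h1 | ⟨h1, h2⟩
    · exact h1
    · exact absurd h1 (hdist v hv' h2)

/-- If `f` is congruent modulo syzygies to an element `f'` whose monomials all have different
leading monomials in `A^r`, then `f` itself is in the span of these syzygies if it is one, and
the leading monomial of its value is divisible by one of the leading monomials of the family
otherwise. -/
theorem schreyer_dichotomy (h : P.IsLeftMonomialOrder ltE) (hm : ∀ l, P.IsLM ltE (g l) (m l))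
    {Z : Submodule A (Fin t → A)} (hZ : ∀ z ∈ Z, Fintype.linearCombination A g z = 0)
    {f f' : Fin t → A} (hf : f - f' ∈ Z)
    (hred : ∀ u, P.coeff f' u ≠ 0 → ∀ i < u.2, ¬ P.LeftDvd ltE (m i) (shift u.1 (m u.2))) :
    f ∈ Z ∨ ∃ j u, P.IsLM ltE (Fintype.linearCombination A g f) u ∧ P.LeftDvd ltE (m j) u := by
  have heq : Fintype.linearCombination A g f = Fintype.linearCombination A g f' := by
    have := hZ _ hf
    rwa [map_sub, sub_eq_zero] at this
  rcases eq_or_ne f' 0 with rfl | h0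
  · exact Or.inl (by simpa using hf)
  · obtain ⟨u, hu⟩ := exists_isLM (schreyer_isLeftMonomialOrder h m) h0
    refine Or.inr ⟨u.2, shift u.1 (m u.2), ?_, (leftDvd_iff h).2 ⟨_, rfl⟩⟩
    rw [heq]
    exact isLM_linearCombination h hm hu fun v _ hlt hv =>
      hred u hu.1 v.2 hlt ((leftDvd_iff h).2 ⟨_, hv.symm⟩)

/-- The witness is the remainder of `f` under division by `Z`. It does not depend on the grading, so
one statement serves the plain and the homogeneous version of Schreyer's theorem. -/
theorem exists_reduced (h : P.IsLeftMonomialOrder ltE) (Z : List (Fin r → A)) (f : Fin r → A) :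
    ∃ f', f - f' ∈ Submodule.span A {z | z ∈ Z} ∧
      (∀ u, P.coeff f' u ≠ 0 → ∀ z ∈ Z, ∀ p, P.IsLM ltE z p → ¬ P.LeftDvd ltE p u) ∧
      ∀ (b : Fin r → ℕ) (d : ℕ), (∀ z ∈ Z, P.IsHomog b z) → f ∈ P.freePart b d →
        f' ∈ P.freePart b d := by
  obtain ⟨q, η, hd⟩ := DivL.exists_divL h Z f
  refine ⟨η, ?_, hd.irreducible, fun b d hZ hf => (hd.homog h hZ hf).1⟩
  rw [← hd.eval, add_sub_cancel_right]
  exact rowEval_mem_span Z q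

variable {Z : List (Fin t → A)}

/-- If `m i` divides `a^γ m_j`, then so does the least common multiple of `m i` and `m_j`; hence
`lcm / m_j` divides `a^γ`. Thus a possible tie is exactly a monomial reducible by the syzygy of the
pair. -/
theorem syz_dvd (h : P.IsLeftMonomialOrder ltE) {m : Fin t → (Fin n → ℕ) × Fin r}
    {u : (Fin n → ℕ) × Fin t} {i : Fin t} (hi : P.LeftDvd ltE (m i) (shift u.1 (m u.2))) :
    (m i).2 = (m u.2).2 ∧
    P.LeftDvd (schreyer ltE m) ((m i).1 ⊔ (m u.2).1 - (m u.2).1, u.2) u := by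
  rw [leftDvd_iff_le h] at hi
  refine ⟨hi.1, (leftDvd_iff_le (schreyer_isLeftMonomialOrder h m)).2 ⟨rfl, ?_⟩⟩
  have h1 : (m i).1 ⊔ (m u.2).1 ≤ u.1 + (m u.2).1 := sup_le hi.2 le_add_self
  exact tsub_le_iff_right.2 h1

/-- If the syzygies in `Z` contain all those needed for S-polynomials, then they generate all
syzygies, and the family `g` is a Gröbner basis. -/
theorem schreyer_theorem (h : P.IsLeftMonomialOrder ltE) (hm : ∀ l, P.IsLM ltE (g l) (m l))
    (hZ : ∀ z ∈ Z, Fintype.linearCombination A g z = 0)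
    (hcov : ∀ i j, i < j → (m i).2 = (m j).2 →
      ∃ z ∈ Z, P.IsLM (schreyer ltE m) z ((m i).1 ⊔ (m j).1 - (m j).1, j)) (f : Fin t → A) :
    f ∈ Submodule.span A {z | z ∈ Z} ∨
      ∃ j u, P.IsLM ltE (Fintype.linearCombination A g f) u ∧ P.LeftDvd ltE (m j) u := by
  obtain ⟨f', h1, h2, -⟩ := exists_reduced (schreyer_isLeftMonomialOrder h m) Z f
  refine schreyer_dichotomy h hm (fun z hz => ?_) h1 fun u hu i hiu hdvd => ?_
  · exact (Submodule.span_le (p := LinearMap.ker (Fintype.linearCombination A g))).2 hZ hz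
  · obtain ⟨h3, h4⟩ := syz_dvd h hdvd
    obtain ⟨z, hz, hlm⟩ := hcov i u.2 hiu h3
    exact h2 u hu z hz _ hlm h4

/-- The homogeneous version of `schreyer_theorem`, in degree `d`. -/
theorem schreyer_theorem_degree (h : P.IsLeftMonomialOrder ltE)
    (hm : ∀ l, P.IsLM ltE (g l) (m l))
    (hZ : ∀ z ∈ Z, Fintype.linearCombination A g z = 0)
    {b : Fin r → ℕ} {b' : Fin t → ℕ} (hg : ∀ l, g l ∈ P.freePart b (b' l))
    (hZb : ∀ z ∈ Z, P.IsHomog b' z) {d : ℕ}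
    (hcov : ∀ i j, i < j → (m i).2 = (m j).2 →
      P.weight ((m i).1 ⊔ (m j).1) + b (m j).2 ≤ d →
      ∃ z ∈ Z, P.IsLM (schreyer ltE m) z ((m i).1 ⊔ (m j).1 - (m j).1, j))
    {f : Fin t → A} (hf : f ∈ P.freePart b' d) :
    f ∈ Submodule.span A {z | z ∈ Z} ∨
      ∃ j u, P.IsLM ltE (Fintype.linearCombination A g f) u ∧ P.LeftDvd ltE (m j) u := by
  obtain ⟨f', h1, h2, hhom⟩ := exists_reduced (schreyer_isLeftMonomialOrder h m) Z f
  refine schreyer_dichotomy h hm (fun z hz => ?_) h1 fun u hu i hiu hdvd => ?_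
  · exact (Submodule.span_le (p := LinearMap.ker (Fintype.linearCombination A g))).2 hZ hz
  · obtain ⟨h3, h4⟩ := syz_dvd h hdvd
    -- The remainder is homogeneous of degree `d`, so `a^γ m_j` has degree `d`. The least common
    -- multiple divides it and has degree at most `d`.
    obtain ⟨z, hz, hlm⟩ := hcov i u.2 hiu h3 (by
      have h5 := (P.mem_freePart b').1 (hhom b' d hZb hf) u hu
      have h6 := (P.mem_freePart b).1 (hg u.2) _ (hm u.2).1
      obtain ⟨γ, hγ⟩ := exists_add_of_le
        (sup_le ((leftDvd_iff_le h).1 hdvd).2 le_add_self : (m i).1 ⊔ (m u.2).1 ≤ u.1 + (m u.2).1)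
      have h7 := congrArg P.weight hγ
      rw [weight_add, weight_add] at h7
      omega)
    exact h2 u hu z hz _ hlm h4

end GradedSolvablePolynomialAlgebra

namespace GradedSolvablePolynomialAlgebra

variable {K A : Type*} [Field K] [Ring A] [Algebra K A] {n : ℕ}
  {P : GradedSolvablePolynomialAlgebra K A n} {r : ℕ}
  {ltE : (Fin n → ℕ) × Fin r → (Fin n → ℕ) × Fin r → Prop}

/-! ### Truncation of row vectors -/

/-- The first `t` entries of a row vector. -/
def truncate (A : Type*) [Ring A] (t : ℕ) : (ℕ →₀ A) →ₗ[A] (Fin t → A) where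
  toFun c l := c l
  map_add' _ _ := rfl
  map_smul' _ _ := rfl

@[simp] theorem truncate_apply (t : ℕ) (c : ℕ →₀ A) (l : Fin t) : truncate A t c l = c l := rfl

/-- Rows are indexed by `ℕ` so that their type survives the growth of the list, whereas Schreyer's
argument needs a free module of finite rank. Entries past the end of the list are multiplied by the
default value zero, so truncation loses nothing. -/
theorem rowEval_eq_truncate {M : Type*} [AddCommGroup M] [Module A M] {t : ℕ} (L : List M)
    (hL : L.length = t) (c : ℕ →₀ A) :
    rowEval L c = Fintype.linearCombination A (fun l : Fin t => L[l]) (truncate A t c) := by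
  subst hL
  refine LinearMap.congr_fun (f := rowEval L)
    (g := (Fintype.linearCombination A fun l : Fin L.length => L[l]).comp
      (truncate A L.length)) (Finsupp.lhom_ext fun k f => ?_) c
  rw [LinearMap.comp_apply]
  by_cases hk : k < L.length
  · have h1 : truncate A L.length (Finsupp.single k f) = Pi.single ⟨k, hk⟩ f := by
      ext l
      by_cases hl : l = ⟨k, hk⟩
      · subst hl; simp
      · have : k ≠ l := fun h => hl (Fin.ext h.symm)
        simp [truncate_apply, hl, this]
    rw [h1, rowEval_single (List.getElem?_eq_getElem hk)]
    simp
  · have h1 : truncate A L.length (Finsupp.single k f) = 0 := by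
      ext l
      have : k ≠ l := by omega
      simp [truncate_apply, this]
    rw [h1, map_zero]
    simp [rowEval, List.getD_eq_getElem?_getD, not_lt.1 hk]

theorem rowEval_append {M : Type*} [AddCommGroup M] [Module A M] {L : List M} {c : ℕ →₀ A}
    (h : ∀ k, c k ≠ 0 → k < L.length) (L' : List M) : rowEval (L ++ L') c = rowEval L c := by
  rw [rowEval, rowEval, Finsupp.linearCombination_apply, Finsupp.linearCombination_apply]
  refine Finsupp.sum_congr fun k hk => ?_
  rw [List.getD_append _ _ _ _ (h k (Finsupp.mem_support_iff.1 hk))]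

theorem HomogRow.rowEval_append {b : Fin r → ℕ} {L : List (Fin r → A)} {d : ℕ} {c : ℕ →₀ A}
    (h : P.HomogRow b L d c) (L' : List (Fin r → A)) : rowEval (L ++ L') c = rowEval L c :=
  GradedSolvablePolynomialAlgebra.rowEval_append (fun _ hk => (h.apply_mem hk).1) L'

/-! ### Left S-polynomials -/

theorem isSPoly_exists {g h : Fin r → A} {α β : Fin n → ℕ} {i : Fin r}
    (hg : P.IsLM ltE g (α, i)) (hh : P.IsLM ltE h (β, i)) : ∃ f f' s, P.IsSPoly ltE g h f f' s :=
  ⟨_, _, _, α, β, i, hg, hh, rfl, rfl, rfl⟩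

theorem IsSPoly.unique (ho : P.IsLeftMonomialOrder ltE) {g h s s' : Fin r → A} {f f' e e' : A}
    (h₁ : P.IsSPoly ltE g h f f' s) (h₂ : P.IsSPoly ltE g h e e' s') :
    f = e ∧ f' = e' ∧ s = s' := by
  obtain ⟨α, β, i, hg, hh, rfl, rfl, rfl⟩ := h₁
  obtain ⟨α', β', i', hg', hh', rfl, rfl, rfl⟩ := h₂
  have h1 := hg.eq ho hg'
  have h2 := hh.eq ho hh'
  simp only [Prod.mk.injEq] at h1 h2
  obtain ⟨rfl, rfl⟩ := h1
  obtain ⟨rfl, -⟩ := h2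
  exact ⟨rfl, rfl, rfl⟩

/-- Both multiples are normalized to have coefficient `1` at the least common multiple of the
leading monomials, so that term cancels and only smaller monomials remain. -/
theorem isSPoly_spec (ho : P.IsLeftMonomialOrder ltE) {g h s : Fin r → A} {f f' : A}
    {α β : Fin n → ℕ} {i : Fin r} (hg : P.IsLM ltE g (α, i)) (hh : P.IsLM ltE h (β, i))
    (hs : P.IsSPoly ltE g h f f' s) :
    s = f • g - f' • h ∧ s ∈ P.supportedIn {u | ltE u (α ⊔ β, i)} ∧
      (∃ c : K, c ≠ 0 ∧ f = c • P.basis (α ⊔ β - α)) ∧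
      ∃ c : K, c ≠ 0 ∧ f' = c • P.basis (α ⊔ β - β) := by
  obtain ⟨α', β', i', hg', hh', rfl, rfl, rfl⟩ := hs
  have h1 := hg.eq ho hg'
  have h2 := hh.eq ho hh'
  simp only [Prod.mk.injEq] at h1 h2
  obtain ⟨rfl, rfl⟩ := h1
  obtain ⟨rfl, -⟩ := h2
  have h3 : shift (α ⊔ β - α) (α, i) = (α ⊔ β, i) :=
    Prod.ext (tsub_add_cancel_of_le le_sup_left) rfl
  have h4 : shift (α ⊔ β - β) (β, i) = (α ⊔ β, i) :=
    Prod.ext (tsub_add_cancel_of_le le_sup_right) rfl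
  have h5 := isLM_multiplier ho hg h3 one_ne_zero
  have h6 := isLM_multiplier ho hh h4 one_ne_zero
  have h7 := hg.smul ho (α ⊔ β - α)
  have h8 := hh.smul ho (α ⊔ β - β)
  rw [h3] at h7
  rw [h4] at h8
  rw [mul_one] at h5 h6
  refine ⟨rfl, ?_, ⟨_, inv_ne_zero h7.1, rfl⟩, ⟨_, inv_ne_zero h8.1, rfl⟩⟩
  rw [smulK_smul, smulK_smul]
  exact h5.1.sub_mem_below h6.1 (h5.2.trans h6.2.symm)

theorem isSPoly_degree {b : Fin r → ℕ} {g : Fin r → A} (hg : P.IsHomog b g) {f : A}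
    {α γ : Fin n → ℕ} {i : Fin r} (hLM : P.IsLM ltE g (α, i)) (hαγ : α ≤ γ)
    (hf : ∃ c : K, c ≠ 0 ∧ f = c • P.basis (γ - α)) :
    f ∈ P.part (P.weight (γ - α)) ∧
      P.weight (γ - α) + P.degOf b g = P.weight γ + b i ∧
      f • g ∈ P.freePart b (P.weight γ + b i) := by
  obtain ⟨c, -, rfl⟩ := hf
  have h1 : c • P.basis (γ - α) ∈ P.part (P.weight (γ - α)) :=
    Submodule.smul_mem _ _ (P.basis_mem_part _)
  have h2 : P.weight (γ - α) + P.degOf b g = P.weight γ + b i := by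
    have h3 := (P.mem_freePart b).1 hg.mem_degOf _ hLM.1
    have h4 := P.weight_add (γ - α) α
    rw [tsub_add_cancel_of_le hαγ] at h4
    simp only at h3
    omega
  exact ⟨h1, h2, h2 ▸ P.smul_mem_freePart h1 hg.mem_degOf⟩

/-! ### Syzygies with a given leading monomial -/

variable (P) in
/-- The leading monomial of the row vector `σ` for the Schreyer ordering given by the list `G` is
the product of `a^γ` and the `j`-th unit vector, and the leading monomial of the product of `a^γ`
and the `j`-th member of `G` is `u`. -/
def SyzLead (ltE : (Fin n → ℕ) × Fin r → (Fin n → ℕ) × Fin r → Prop) (G : List (Fin r → A))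
    (j : ℕ) (γ : Fin n → ℕ) (u : (Fin n → ℕ) × Fin r) (σ : ℕ →₀ A) : Prop :=
  P.basis.repr (σ j) γ ≠ 0 ∧ ∀ l δ, P.basis.repr (σ l) δ ≠ 0 → (l = j ∧ δ = γ) ∨
    ∃ g p, G[l]? = some g ∧ P.IsLM ltE g p ∧ (ltE (shift δ p) u ∨ shift δ p = u ∧ l < j)

theorem getElem?_append_of_some {X : Type*} {L : List X} {i : ℕ} {x : X} (h : L[i]? = some x)
    (L' : List X) : (L ++ L')[i]? = some x := by
  rw [List.getElem?_append_left (List.getElem?_eq_some_iff.1 h).1, h]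

/-- This persistence is why the leading monomial is described on untruncated rows: a syzygy recorded
early still covers its pair when more elements have been appended. -/
theorem SyzLead.append {G : List (Fin r → A)} {j : ℕ} {γ : Fin n → ℕ}
    {u : (Fin n → ℕ) × Fin r} {σ : ℕ →₀ A} (h : P.SyzLead ltE G j γ u σ)
    (G' : List (Fin r → A)) : P.SyzLead ltE (G ++ G') j γ u σ := by
  refine ⟨h.1, fun l δ hδ => (h.2 l δ hδ).imp_right ?_⟩
  rintro ⟨g, p, h1, h2⟩
  exact ⟨g, p, getElem?_append_of_some h1 G', h2⟩

theorem SyzLead.isLM (ho : P.IsLeftMonomialOrder ltE) {G : List (Fin r → A)} {t : ℕ}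
    (ht : G.length = t)
    {m : Fin t → (Fin n → ℕ) × Fin r} (hm : ∀ l : Fin t, P.IsLM ltE G[l] (m l))
    {j : Fin t} {γ : Fin n → ℕ} {σ : ℕ →₀ A}
    (h : P.SyzLead ltE G j γ (shift γ (m j)) σ) :
    P.IsLM (schreyer ltE m) (truncate A t σ) (γ, j) := by
  subst ht
  refine ⟨h.1, ?_⟩
  rintro ⟨δ, l⟩ hδ hne
  rcases h.2 l δ hδ with ⟨h1, rfl⟩ | ⟨g, p, h1, h2, h3⟩
  · obtain rfl := Fin.ext h1
    exact absurd rfl hne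
  · have hg : G[l] = g := by
      have := List.getElem?_eq_getElem l.2
      rw [h1] at this
      exact (Option.some.inj this).symm
    obtain rfl := h2.eq ho (hg ▸ hm l)
    exact h3

variable (P) in
/-- The set `S` contains a syzygy with the leading monomial of the one given by the S-polynomial of
the `i`-th and the `j`-th member of `G`, if these have one. -/
def Covered (ltE : (Fin n → ℕ) × Fin r → (Fin n → ℕ) × Fin r → Prop) (G : List (Fin r → A))
    (S : Set (ℕ →₀ A)) (i j : ℕ) : Prop :=
  ∀ g h α β k, G[i]? = some g → G[j]? = some h → P.IsLM ltE g (α, k) → P.IsLM ltE h (β, k) →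
    ∃ σ ∈ S, P.SyzLead ltE G j (α ⊔ β - β) (α ⊔ β, k) σ

theorem Covered.append {G : List (Fin r → A)} {S S' : Set (ℕ →₀ A)} {i j : ℕ}
    (h : P.Covered ltE G S i j) (hS : S ⊆ S') (hi : i < G.length) (hj : j < G.length)
    (G' : List (Fin r → A)) : P.Covered ltE (G ++ G') S' i j := by
  intro g h' α β k h1 h2 h3 h4
  rw [List.getElem?_append_left hi] at h1
  rw [List.getElem?_append_left hj] at h2
  obtain ⟨σ, h5, h6⟩ := h g h' α β k h1 h2 h3 h4
  exact ⟨σ, hS h5, h6.append G'⟩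

/-- The terms at `i` and `j` both evaluate to multiples leading at the least common multiple, while
those of `c` evaluate strictly below it. As `i < j`, the Schreyer tie-break makes the term at `j`
the leading one. -/
theorem syzLead_of_isSPoly (ho : P.IsLeftMonomialOrder ltE) {G : List (Fin r → A)} {i j : ℕ}
    (hij : i < j) {g h s : Fin r → A} {f f' : A} {α β : Fin n → ℕ} {k : Fin r}
    (hi : G[i]? = some g) (hj : G[j]? = some h) (hg : P.IsLM ltE g (α, k))
    (hh : P.IsLM ltE h (β, k)) (hs : P.IsSPoly ltE g h f f' s) {c : ℕ →₀ A}
    (hc : ∀ l δ, P.basis.repr (c l) δ ≠ 0 →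
      ∃ g m, G[l]? = some g ∧ P.IsLM ltE g m ∧ ltE (shift δ m) (α ⊔ β, k)) :
    P.SyzLead ltE G j (α ⊔ β - β) (α ⊔ β, k) (c - Finsupp.single i f + Finsupp.single j f') := by
  have := ho.total
  obtain ⟨-, -, ⟨a, ha, rfl⟩, ⟨a', ha', rfl⟩⟩ := isSPoly_spec ho hg hh hs
  have h3 : shift (α ⊔ β - α) (α, k) = (α ⊔ β, k) :=
    Prod.ext (tsub_add_cancel_of_le le_sup_left) rfl
  have h4 : shift (α ⊔ β - β) (β, k) = (α ⊔ β, k) :=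
    Prod.ext (tsub_add_cancel_of_le le_sup_right) rfl
  constructor
  · have h0 : P.basis.repr (c j) (α ⊔ β - β) = 0 := by
      by_contra h0
      obtain ⟨g', m, h5, h6, h7⟩ := hc _ _ h0
      rw [hj] at h5
      obtain rfl := Option.some.inj h5
      rw [h6.eq ho hh, h4] at h7
      exact irrefl_of ltE _ h7
    simpa [Finsupp.single_apply, hij.ne, h0] using ha'
  · intro l δ hδ
    by_cases hl : l = j ∧ δ = α ⊔ β - β
    · exact Or.inl hl
    refine Or.inr ?_
    by_cases hcl : P.basis.repr (c l) δ = 0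
    · have h5 : P.basis.repr (Finsupp.single j (a' • P.basis (α ⊔ β - β)) l) δ = 0 := by
        rcases eq_or_ne j l with rfl | hjl
        · have : α ⊔ β - β ≠ δ := fun h => hl ⟨rfl, h.symm⟩
          simp [this]
        · simp [hjl]
      have h6 : P.basis.repr (Finsupp.single i (a • P.basis (α ⊔ β - α)) l) δ ≠ 0 := by
        simpa [hcl, h5] using hδ
      rcases eq_or_ne i l with rfl | hil
      · rcases eq_or_ne (α ⊔ β - α) δ with rfl | hd
        · exact ⟨g, _, hi, hg, Or.inr ⟨h3, hij⟩⟩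
        · simp [hd] at h6
      · simp [hil] at h6
    · obtain ⟨g', m, h5, h6, h7⟩ := hc _ _ hcl
      exact ⟨g', m, h5, h6, Or.inl h7⟩

end GradedSolvablePolynomialAlgebra

namespace GradedSolvablePolynomialAlgebra

variable {K A : Type*} [Field K] [Ring A] [Algebra K A] {n : ℕ}
  {P : GradedSolvablePolynomialAlgebra K A n} {r : ℕ}
  {ltE : (Fin n → ℕ) × Fin r → (Fin n → ℕ) × Fin r → Prop}
  {b : Fin r → ℕ} {U : Finset (Fin r → A)} {T : MinState A r} {q : ℕ}

/-! ### The invariant of the computation of a minimal generating set -/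

theorem PairSPoly.append {G : List (Fin r → A)} {ij : ℕ × ℕ} {f f' : A} {s : Fin r → A}
    (h : P.PairSPoly ltE G ij f f' s) (G' : List (Fin r → A)) :
    P.PairSPoly ltE (G ++ G') ij f f' s := by
  obtain ⟨g, h', h1, h2, h3⟩ := h
  exact ⟨g, h', getElem?_append_of_some h1 G', getElem?_append_of_some h2 G', h3⟩

theorem PairDeg.append {G : List (Fin r → A)} {ij : ℕ × ℕ} {d : ℕ}
    (h : P.PairDeg b ltE G d ij) (G' : List (Fin r → A)) : P.PairDeg b ltE (G ++ G') d ij := by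
  obtain ⟨f, f', s, h1, h2⟩ := h
  exact ⟨f, f', s, h1.append G', h2⟩

theorem PairSPoly.unique (ho : P.IsLeftMonomialOrder ltE) {G : List (Fin r → A)} {ij : ℕ × ℕ}
    {f f' e e' : A} {s s' : Fin r → A} (h : P.PairSPoly ltE G ij f f' s)
    (h' : P.PairSPoly ltE G ij e e' s') : f = e ∧ f' = e' ∧ s = s' := by
  obtain ⟨g₁, g₂, h1, h2, h3⟩ := h
  obtain ⟨g₁', g₂', h1', h2', h3'⟩ := h'
  rw [h1] at h1'
  rw [h2] at h2'
  obtain rfl := Option.some.inj h1'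
  obtain rfl := Option.some.inj h2'
  exact h3.unique ho h3'

theorem PairDeg.unique (ho : P.IsLeftMonomialOrder ltE) {G : List (Fin r → A)} {ij : ℕ × ℕ}
    {d d' : ℕ} (h : P.PairDeg b ltE G d ij) (h' : P.PairDeg b ltE G d' ij) : d = d' := by
  obtain ⟨f, f', s, h1, h2, h3⟩ := h
  obtain ⟨e, e', s', h1', h2', h3'⟩ := h'
  obtain ⟨-, -, rfl⟩ := h1.unique ho h1'
  exact P.freePart_degree_unique h2 h3 h3'

variable (P ltE b U) in
/-- The invariant of the computation; `q` is the current degree. -/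
structure MinInv (T : MinState A r) (q : ℕ) : Prop where
  todo : ∀ ξ ∈ T.todo, ξ ∈ U ∧ q ≤ P.degOf b ξ
  curTodo : ∀ ξ ∈ T.curTodo, ξ ∈ U ∧ ξ ∈ P.freePart b q
  pairs : ∀ ij ∈ T.pairs, ij.1 < ij.2 ∧ ∃ d, q < d ∧ P.PairDeg b ltE T.groebner d ij
  curPairs : ∀ ij ∈ T.curPairs, ij.1 < ij.2 ∧ P.PairDeg b ltE T.groebner q ij
  homog : ∀ g ∈ T.groebner, P.IsHomog b g ∧ P.degOf b g ≤ q
  sorted : T.groebner.Pairwise fun g h => P.degOf b g ≤ P.degOf b h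
  rows : ∀ x ∈ T.basis, rowEval T.umin x.2 = x.1 ∧ P.HomogRow b T.umin (P.degOf b x.1) x.2
  umin_mem : ∀ ξ ∈ T.umin, ξ ∈ U ∧ P.degOf b ξ ≤ q ∧ ξ ∈ Submodule.span A {x | x ∈ T.groebner}
  umin_sorted : T.umin.Pairwise fun ξ ξ' => P.degOf b ξ ≤ P.degOf b ξ'
  umin_indep : ∀ k ξ, T.umin[k]? = some ξ → ξ ∉ Submodule.span A {x | x ∈ T.umin.take k}
  gens : ∀ ξ ∈ U, ξ ∈ T.todo ∨ ξ ∈ T.curTodo ∨ ξ ∈ Submodule.span A {x | x ∈ T.umin}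
  syz_finite : T.syz.Finite
  syz : ∀ σ ∈ T.syz, rowEval T.groebner σ = 0 ∧ ∃ d, P.HomogRow b T.groebner d σ
  covered : ∀ i j, i < j → (i, j) ∈ T.pairs ∨ (i, j) ∈ T.curPairs ∨
    P.Covered ltE T.groebner T.syz i j

theorem minInv_init : P.MinInv ltE b U (MinState.init U) 0 where
  todo := by simp [MinState.init]
  curTodo := by simp [MinState.init]
  pairs := by simp [MinState.init]
  curPairs := by simp [MinState.init]
  homog := by simp [MinState.init, MinState.groebner]
  sorted := by simp [MinState.init, MinState.groebner]
  rows := by simp [MinState.init]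
  umin_mem := by simp [MinState.init]
  umin_sorted := by simp [MinState.init]
  umin_indep := by simp [MinState.init]
  gens := fun _ hξ => Or.inl hξ
  syz_finite := by simp [MinState.init]
  syz := by simp [MinState.init]
  covered i j _ := Or.inr (Or.inr fun g h α β k h1 => by
    simp [MinState.init, MinState.groebner] at h1)

namespace MinInv

theorem groebner_mem_span (hT : P.MinInv ltE b U T q) {g : Fin r → A} (hg : g ∈ T.groebner) :
    g ∈ Submodule.span A {x | x ∈ T.umin} := by
  obtain ⟨x, hx, rfl⟩ := List.mem_map.1 hg
  rw [← (hT.rows x hx).1]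
  exact rowEval_mem_span _ _

theorem span_groebner (hT : P.MinInv ltE b U T q) :
    Submodule.span A {x | x ∈ T.groebner} = Submodule.span A {x | x ∈ T.umin} :=
  le_antisymm (Submodule.span_le.2 fun _ hg => hT.groebner_mem_span hg)
    (Submodule.span_le.2 fun ξ hξ => (hT.umin_mem ξ hξ).2.2)

theorem pair_info (ho : P.IsLeftMonomialOrder ltE) {G : List (Fin r → A)}
    (hG : ∀ g ∈ G, P.IsHomog b g) {i j : ℕ} {f f' : A} {s : Fin r → A}
    (h : P.PairSPoly ltE G (i, j) f f' s) :
    ∃ g g' α β k, G[i]? = some g ∧ G[j]? = some g' ∧ P.IsLM ltE g (α, k) ∧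
      P.IsLM ltE g' (β, k) ∧ P.IsSPoly ltE g g' f f' s ∧ s = f • g - f' • g' ∧
      s ∈ P.supportedIn {u | ltE u (α ⊔ β, k)} ∧ s ∈ P.freePart b (P.weight (α ⊔ β) + b k) ∧
      P.HomogRow b G (P.weight (α ⊔ β) + b k) (Finsupp.single i f) ∧
      P.HomogRow b G (P.weight (α ⊔ β) + b k) (Finsupp.single j f') := by
  obtain ⟨g, g', hi, hj, hs⟩ := h
  obtain ⟨α, β, k, hg, hg', -, -, -⟩ := id hs
  obtain ⟨h1, h2, h3, h4⟩ := isSPoly_spec ho hg hg' hs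
  obtain ⟨h5, h6, h7⟩ := isSPoly_degree (hG g (List.mem_of_getElem? hi)) hg le_sup_left h3
  obtain ⟨h8, h9, h10⟩ := isSPoly_degree (hG g' (List.mem_of_getElem? hj)) hg' le_sup_right h4
  exact ⟨g, g', α, β, k, hi, hj, hg, hg', hs, h1, h2, h1 ▸ sub_mem h7 h10,
    HomogRow.single hi h5 h6, HomogRow.single hj h8 h9⟩

theorem next (ho : P.IsLeftMonomialOrder ltE) (hT : P.MinInv ltE b U T q)
    (hU : ∀ ξ ∈ U, P.IsHomog b ξ) {q' : ℕ} (h₁ : T.curPairs = ∅) (h₂ : T.curTodo = ∅)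
    (hq : IsLeast {q | (∃ ξ ∈ T.todo, ξ ∈ P.freePart b q) ∨
        ∃ ij ∈ T.pairs, P.PairDeg b ltE T.groebner q ij} q') :
    open scoped Classical in
    P.MinInv ltE b U
      { T with
          curPairs := T.pairs.filter fun ij => P.PairDeg b ltE T.groebner q' ij
          pairs := T.pairs.filter fun ij => ¬ P.PairDeg b ltE T.groebner q' ij
          curTodo := T.todo.filter fun ξ => ξ ∈ P.freePart b q'
          todo := T.todo.filter fun ξ => ξ ∉ P.freePart b q' } q' := by
  classical
  -- The current degree never decreases, because everything still pending has degree at least `q`.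
  have hle : q ≤ q' := by
    rcases hq.1 with ⟨ξ, hξ, hd⟩ | ⟨ij, hij, hd⟩
    · obtain ⟨h3, h4⟩ := hT.todo ξ hξ
      rwa [degOf_eq (hU ξ h3).1 hd] at h4
    · obtain ⟨-, d, h3, h4⟩ := hT.pairs ij hij
      exact h4.unique ho hd ▸ h3.le
  refine ⟨fun ξ hξ => ?_, fun ξ hξ => ?_, fun ij hij => ?_, fun ij hij => ?_,
    fun g hg => ⟨(hT.homog g hg).1, (hT.homog g hg).2.trans hle⟩, hT.sorted, hT.rows,
    fun ξ hξ => ⟨(hT.umin_mem ξ hξ).1, (hT.umin_mem ξ hξ).2.1.trans hle, (hT.umin_mem ξ hξ).2.2⟩,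
    hT.umin_sorted, hT.umin_indep, fun ξ hξ => ?_, hT.syz_finite, hT.syz, fun i j hij => ?_⟩
  · have hξ' := (Finset.mem_filter.1 hξ).1
    obtain ⟨h3, -⟩ := hT.todo ξ hξ'
    exact ⟨h3, hq.2 (Or.inl ⟨ξ, hξ', (hU ξ h3).mem_degOf⟩)⟩
  · obtain ⟨h3, h4⟩ := Finset.mem_filter.1 hξ
    exact ⟨(hT.todo ξ h3).1, h4⟩
  · obtain ⟨h3, h4⟩ := Finset.mem_filter.1 hij
    obtain ⟨h5, d, h6, h7⟩ := hT.pairs ij h3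
    refine ⟨h5, d, lt_of_le_of_ne (hq.2 (Or.inr ⟨ij, h3, h7⟩)) ?_, h7⟩
    rintro rfl
    exact h4 h7
  · obtain ⟨h3, h4⟩ := Finset.mem_filter.1 hij
    exact ⟨(hT.pairs ij h3).1, h4⟩
  · rcases hT.gens ξ hξ with h | h | h
    · by_cases h3 : ξ ∈ P.freePart b q'
      · exact Or.inr (Or.inl (Finset.mem_filter.2 ⟨h, h3⟩))
      · exact Or.inl (Finset.mem_filter.2 ⟨h, h3⟩)
    · simp [h₂] at h
    · exact Or.inr (Or.inr h)
  · rcases hT.covered i j hij with h | h | h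
    · by_cases h3 : P.PairDeg b ltE T.groebner q' (i, j)
      · exact Or.inr (Or.inl (Finset.mem_filter.2 ⟨h, h3⟩))
      · exact Or.inl (Finset.mem_filter.2 ⟨h, h3⟩)
    · simp [h₁] at h
    · exact Or.inr (Or.inr h)

theorem _root_.GradedSolvablePolynomialAlgebra.groebner_adjoin (T : MinState A r) (η : Fin r → A)
    (ρ : ℕ →₀ A) : (P.adjoin ltE T η ρ).groebner = T.groebner ++ [η] := by
  simp [GradedSolvablePolynomialAlgebra.adjoin, MinState.groebner]

theorem _root_.MinState.length_groebner (T : MinState A r) :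
    T.groebner.length = T.basis.length := by simp [MinState.groebner]

/-- The common part of the two steps that append a remainder `η`. Here `T'` is `T` with the treated
task removed and the syzygies or the selected generators updated, just before `η` is appended. -/
theorem adjoin (ho : P.IsLeftMonomialOrder ltE) (hT : P.MinInv ltE b U T q) {T' : MinState A r}
    (hbasis : T'.basis = T.basis) (hpairs : T'.pairs = T.pairs) (htodo : T'.todo = T.todo)
    (hcurPairs : T'.curPairs ⊆ T.curPairs) (hcurTodo : T'.curTodo ⊆ T.curTodo)
    {η : Fin r → A} {ρ : ℕ →₀ A} (hη : η ≠ 0) (hηq : η ∈ P.freePart b q)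
    (hirr : ∀ u, P.coeff η u ≠ 0 → ∀ g ∈ T.groebner, ∀ p, P.IsLM ltE g p → ¬ P.LeftDvd ltE p u)
    (hρ : rowEval T'.umin ρ = η ∧ P.HomogRow b T'.umin q ρ)
    (humin : ∃ L, T'.umin = T.umin ++ L)
    (humem : ∀ ξ ∈ T'.umin,
      ξ ∈ U ∧ P.degOf b ξ ≤ q ∧ ξ ∈ Submodule.span A {x | x ∈ T.groebner ++ [η]})
    (husorted : T'.umin.Pairwise fun ξ ξ' => P.degOf b ξ ≤ P.degOf b ξ')
    (huindep : ∀ k ξ, T'.umin[k]? = some ξ → ξ ∉ Submodule.span A {x | x ∈ T'.umin.take k})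
    (hgens : ∀ ξ ∈ U, ξ ∈ T.todo ∨ ξ ∈ T'.curTodo ∨ ξ ∈ Submodule.span A {x | x ∈ T'.umin})
    (hsub : T.syz ⊆ T'.syz) (hfin : T'.syz.Finite)
    (hsyz : ∀ σ ∈ T'.syz, rowEval (T.groebner ++ [η]) σ = 0 ∧
      ∃ d, P.HomogRow b (T.groebner ++ [η]) d σ)
    (hcov : ∀ i j, (i, j) ∈ T.curPairs →
      (i, j) ∈ T'.curPairs ∨ P.Covered ltE (T.groebner ++ [η]) T'.syz i j) :
    P.MinInv ltE b U (P.adjoin ltE T' η ρ) q := by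
  classical
  have hgr : T'.groebner = T.groebner := by rw [MinState.groebner, hbasis, MinState.groebner]
  have hlen : T.groebner.length = T.basis.length := T.length_groebner
  have hG : (P.adjoin ltE T' η ρ).groebner = T.groebner ++ [η] := by rw [groebner_adjoin, hgr]
  have hdeg : P.degOf b η = q := degOf_eq hη hηq
  have hhom : ∀ g ∈ T.groebner ++ [η], P.IsHomog b g := fun g hg => by
    rcases List.mem_append.1 hg with h | h
    · exact (hT.homog g h).1
    · rw [List.mem_singleton.1 h]; exact ⟨hη, q, hηq⟩
  have hlast : (T.groebner ++ [η])[T.basis.length]? = some η := by simp [← hlen]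
  have hmempairs : ∀ ij, ij ∈ (P.adjoin ltE T' η ρ).pairs ↔ ij ∈ T.pairs ∨
      (∃ i < T.basis.length, ij = (i, T.basis.length)) ∧
        ∃ f f' s, P.PairSPoly ltE (T.groebner ++ [η]) ij f f' s ∧ s ≠ 0 := fun ij => by
    simp only [GradedSolvablePolynomialAlgebra.adjoin, hpairs, hbasis, hgr, Finset.mem_union,
      Finset.mem_filter, Finset.mem_image, Finset.mem_range]
    simp only [eq_comm]
  have hmemsyz : ∀ σ, σ ∈ (P.adjoin ltE T' η ρ).syz ↔ σ ∈ T'.syz ∨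
      ∃ i < T.basis.length, ∃ f f', P.PairSPoly ltE (T.groebner ++ [η]) (i, T.basis.length) f f' 0 ∧
        σ = Finsupp.single T.basis.length f' - Finsupp.single i f := fun σ => by
    simp only [GradedSolvablePolynomialAlgebra.adjoin, hbasis, hgr]
    rfl
  constructor
  · exact htodo ▸ hT.todo
  · exact fun ξ hξ => hT.curTodo ξ (hcurTodo hξ)
  · intro ij hij
    rw [hG]
    rcases (hmempairs ij).1 hij with h | ⟨⟨i, hi, rfl⟩, f, f', s, hs, hs0⟩
    · obtain ⟨h1, d, h2, h3⟩ := hT.pairs ij h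
      exact ⟨h1, d, h2, h3.append _⟩
    · refine ⟨hi, ?_⟩
      obtain ⟨g, g', α, β, k, h1, h2, h3, h4, -, -, -, h5, -, -⟩ := pair_info ho hhom hs
      refine ⟨_, ?_, f, f', s, hs, hs0, h5⟩
      rw [hlast] at h2
      obtain rfl := Option.some.inj h2
      rw [List.getElem?_append_left (hlen ▸ hi)] at h1
      have h6 := (P.mem_freePart b).1 hηq _ h4.1
      -- Since `LM(g)` does not divide `LM(η)`, the least common multiple is a proper multiple of
      -- `LM(η)` and has degree greater than `q`. Hence a new remainder never creates an
      -- S-polynomial in the degree being treated.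
      have h7 : ¬ α ≤ β := fun hle =>
        hirr _ h4.1 g (List.mem_of_getElem? h1) _ h3 ((leftDvd_iff_le ho).2 ⟨rfl, hle⟩)
      obtain ⟨γ, hγ⟩ := exists_add_of_le (le_sup_right : β ≤ α ⊔ β)
      have h8 : P.weight γ ≠ 0 := fun h0 => h7 (by
        rw [P.weight_eq_zero h0, add_zero] at hγ
        exact hγ ▸ le_sup_left)
      rw [hγ, weight_add]
      simp only at h6
      omega
  · intro ij hij
    rw [hG]
    obtain ⟨h1, h2⟩ := hT.curPairs ij (hcurPairs hij)
    exact ⟨h1, h2.append _⟩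
  · intro g hg
    rw [hG] at hg
    refine ⟨hhom g hg, ?_⟩
    rcases List.mem_append.1 hg with h | h
    · exact (hT.homog g h).2
    · rw [List.mem_singleton.1 h, hdeg]
  · rw [hG, List.pairwise_append]
    refine ⟨hT.sorted, by simp, fun g hg g' hg' => ?_⟩
    rw [List.mem_singleton.1 hg', hdeg]
    exact (hT.homog g hg).2
  · intro x hx
    rcases List.mem_append.1 hx with h | h
    · obtain ⟨L, hL⟩ := humin
      obtain ⟨h1, h2⟩ := hT.rows x (hbasis ▸ h)
      change rowEval T'.umin x.2 = x.1 ∧ P.HomogRow b T'.umin _ _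
      rw [hL]
      exact ⟨(h2.rowEval_append L).trans h1, h2.append L⟩
    · rw [List.mem_singleton.1 h]
      exact ⟨hρ.1, hdeg.symm ▸ hρ.2⟩
  · rw [hG]; exact humem
  · exact husorted
  · exact huindep
  · intro ξ hξ
    have := hgens ξ hξ
    rwa [← htodo] at this
  · refine hfin.union (Set.Finite.subset ((Finset.range T.basis.length).finite_toSet.biUnion
      (t := fun i => {σ | ∃ f f', P.PairSPoly ltE (T.groebner ++ [η]) (i, T.basis.length) f f' 0 ∧
        σ = Finsupp.single T.basis.length f' - Finsupp.single i f}) fun i _ => ?_) ?_)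
    -- For each `i` the multipliers of the S-polynomial are unique, so at most one syzygy is added.
    · refine Set.Subsingleton.finite ?_
      rintro σ ⟨f, f', h1, rfl⟩ σ' ⟨e, e', h2, rfl⟩
      obtain ⟨rfl, rfl, -⟩ := h1.unique ho h2
      rfl
    · rintro σ ⟨i, hi, h⟩
      rw [hbasis] at hi
      simp only [hgr, hbasis] at h
      exact Set.mem_biUnion (Finset.mem_coe.2 (Finset.mem_range.2 hi)) h
  · intro σ hσ
    rw [hG]
    rcases (hmemsyz σ).1 hσ with h | ⟨i, hi, f, f', hs, rfl⟩
    · exact hsyz σ h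
    · obtain ⟨g, g', α, β, k, h1, h2, -, -, -, h3, -, -, h4, h5⟩ := pair_info ho hhom hs
      refine ⟨?_, _, h5.sub h4⟩
      rw [map_sub, rowEval_single h1, rowEval_single h2, ← neg_sub, ← h3, neg_zero]
  · intro i j hij
    rw [hG, hmempairs]
    have hsubset : T'.syz ⊆ (P.adjoin ltE T' η ρ).syz := fun σ hσ => (hmemsyz σ).2 (Or.inl hσ)
    -- Three cases: a pair of old elements, a pair containing `η`, and an index beyond the list, for
    -- which there is nothing to cover.
    rcases lt_trichotomy j T.basis.length with hj | rfl | hj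
    · rcases hT.covered i j hij with h | h | h
      · exact Or.inl (Or.inl h)
      · rcases hcov i j h with h | h
        · exact Or.inr (Or.inl h)
        · refine Or.inr (Or.inr fun g g' α β k h1 h2 h3 h4 => ?_)
          obtain ⟨σ, h5, h6⟩ := h g g' α β k h1 h2 h3 h4
          exact ⟨σ, hsubset h5, h6⟩
      · exact Or.inr (Or.inr (h.append (hsub.trans hsubset) (by omega) (by omega) _))
    · by_cases hex : ∃ f f' s,
          P.PairSPoly ltE (T.groebner ++ [η]) (i, T.basis.length) f f' s ∧ s ≠ 0
      · exact Or.inl (Or.inr ⟨⟨i, hij, rfl⟩, hex⟩)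
      · refine Or.inr (Or.inr fun g g' α β k h1 h2 h3 h4 => ?_)
        obtain ⟨f, f', s, hs⟩ := isSPoly_exists h3 h4
        have hs0 : s = 0 := by
          by_contra h0
          exact hex ⟨f, f', s, ⟨g, g', h1, h2, hs⟩, h0⟩
        subst hs0
        refine ⟨_, (hmemsyz _).2 (Or.inr ⟨i, hij, f, f', ⟨g, g', h1, h2, hs⟩, rfl⟩), ?_⟩
        -- A vanishing S-polynomial needs no division, so its syzygy has no quotient part.
        have := syzLead_of_isSPoly ho hij h1 h2 h3 h4 hs (c := 0) (by simp)
        rwa [zero_sub, neg_add_eq_sub] at this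
    · refine Or.inr (Or.inr fun g g' α β k h1 h2 => ?_)
      have := (List.getElem?_eq_some_iff.1 h2).1
      simp at this
      omega

end MinInv

end GradedSolvablePolynomialAlgebra

namespace GradedSolvablePolynomialAlgebra

variable {K A : Type*} [Field K] [Ring A] [Algebra K A] {n : ℕ}
  {P : GradedSolvablePolynomialAlgebra K A n} {r : ℕ}
  {ltE : (Fin n → ℕ) × Fin r → (Fin n → ℕ) × Fin r → Prop}
  {b : Fin r → ℕ} {U : Finset (Fin r → A)} {T : MinState A r} {q : ℕ}

/-! ### Schreyer's theorem applied to the states of the computation -/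

theorem rowMul_eq_rowEval (T : MinState A r) (c : ℕ →₀ A) :
    T.rowMul c = rowEval (T.basis.map Prod.snd) c := rfl

namespace MinInv

/-- This is the matrix identity `G = V U_min`, applied to a row `c`. -/
theorem rowEval_rowMul (hT : P.MinInv ltE b U T q) (c : ℕ →₀ A) :
    rowEval T.umin (T.rowMul c) = rowEval T.groebner c := by
  refine LinearMap.congr_fun (f := (rowEval T.umin).comp (rowEval (T.basis.map Prod.snd)))
    (g := rowEval T.groebner) (Finsupp.lhom_ext fun k f => ?_) c
  rw [LinearMap.comp_apply]
  rcases h : T.basis[k]? with _ | x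
  · simp [rowEval, MinState.groebner, List.getD_eq_getElem?_getD, h]
  · have h1 : (T.basis.map Prod.snd)[k]? = some x.2 := by simp [h]
    have h2 : T.groebner[k]? = some x.1 := by simp [MinState.groebner, h]
    rw [rowEval_single h1, rowEval_single h2, map_smul, (hT.rows x (List.mem_of_getElem? h)).1]

theorem homogRow_rowMul (hT : P.MinInv ltE b U T q) {c : ℕ →₀ A} {d : ℕ}
    (hc : P.HomogRow b T.groebner d c) : P.HomogRow b T.umin d (T.rowMul c) := by
  refine HomogRow.sum fun k hk => ?_
  obtain ⟨h1, p, h2, h3⟩ := hc.apply_mem (Finsupp.mem_support_iff.1 hk)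
  have h4 : k < T.basis.length := T.length_groebner ▸ h1
  have h5 := (hT.rows T.basis[k] (List.getElem_mem h4)).2
  have h6 : (T.basis.map Prod.snd).getD k 0 = T.basis[k].2 := by
    simp [List.getD_eq_getElem?_getD, h4]
  have h7 : T.groebner.getD k 0 = T.basis[k].1 := by
    simp [MinState.groebner, List.getD_eq_getElem?_getD, h4]
  rw [h7] at h2
  change P.HomogRow b T.umin d (c k • (T.basis.map Prod.snd).getD k 0)
  rw [h6, ← h2]
  exact h5.smul h3

theorem exists_lm (ho : P.IsLeftMonomialOrder ltE) (hT : P.MinInv ltE b U T q) :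
    ∃ m : Fin T.groebner.length → (Fin n → ℕ) × Fin r,
      ∀ l : Fin T.groebner.length, P.IsLM ltE T.groebner[l] (m l) :=
  ⟨_, fun l => Classical.choose_spec
    (exists_isLM ho (hT.homog T.groebner[l] (List.getElem_mem l.2)).1.1)⟩

theorem exists_syzList (hT : P.MinInv ltE b U T q) :
    ∃ Z : List (Fin T.groebner.length → A),
      (∀ z, z ∈ Z ↔ z ≠ 0 ∧ ∃ σ ∈ T.syz, z = truncate A _ σ) ∧
      (∀ z ∈ Z, Fintype.linearCombination A (fun l : Fin T.groebner.length => T.groebner[l]) z = 0) ∧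
      ∀ z ∈ Z, P.IsHomog (fun l : Fin T.groebner.length => P.degOf b T.groebner[l]) z := by
  classical
  have h0 : ∀ z, z ∈ ((hT.syz_finite.toFinset.image (truncate A T.groebner.length)).erase 0).toList
      ↔ z ≠ 0 ∧ ∃ σ ∈ T.syz, z = truncate A _ σ := fun z => by simp [eq_comm]
  refine ⟨_, h0, fun z hz => ?_, fun z hz => ?_⟩
  · obtain ⟨-, σ, hσ, rfl⟩ := (h0 z).1 hz
    rw [← rowEval_eq_truncate T.groebner rfl]
    exact (hT.syz σ hσ).1
  · obtain ⟨h1, σ, hσ, rfl⟩ := (h0 z).1 hz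
    obtain ⟨d, hd⟩ := (hT.syz σ hσ).2
    refine ⟨h1, d, (P.mem_freePart _).2 fun p hp => ?_⟩
    have := (hd p.2 p.1 hp).2
    rwa [List.getD_eq_getElem?_getD, List.getElem?_eq_getElem p.2.2, Option.getD_some] at this

theorem exists_syz (ho : P.IsLeftMonomialOrder ltE) {Z : List (Fin T.groebner.length → A)}
    (hZ : ∀ z, z ∈ Z ↔ z ≠ 0 ∧ ∃ σ ∈ T.syz, z = truncate A _ σ)
    {m : Fin T.groebner.length → (Fin n → ℕ) × Fin r}
    (hm : ∀ l : Fin T.groebner.length, P.IsLM ltE T.groebner[l] (m l))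
    {i j : Fin T.groebner.length} (hij : (m i).2 = (m j).2)
    (hcov : P.Covered ltE T.groebner T.syz i j) :
    ∃ z ∈ Z, P.IsLM (schreyer ltE m) z ((m i).1 ⊔ (m j).1 - (m j).1, j) := by
  obtain ⟨σ, h1, h2⟩ := hcov _ _ (m i).1 (m j).1 (m j).2 (List.getElem?_eq_getElem i.2)
    (List.getElem?_eq_getElem j.2) (by rw [← hij]; exact hm i) (hm j)
  have h3 : shift ((m i).1 ⊔ (m j).1 - (m j).1) (m j) = ((m i).1 ⊔ (m j).1, (m j).2) :=
    Prod.ext (tsub_add_cancel_of_le le_sup_right) rfl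
  rw [← h3] at h2
  have h4 := h2.isLM ho rfl hm
  exact ⟨_, (hZ _).2 ⟨h4.ne_zero, σ, h1, rfl⟩, h4⟩

theorem span_groebner_eq_range (T : MinState A r) :
    Submodule.span A {x | x ∈ T.groebner} =
      LinearMap.range (Fintype.linearCombination A fun l : Fin T.groebner.length => T.groebner[l]) := by
  rw [Fintype.range_linearCombination]
  congr 1
  ext x
  rw [Set.mem_ofPred_eq, List.mem_iff_get]
  rfl

/-- If a generator has a nonzero remainder after all S-polynomials of its degree have been treated,
then it is not in the span of the generators selected before. -/
theorem notMem_span (ho : P.IsLeftMonomialOrder ltE) (hT : P.MinInv ltE b U T q)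
    (h₁ : T.curPairs = ∅) {ξ η : Fin r → A} {c : ℕ →₀ A} (hξ : ξ ∈ P.freePart b q)
    (hd : P.DivL ltE T.groebner ξ c η) (hη : η ≠ 0) :
    ξ ∉ Submodule.span A {x | x ∈ T.umin} := by
  intro hmem
  have hG : ∀ g ∈ T.groebner, P.IsHomog b g := fun g hg => (hT.homog g hg).1
  have hηq := (hd.homog ho hG hξ).1
  rw [← hT.span_groebner] at hmem
  have hη2 : η ∈ Submodule.span A {x | x ∈ T.groebner} := by
    rw [← hd.eval] at hmem
    exact (Submodule.add_mem_iff_right _ (rowEval_mem_span _ c)).1 hmem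
  rw [span_groebner_eq_range] at hη2
  obtain ⟨f, rfl⟩ := hη2
  obtain ⟨m, hm⟩ := hT.exists_lm ho
  obtain ⟨Z, hZ, hZ0, hZhom⟩ := hT.exists_syzList
  let b' : Fin T.groebner.length → ℕ := fun l => P.degOf b T.groebner[l]
  have hgb : ∀ l : Fin T.groebner.length, T.groebner[l] ∈ P.freePart b (b' l) := fun l =>
    (hG _ (List.getElem_mem l.2)).mem_degOf
  let Φ := Fintype.linearCombination A fun l : Fin T.groebner.length => T.groebner[l]
  -- The remainder `η = Φ f` is homogeneous of degree `q`, so the coefficients may be replaced by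
  -- their degree-`q` component.
  have hcomp : Φ (P.component b' q f) = Φ f := by
    rw [← P.component_map (b := b') (b' := b), P.component_of_mem hηq]
    intro d f' hf'
    exact P.map_mem_freePart _ (fun l => by simpa [Φ] using hgb l) hf'
  -- No pair is left in degree `q`, and the pending ones have strictly larger degree. Hence all
  -- pairs of degree at most `q` are covered.
  have hcov : ∀ i j, i < j → (m i).2 = (m j).2 → P.weight ((m i).1 ⊔ (m j).1) + b (m j).2 ≤ q →
      ∃ z ∈ Z, P.IsLM (schreyer ltE m) z ((m i).1 ⊔ (m j).1 - (m j).1, j) := by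
    intro i j hij hc hle
    refine exists_syz ho hZ hm hc ?_
    rcases hT.covered i j hij with h | h | h
    · obtain ⟨-, d, h2, f, f', s, h3, h4, h5⟩ := hT.pairs _ h
      obtain ⟨g, g', α, β, k, h6, h7, h8, h9, -, -, -, h10, -⟩ := pair_info ho hG h3
      rw [List.getElem?_eq_getElem i.2] at h6
      rw [List.getElem?_eq_getElem j.2] at h7
      obtain rfl := Option.some.inj h6
      obtain rfl := Option.some.inj h7
      have h11 := P.freePart_degree_unique h4 h5 h10
      rw [(hm i).eq ho h8, (hm j).eq ho h9] at hle
      simp only at hle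
      omega
    · simp [h₁] at h
    · exact h
  rcases schreyer_theorem_degree ho hm hZ0 hgb hZhom (d := q) hcov
    (P.component_mem (b := b') f q) with h | ⟨j, u, h2, h3⟩
  -- Either alternative is absurd: the first makes `η` zero, the second makes its leading monomial
  -- reducible.
  · refine hη ?_
    change Φ f = 0
    rw [← hcomp]
    exact (Submodule.span_le (p := LinearMap.ker Φ)).2 hZ0 h
  · change P.IsLM ltE (Φ _) u at h2
    rw [hcomp] at h2
    exact hd.irreducible u h2.1 _ (List.getElem_mem j.2) _ (hm j) h3

/-- With no pair pending, all are covered and Schreyer's theorem holds without a degree bound. For a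
nonzero value it yields the Gröbner property; for the value zero it yields generation of the
syzygies. -/
theorem done_dichotomy (ho : P.IsLeftMonomialOrder ltE) (hT : P.MinInv ltE b U T q) (hdone : T.Done)
    (f : Fin T.groebner.length → A) :
    f ∈ Submodule.span A {z | ∃ σ ∈ T.syz, z = truncate A _ σ} ∨
      ∃ g ∈ T.groebner, ∃ p u, P.IsLM ltE g p ∧ P.IsLM ltE
        (Fintype.linearCombination A (fun l : Fin T.groebner.length => T.groebner[l]) f) u ∧
        P.LeftDvd ltE p u := by
  obtain ⟨m, hm⟩ := hT.exists_lm ho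
  obtain ⟨Z, hZ, hZ0, -⟩ := hT.exists_syzList
  have hcov : ∀ i j, i < j → (m i).2 = (m j).2 →
      ∃ z ∈ Z, P.IsLM (schreyer ltE m) z ((m i).1 ⊔ (m j).1 - (m j).1, j) := by
    intro i j hij hc
    refine exists_syz ho hZ hm hc ?_
    rcases hT.covered i j hij with h | h | h
    · simp [hdone.1] at h
    · simp [hdone.2.1] at h
    · exact h
  rcases schreyer_theorem ho hm hZ0 hcov f with h | ⟨j, u, h1, h2⟩
  · exact Or.inl (Submodule.span_mono (fun z hz => ((hZ z).1 hz).2) h)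
  · exact Or.inr ⟨_, List.getElem_mem j.2, _, u, hm j, h1, h2⟩

theorem isLeftGroebner (ho : P.IsLeftMonomialOrder ltE) (hT : P.MinInv ltE b U T q)
    (hdone : T.Done) : P.IsLeftGroebner ltE (Submodule.span A {x | x ∈ T.umin}) T.groebner := by
  refine ⟨fun g hg => ⟨hT.groebner_mem_span hg, (hT.homog g hg).1.1⟩, fun ξ hξ h0 => ?_⟩
  rw [← hT.span_groebner, span_groebner_eq_range] at hξ
  obtain ⟨f, rfl⟩ := hξ
  rcases hT.done_dichotomy ho hdone f with h | ⟨g, hg, p, u, h⟩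
  · refine absurd ?_ h0
    refine (Submodule.span_le (p := LinearMap.ker (Fintype.linearCombination A
      (fun l : Fin T.groebner.length => T.groebner[l])))).2 ?_ h
    rintro z ⟨σ, hσ, rfl⟩
    change _ = _
    rw [← rowEval_eq_truncate T.groebner rfl]
    exact (hT.syz σ hσ).1
  · exact ⟨g, hg, p, u, h⟩

theorem mem_span_syz (ho : P.IsLeftMonomialOrder ltE) (hT : P.MinInv ltE b U T q)
    (hdone : T.Done) {c : ℕ →₀ A} (hc : rowEval T.groebner c = 0) :
    truncate A _ c ∈ Submodule.span A {z | ∃ σ ∈ T.syz, z = truncate A T.groebner.length σ} := by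
  rw [rowEval_eq_truncate T.groebner rfl] at hc
  rcases hT.done_dichotomy ho hdone (truncate A _ c) with h | ⟨g, hg, p, u, -, h, -⟩
  · exact h
  · exact absurd hc h.ne_zero

/-! ### The invariant is preserved -/

theorem pairZero (ho : P.IsLeftMonomialOrder ltE) (hT : P.MinInv ltE b U T q) {i j : ℕ}
    {f f' : A} {s : Fin r → A} {c : ℕ →₀ A} (hij : (i, j) ∈ T.curPairs)
    (hs : P.PairSPoly ltE T.groebner (i, j) f f' s) (hdiv : P.DivL ltE T.groebner s c 0) :
    P.MinInv ltE b U
      { T with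
        curPairs := T.curPairs.erase (i, j)
        syz := T.syz ∪ {c - Finsupp.single i f + Finsupp.single j f'} } q := by
  have hG : ∀ g ∈ T.groebner, P.IsHomog b g := fun g hg => (hT.homog g hg).1
  obtain ⟨g, g', α, β, k, h1, h2, h3, h4, h5, h6, h7, h8, h9, h10⟩ := pair_info ho hG hs
  refine ⟨hT.todo, hT.curTodo, hT.pairs, fun x hx => hT.curPairs x (Finset.mem_of_mem_erase hx),
    hT.homog, hT.sorted, hT.rows, hT.umin_mem, hT.umin_sorted, hT.umin_indep, hT.gens,
    hT.syz_finite.union (Set.finite_singleton _), ?_, fun i' j' hij' => ?_⟩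
  · rintro σ (hσ | rfl)
    · exact hT.syz σ hσ
    · refine ⟨?_, _, ((hdiv.homog ho hG h8).2.sub h9).add h10⟩
      change rowEval T.groebner _ = 0
      have h11 := hdiv.eval
      rw [add_zero] at h11
      rw [map_add, map_sub, rowEval_single h1, rowEval_single h2, h11, h6]
      abel
  · by_cases heq : (i', j') = (i, j)
    · obtain ⟨rfl, rfl⟩ := Prod.mk.inj heq
      refine Or.inr (Or.inr fun x x' α' β' k' a1 a2 a3 a4 => ?_)
      obtain rfl := Option.some.inj (h1.symm.trans a1)
      obtain rfl := Option.some.inj (h2.symm.trans a2)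
      refine ⟨_, Or.inr rfl, syzLead_of_isSPoly ho hij' h1 h2 a3 a4 h5
        (hdiv.bound ho (isSPoly_spec ho a3 a4 h5).2.1).2⟩
    · rcases hT.covered i' j' hij' with h | h | h
      · exact Or.inl h
      · exact Or.inr (Or.inl (Finset.mem_erase.2 ⟨heq, h⟩))
      · refine Or.inr (Or.inr fun x x' α' β' k' a1 a2 a3 a4 => ?_)
        obtain ⟨σ, hσ, hl⟩ := h x x' α' β' k' a1 a2 a3 a4
        exact ⟨σ, Or.inl hσ, hl⟩

theorem pairNew (ho : P.IsLeftMonomialOrder ltE) (hT : P.MinInv ltE b U T q) {i j : ℕ}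
    {f f' : A} {s : Fin r → A} {c : ℕ →₀ A} {η : Fin r → A} (hij : (i, j) ∈ T.curPairs)
    (hs : P.PairSPoly ltE T.groebner (i, j) f f' s) (hdiv : P.DivL ltE T.groebner s c η)
    (hη : η ≠ 0) :
    P.MinInv ltE b U
      (P.adjoin ltE
          { T with
            curPairs := T.curPairs.erase (i, j)
            syz := T.syz ∪ {c + Finsupp.single T.basis.length 1
              - Finsupp.single i f + Finsupp.single j f'} }
          η (T.rowMul (Finsupp.single i f - Finsupp.single j f' - c))) q := by
  have hG : ∀ g ∈ T.groebner, P.IsHomog b g := fun g hg => (hT.homog g hg).1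
  obtain ⟨g, g', α, β, k, h1, h2, h3, h4, h5, h6, h7, h8, h9, h10⟩ := pair_info ho hG hs
  have hd : P.weight (α ⊔ β) + b k = q := by
    obtain ⟨e, e', s', a1, a2, a3⟩ := (hT.curPairs _ hij).2
    obtain ⟨-, -, rfl⟩ := hs.unique ho a1
    exact P.freePart_degree_unique a2 h8 a3
  rw [hd] at h8 h9 h10
  obtain ⟨h11, h12⟩ := hdiv.homog ho hG h8
  have hlast : (T.groebner ++ [η])[T.basis.length]? = some η := by simp [← T.length_groebner]
  -- The remainder is `η = f g_i - f' g_j - Σ c_l g_l`; multiplying this row by the matrix `V`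
  -- expresses `η` through the selected generators.
  have heq : rowEval T.groebner (Finsupp.single i f - Finsupp.single j f' - c) = η := by
    rw [map_sub, map_sub, rowEval_single h1, rowEval_single h2, ← h6, ← hdiv.eval]
    abel
  refine hT.adjoin (T' :=
      { T with
        curPairs := T.curPairs.erase (i, j)
        syz := T.syz ∪ {c + Finsupp.single T.basis.length 1
          - Finsupp.single i f + Finsupp.single j f'} })
    ho rfl rfl rfl (Finset.erase_subset _ _) (Finset.Subset.refl _) hη h11
    hdiv.irreducible ⟨(hT.rowEval_rowMul _).trans heq, hT.homogRow_rowMul ((h9.sub h10).sub h12)⟩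
    ⟨[], by simp⟩ (fun ξ hξ => ?_) hT.umin_sorted hT.umin_indep hT.gens Set.subset_union_left
    (hT.syz_finite.union (Set.finite_singleton _)) ?_ fun i' j' hij' => ?_
  · obtain ⟨a1, a2, a3⟩ := hT.umin_mem ξ hξ
    exact ⟨a1, a2, Submodule.span_mono (fun x hx => List.mem_append_left _ hx) a3⟩
  · rintro σ (hσ | rfl)
    · obtain ⟨a1, d, a2⟩ := hT.syz σ hσ
      exact ⟨(a2.rowEval_append _).trans a1, d, a2.append _⟩
    · refine ⟨?_, q, (((h12.append _).add ?_).sub (h9.append _)).add (h10.append _)⟩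
      · rw [map_add, map_sub, map_add, rowEval_single hlast,
          rowEval_single (getElem?_append_of_some h1 _),
          rowEval_single (getElem?_append_of_some h2 _), h12.rowEval_append, one_smul,
          hdiv.eval, h6]
        abel
      · exact HomogRow.single hlast P.one_mem_part (by rw [zero_add, degOf_eq hη h11])
  · by_cases heq' : (i', j') = (i, j)
    · obtain ⟨rfl, rfl⟩ := Prod.mk.inj heq'
      refine Or.inr fun x x' α' β' k' a1 a2 a3 a4 => ?_
      obtain rfl := Option.some.inj ((getElem?_append_of_some h1 _).symm.trans a1)
      obtain rfl := Option.some.inj ((getElem?_append_of_some h2 _).symm.trans a2)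
      obtain ⟨a5, a6⟩ := hdiv.bound ho (isSPoly_spec ho a3 a4 h5).2.1
      refine ⟨_, Or.inr rfl, syzLead_of_isSPoly ho (hT.curPairs _ hij).1 a1 a2 a3 a4 h5
        fun l δ hδ => ?_⟩
      by_cases hcl : P.basis.repr (c l) δ = 0
      -- Besides `c`, the syzygy has the entry `1` at the new element `η`. Its contribution `LM(η)`
      -- is below the least common multiple because the S-polynomial is.
      · rcases eq_or_ne T.basis.length l with rfl | hl
        · rcases eq_or_ne δ 0 with rfl | hδ0
          · obtain ⟨p, hp⟩ := exists_isLM ho hη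
            exact ⟨η, p, hlast, hp, by simpa using a5 p hp.1⟩
          · simp [hcl, ← P.basis_zero, hδ0] at hδ
        · simp [hcl, hl] at hδ
      · obtain ⟨y, m, b1, b2⟩ := a6 l δ hcl
        exact ⟨y, m, getElem?_append_of_some b1 _, b2⟩
    · exact Or.inl (Finset.mem_erase.2 ⟨heq', hij'⟩)

theorem genZero (hT : P.MinInv ltE b U T q) {ξ : Fin r → A}
    {c : ℕ →₀ A} (hdiv : P.DivL ltE T.groebner ξ c 0) :
    open scoped Classical in
    P.MinInv ltE b U { T with curTodo := T.curTodo.erase ξ } q := by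
  classical
  refine ⟨hT.todo, fun x hx => hT.curTodo x (Finset.mem_of_mem_erase hx), hT.pairs, hT.curPairs,
    hT.homog, hT.sorted, hT.rows, hT.umin_mem, hT.umin_sorted, hT.umin_indep, fun x hx => ?_,
    hT.syz_finite, hT.syz, hT.covered⟩
  rcases hT.gens x hx with h | h | h
  · exact Or.inl h
  · by_cases hxξ : x = ξ
    · refine Or.inr (Or.inr ?_)
      change x ∈ Submodule.span A {x | x ∈ T.umin}
      rw [hxξ, ← hdiv.eval, add_zero, ← hT.span_groebner]
      exact rowEval_mem_span _ _
    · exact Or.inr (Or.inl (Finset.mem_erase.2 ⟨hxξ, h⟩))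
  · exact Or.inr (Or.inr h)

theorem genNew (ho : P.IsLeftMonomialOrder ltE) (hT : P.MinInv ltE b U T q)
    (hU : ∀ ξ ∈ U, P.IsHomog b ξ) {ξ : Fin r → A}
    {c : ℕ →₀ A} {η : Fin r → A} (h₁ : T.curPairs = ∅) (hξ : ξ ∈ T.curTodo)
    (hdiv : P.DivL ltE T.groebner ξ c η) (hη : η ≠ 0) :
    open scoped Classical in
    P.MinInv ltE b U
      (P.adjoin ltE
          { T with
            curTodo := T.curTodo.erase ξ
            umin := T.umin ++ [ξ] }
          η (Finsupp.single T.umin.length 1 - T.rowMul c)) q := by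
  classical
  have hG : ∀ g ∈ T.groebner, P.IsHomog b g := fun g hg => (hT.homog g hg).1
  obtain ⟨hξU, hξq⟩ := hT.curTodo ξ hξ
  obtain ⟨h11, h12⟩ := hdiv.homog ho hG hξq
  have hdξ : P.degOf b ξ = q := degOf_eq (hU ξ hξU).1 hξq
  have hlast : (T.umin ++ [ξ])[T.umin.length]? = some ξ := by simp
  have hrow := hT.homogRow_rowMul h12
  refine hT.adjoin (T' :=
      { T with
        curTodo := T.curTodo.erase ξ
        umin := T.umin ++ [ξ] })
    ho rfl rfl rfl (Finset.Subset.refl _) (Finset.erase_subset _ _) hη h11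
    hdiv.irreducible ⟨?_, ?_⟩ ⟨[ξ], rfl⟩ (fun x hx => ?_) ?_ (fun k x hk => ?_) (fun x hx => ?_)
    (Set.Subset.refl _) hT.syz_finite (fun σ hσ => ?_) fun i' j' hij' => Or.inl hij'
  · change rowEval (T.umin ++ [ξ]) _ = η
    rw [map_sub, rowEval_single hlast, hrow.rowEval_append, hT.rowEval_rowMul, one_smul,
      ← hdiv.eval]
    abel
  · exact (HomogRow.single hlast P.one_mem_part (by rw [zero_add, hdξ])).sub (hrow.append _)
  · rcases List.mem_append.1 hx with h | h
    · obtain ⟨a1, a2, a3⟩ := hT.umin_mem x h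
      exact ⟨a1, a2, Submodule.span_mono (fun x hx => List.mem_append_left _ hx) a3⟩
    · obtain rfl := List.mem_singleton.1 h
      refine ⟨hξU, hdξ.le, ?_⟩
      rw [← hdiv.eval]
      exact add_mem (Submodule.span_mono (fun x hx => List.mem_append_left _ hx)
        (rowEval_mem_span T.groebner c)) (Submodule.subset_span (by simp))
  · change (T.umin ++ [ξ]).Pairwise _
    rw [List.pairwise_append]
    refine ⟨hT.umin_sorted, by simp, fun x hx y hy => ?_⟩
    rw [List.mem_singleton.1 hy, hdξ]
    exact (hT.umin_mem x hx).2.1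
  · change x ∉ Submodule.span A {y | y ∈ (T.umin ++ [ξ]).take k}
    change (T.umin ++ [ξ])[k]? = some x at hk
    rcases lt_or_ge k T.umin.length with h | h
    · rw [List.getElem?_append_left h] at hk
      rw [List.take_append_of_le_length h.le]
      exact hT.umin_indep k x hk
    -- Only the newly selected generator needs an argument: it is outside the span of all earlier
    -- ones because its remainder is nonzero.
    · obtain rfl : k = T.umin.length := by
        have := (List.getElem?_eq_some_iff.1 hk).1
        simp at this
        omega
      obtain rfl := Option.some.inj (hlast.symm.trans hk)
      rw [List.take_left']
      · exact hT.notMem_span ho h₁ hξq hdiv hη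
      · rfl
  · rcases hT.gens x hx with h | h | h
    · exact Or.inl h
    · by_cases hxξ : x = ξ
      · exact Or.inr (Or.inr (Submodule.subset_span (by simp [hxξ])))
      · exact Or.inr (Or.inl (Finset.mem_erase.2 ⟨hxξ, h⟩))
    · exact Or.inr (Or.inr (Submodule.span_mono (fun x hx => List.mem_append_left _ hx) h))
  · obtain ⟨a1, d, a2⟩ := hT.syz σ hσ
    exact ⟨(a2.rowEval_append _).trans a1, d, a2.append _⟩

theorem step (ho : P.IsLeftMonomialOrder ltE) (hU : ∀ ξ ∈ U, P.IsHomog b ξ)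
    (hT : P.MinInv ltE b U T q) {S : MinState A r} (hS : P.MinStep b ltE T S) :
    ∃ q', P.MinInv ltE b U S q' := by
  cases hS with
  | next q' h₁ h₂ hq => exact ⟨q', hT.next ho hU h₁ h₂ hq⟩
  | pairZero i j f f' s c hij hs hdiv => exact ⟨q, hT.pairZero ho hij hs hdiv⟩
  | pairNew i j f f' s c η hij hs hdiv hη => exact ⟨q, hT.pairNew ho hij hs hdiv hη⟩
  | genZero ξ c h₁ hξ hdiv => exact ⟨q, hT.genZero hdiv⟩
  | genNew ξ c η h₁ hξ hdiv hη => exact ⟨q, hT.genNew ho hU h₁ hξ hdiv hη⟩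

theorem of_reachable (ho : P.IsLeftMonomialOrder ltE) (hU : ∀ ξ ∈ U, P.IsHomog b ξ)
    (hS : Relation.ReflTransGen (P.MinStep b ltE) (MinState.init U) T) :
    ∃ q, P.MinInv ltE b U T q := by
  induction hS with
  | refl => exact ⟨0, minInv_init⟩
  | tail _ h ih => exact ih.elim fun q hq => hq.step ho hU h

end MinInv

end GradedSolvablePolynomialAlgebra

/-! ### Minimal generating families -/

namespace GradedSolvablePolynomialAlgebra

variable {K A : Type*} [Field K] [Ring A] [Algebra K A] {n : ℕ}
  {P : GradedSolvablePolynomialAlgebra K A n} {r : ℕ}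
  {ltE : (Fin n → ℕ) × Fin r → (Fin n → ℕ) × Fin r → Prop}
  {b : Fin r → ℕ} {U : Finset (Fin r → A)} {T : MinState A r} {q : ℕ}

theorem repr_one_zero : P.basis.repr 1 0 = 1 := by
  rw [← P.basis_zero]; simp

/-- If `v i` were a combination of other members of the family, moving everything to one side would
give a relation with coefficient `1` at `i`. -/
theorem isMinGen_of_ker {M ι : Type*} [AddCommGroup M] [Module A M] [Fintype ι] {v : ι → M}
    {N : Submodule A M} (hspan : Submodule.span A (Set.range v) = N)
    (hker : ∀ f, Fintype.linearCombination A v f = 0 → ∀ i, P.basis.repr (f i) 0 = 0) :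
    IsMinGen N v := by
  classical
  refine ⟨hspan, fun S hS hN => ?_⟩
  obtain ⟨i, hi⟩ := (Set.ne_univ_iff_exists_notMem S).1 hS
  have hv : v i ∈ Submodule.span A (v '' S) := by
    rw [hN, ← hspan]
    exact Submodule.subset_span ⟨i, rfl⟩
  rw [Finsupp.mem_span_image_iff_linearCombination] at hv
  obtain ⟨l, hl, hl2⟩ := hv
  have hli : l i = 0 := by
    by_contra h
    exact hi (hl (Finsupp.mem_support_iff.2 h))
  have h1 := hker (Pi.single i 1 - ⇑l) (by
    rw [map_sub, Fintype.linearCombination_apply_single, one_smul, sub_eq_zero, ← hl2,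
      Finsupp.linearCombination_apply, Finsupp.sum_fintype _ _ (by simp),
      Fintype.linearCombination_apply]) i
  simp [hli, repr_one_zero] at h1

namespace MinInv

/-- A constant term at `k` survives in the homogeneous component of degree `deg ξ_k`. The last
nonzero entry of that component belongs to a generator of the same degree, so it is a nonzero scalar
and expresses this generator through earlier ones. -/
theorem constant_eq_zero (hT : P.MinInv ltE b U T q) (hU : ∀ ξ ∈ U, P.IsHomog b ξ)
    {f : Fin T.umin.length → A}
    (hf : Fintype.linearCombination A (fun l : Fin T.umin.length => T.umin[l]) f = 0)
    (k : Fin T.umin.length) : P.basis.repr (f k) 0 = 0 := by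
  classical
  by_contra hne
  let b' : Fin T.umin.length → ℕ := fun l => P.degOf b T.umin[l]
  let Φ := Fintype.linearCombination A (fun l : Fin T.umin.length => T.umin[l])
  have hgb : ∀ l : Fin T.umin.length, T.umin[l] ∈ P.freePart b (b' l) := fun l =>
    (hU _ (hT.umin_mem _ (List.getElem_mem l.2)).1).mem_degOf
  have hΦ : ∀ d, ∀ f' ∈ P.freePart b' d, Φ f' ∈ P.freePart b d := fun d f' hf' =>
    P.map_mem_freePart _ (fun l => by simpa [Φ] using hgb l) hf'
  set f' := P.component b' (b' k) f with hf'
  have h0 : Φ f' = 0 := by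
    rw [hf', ← P.component_map (b := b') (b' := b) Φ hΦ]
    change P.component b _ (Fintype.linearCombination A _ f) = 0
    rw [hf, map_zero]
  have hmem : f' ∈ P.freePart b' (b' k) := P.component_mem f _
  have hk : f' k ≠ 0 := fun h => hne <| by
    have := P.coeff_component (b := b') f (q := b' k) (p := (0, k)) (by simp)
    change P.basis.repr (f' k) 0 = P.basis.repr (f k) 0 at this
    rw [← this, h]
    simp
  have hsne : (Finset.univ.filter fun l => f' l ≠ 0).Nonempty := ⟨k, by simpa using hk⟩
  set k' := (Finset.univ.filter fun l => f' l ≠ 0).max' hsne with hk'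
  have hk'ne : f' k' ≠ 0 := by
    have := Finset.max'_mem _ hsne
    simpa [← hk'] using this
  have hmax : ∀ l, f' l ≠ 0 → l ≤ k' := fun l hl => Finset.le_max' _ _ (by simpa using hl)
  -- Sorting gives one inequality, and a nonzero entry in a vector of degree `b' k` gives the other.
  -- The entry at `k'` therefore has degree zero.
  have hble : b' k ≤ b' k' := by
    rcases (hmax k hk).eq_or_lt with h | h
    · rw [← h]
    · exact List.pairwise_iff_getElem.1 hT.umin_sorted k k' k.2 k'.2 h
  have hble' : b' k' ≤ b' k := by
    by_contra h
    exact hk'ne (P.apply_eq_zero b' hmem (not_le.1 h))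
  have h2 := P.apply_mem_part b' hmem hble'
  rw [Nat.sub_eq_zero_of_le hble] at h2
  have h3 := P.eq_algebraMap_of_mem_part_zero h2
  set c := P.basis.repr (f' k') 0
  have hc : c ≠ 0 := by
    rintro hc
    rw [hc, map_zero] at h3
    exact hk'ne h3
  have h4 : f' k' • T.umin[k'] ∈ Submodule.span A {x | x ∈ T.umin.take k'} := by
    have h5 : Φ f' = f' k' • T.umin[k'] + ∑ l ∈ Finset.univ.erase k', f' l • T.umin[l] := by
      rw [Finset.add_sum_erase _ (fun l : Fin T.umin.length => f' l • T.umin[l])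
        (Finset.mem_univ k')]
      rfl
    rw [h0] at h5
    rw [eq_neg_of_add_eq_zero_left h5.symm]
    refine Submodule.neg_mem _ (Submodule.sum_mem _ fun l hl => ?_)
    by_cases hl0 : f' l = 0
    · simp [hl0]
    · refine Submodule.smul_mem _ _ (Submodule.subset_span ?_)
      have hlt : (l : ℕ) < k' := lt_of_le_of_ne (hmax l hl0) fun h =>
        Finset.ne_of_mem_erase hl (Fin.ext h)
      exact List.mem_take_iff_getElem.2 ⟨l, by simp [hlt], rfl⟩
  refine hT.umin_indep k' T.umin[k'] (List.getElem?_eq_getElem k'.2) ?_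
  have h6 := Submodule.smul_mem _ (algebraMap K A c⁻¹) h4
  rwa [h3, smul_smul, ← map_mul, inv_mul_cancel₀ hc, map_one, one_smul] at h6

theorem span_umin (hT : P.MinInv ltE b U T q) (hdone : T.Done) :
    Submodule.span A {x | x ∈ T.umin} = Submodule.span A (U : Set (Fin r → A)) := by
  refine le_antisymm (Submodule.span_mono fun x hx => (hT.umin_mem x hx).1)
    (Submodule.span_le.2 fun ξ hξ => ?_)
  rcases hT.gens ξ hξ with h | h | h
  · simp [hdone.2.2.1] at h
  · simp [hdone.2.2.2] at h
  · exact h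

theorem span_range_umin (T : MinState A r) :
    Submodule.span A (Set.range fun l : Fin T.umin.length => T.umin[l]) =
      Submodule.span A {x | x ∈ T.umin} := by
  congr 1
  ext x
  rw [Set.mem_ofPred_eq, List.mem_iff_get]
  rfl

theorem minOutput (ho : P.IsLeftMonomialOrder ltE) (hU : ∀ ξ ∈ U, P.IsHomog b ξ)
    (hT : P.MinInv ltE b U T q) (hdone : T.Done) : P.MinOutput b ltE U T := by
  have hspan := hT.span_umin hdone
  refine ⟨hdone, fun ξ hξ => (hT.umin_mem ξ hξ).1, ?_, hspan ▸ hT.isLeftGroebner ho hdone,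
    fun g hg => (hT.homog g hg).1, ?_⟩
  · exact isMinGen_of_ker (P := P) ((span_range_umin T).trans hspan)
      fun f hf k => hT.constant_eq_zero hU hf k
  · refine hT.sorted.imp_of_mem fun {g h} hg hh hle d d' hd hd' => ?_
    rwa [degOf_eq (hT.homog g hg).1.1 hd, degOf_eq (hT.homog h hh).1.1 hd'] at hle

/-- Division always succeeds and every pending task has a degree, so some step applies as long as a
task is left. -/
theorem done_of_stuck (ho : P.IsLeftMonomialOrder ltE) (hU : ∀ ξ ∈ U, P.IsHomog b ξ)
    (hT : P.MinInv ltE b U T q) (hstuck : ∀ S, ¬ P.MinStep b ltE T S) : T.Done := by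
  classical
  have h1 : T.curPairs = ∅ := by
    by_contra hne
    obtain ⟨⟨i, j⟩, hij⟩ := Finset.nonempty_iff_ne_empty.2 hne
    obtain ⟨-, f, f', s, hs, -, -⟩ := hT.curPairs _ hij
    obtain ⟨c, η, hd⟩ := DivL.exists_divL ho T.groebner s
    rcases eq_or_ne η 0 with rfl | hη
    · exact hstuck _ (.pairZero T i j f f' s c hij hs hd)
    · exact hstuck _ (.pairNew T i j f f' s c η hij hs hd hη)
  have h2 : T.curTodo = ∅ := by
    by_contra hne
    obtain ⟨ξ, hξ⟩ := Finset.nonempty_iff_ne_empty.2 hne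
    obtain ⟨c, η, hd⟩ := DivL.exists_divL ho T.groebner ξ
    rcases eq_or_ne η 0 with rfl | hη
    · exact hstuck _ (.genZero T ξ c h1 hξ hd)
    · exact hstuck _ (.genNew T ξ c η h1 hξ hd hη)
  have h3 : ¬ {q | (∃ ξ ∈ T.todo, ξ ∈ P.freePart b q) ∨
        ∃ ij ∈ T.pairs, P.PairDeg b ltE T.groebner q ij}.Nonempty := fun hne =>
    hstuck _ (.next T _ h1 h2 ⟨Nat.sInf_mem hne, fun d hd => Nat.sInf_le hd⟩)
  refine ⟨?_, h1, ?_, h2⟩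
  · by_contra hne
    obtain ⟨ij, hij⟩ := Finset.nonempty_iff_ne_empty.2 hne
    obtain ⟨-, d, -, hd⟩ := hT.pairs _ hij
    exact h3 ⟨d, Or.inr ⟨ij, hij, hd⟩⟩
  · by_contra hne
    obtain ⟨ξ, hξ⟩ := Finset.nonempty_iff_ne_empty.2 hne
    exact h3 ⟨_, Or.inl ⟨ξ, hξ, (hU ξ (hT.todo ξ hξ).1).mem_degOf⟩⟩

end MinInv

/-! ### Termination -/

/-- The relation between a set of monomials and larger sets closed under multiplication. -/
def Enlarges (s' s : Set ((Fin n → ℕ) × Fin r)) : Prop :=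
  s ⊂ s' ∧ ∀ p u : (Fin n → ℕ) × Fin r, p ∈ s' → p.2 = u.2 → p.1 ≤ u.1 → u ∈ s'

theorem wellQuasiOrdered_monomials :
    WellQuasiOrdered fun p u : (Fin n → ℕ) × Fin r => p.1 ≤ u.1 ∧ p.2 = u.2 :=
  WellQuasiOrdered.prod wellQuasiOrdered_le (Finite.wellQuasiOrdered (· = ·))

/-- In an infinite chain choose a new monomial at each stage. By Dickson's lemma an earlier one
divides a later one, which then already belonged to the set it was supposed to enlarge. -/
theorem wellFounded_enlarges :
    WellFounded (Enlarges : Set ((Fin n → ℕ) × Fin r) → Set ((Fin n → ℕ) × Fin r) → Prop) := by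
  rw [wellFounded_iff_isEmpty_descending_chain]
  refine ⟨fun ⟨f, hf⟩ => ?_⟩
  have hmono : Monotone f := monotone_nat_of_le_succ fun i => (hf i).1.1
  have hx : ∀ i, ∃ x, x ∈ f (i + 1) ∧ x ∉ f i := fun i => Set.not_subset.1 (hf i).1.2
  choose x hx1 hx2 using hx
  obtain ⟨i, j, hij, h1, h2⟩ := wellQuasiOrdered_monomials x
  refine hx2 j ?_
  -- Closure under multiples is known only for the larger set of each step, hence for `f j` with `j
  -- ≥ 1`.
  obtain ⟨k, rfl⟩ : ∃ k, j = k + 1 := ⟨j - 1, by omega⟩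
  exact (hf k).2 _ _ (hmono (Nat.succ_le_of_lt hij) (hx1 i)) h2 h1

variable (P) in
/-- The monomials that are divisible by the leading monomial of a member of `G`. -/
def lmSet (ltE : (Fin n → ℕ) × Fin r → (Fin n → ℕ) × Fin r → Prop) (G : List (Fin r → A)) :
    Set ((Fin n → ℕ) × Fin r) :=
  {u | ∃ g ∈ G, ∃ p, P.IsLM ltE g p ∧ P.LeftDvd ltE p u}

theorem enlarges_lmSet (ho : P.IsLeftMonomialOrder ltE) {G : List (Fin r → A)} {η : Fin r → A}
    {p : (Fin n → ℕ) × Fin r} (hp : P.IsLM ltE η p) (hirr : p ∉ P.lmSet ltE G) :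
    Enlarges (P.lmSet ltE (G ++ [η])) (P.lmSet ltE G) := by
  refine ⟨⟨?_, fun hsub => hirr (hsub
    ⟨η, by simp, p, hp, (leftDvd_iff_le ho).2 ⟨rfl, le_rfl⟩⟩)⟩, ?_⟩
  · rintro u ⟨g, hg, h⟩
    exact ⟨g, List.mem_append_left _ hg, h⟩
  · rintro p u ⟨g, hg, p', hp', hdvd⟩ h1 h2
    rw [leftDvd_iff_le ho] at hdvd
    exact ⟨g, hg, p', hp', (leftDvd_iff_le ho).2 ⟨hdvd.1.trans h1, hdvd.2.trans h2⟩⟩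

theorem DivL.enlarges_lmSet (ho : P.IsLeftMonomialOrder ltE) {G : List (Fin r → A)}
    {ω η : Fin r → A} {c : ℕ →₀ A} (hd : P.DivL ltE G ω c η) (hη : η ≠ 0) :
    Enlarges (P.lmSet ltE (G ++ [η])) (P.lmSet ltE G) := by
  obtain ⟨p, hp⟩ := exists_isLM ho hη
  exact GradedSolvablePolynomialAlgebra.enlarges_lmSet ho hp
    fun ⟨g, hg, u, hu, hdvd⟩ => hd.irreducible p hp.1 g hg u hu hdvd

/-- The number of the tasks that are left, those of later degrees being counted twice. -/
def _root_.MinState.tasks (T : MinState A r) : ℕ :=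
  2 * T.pairs.card + T.curPairs.card + (2 * T.todo.card + T.curTodo.card)

-- A nonzero remainder may create many pairs but enlarges the set of reducible monomials, which has
-- lexicographic priority. All other steps keep that set and lower the number of tasks; in `next`,
-- this is because tasks moved to the current degree count once instead of twice.
open Classical in
theorem MinStep.decreases (ho : P.IsLeftMonomialOrder ltE) {S : MinState A r}
    (hS : P.MinStep b ltE T S) :
    Prod.Lex Enlarges (· < ·) (P.lmSet ltE S.groebner, S.tasks)
      (P.lmSet ltE T.groebner, T.tasks) := by
  cases hS with
  | next q' h₁ h₂ hq =>
    refine Prod.Lex.right _ ?_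
    have h3 := Finset.card_filter_add_card_filter_not (s := T.pairs)
      (fun ij => P.PairDeg b ltE T.groebner q' ij)
    have h4 := Finset.card_filter_add_card_filter_not (s := T.todo)
      (fun ξ => ξ ∈ P.freePart b q')
    have h5 : 0 < (T.pairs.filter fun ij => P.PairDeg b ltE T.groebner q' ij).card ∨
        0 < (T.todo.filter fun ξ => ξ ∈ P.freePart b q').card := by
      rcases hq.1 with ⟨ξ, hξ, hd⟩ | ⟨ij, hij, hd⟩
      · exact Or.inr (Finset.card_pos.2 ⟨ξ, Finset.mem_filter.2 ⟨hξ, hd⟩⟩)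
      · exact Or.inl (Finset.card_pos.2 ⟨ij, Finset.mem_filter.2 ⟨hij, hd⟩⟩)
    simp only [MinState.tasks, h₁, h₂, Finset.card_empty]
    omega
  | pairZero i j f f' s c hij hs hdiv =>
    refine Prod.Lex.right _ ?_
    have := Finset.card_erase_lt_of_mem hij
    simp only [MinState.tasks]
    omega
  | pairNew i j f f' s c η hij hs hdiv hη =>
    refine Prod.Lex.left _ _ ?_
    rw [groebner_adjoin]
    exact hdiv.enlarges_lmSet ho hη
  | genZero ξ c h₁ hξ hdiv =>
    refine Prod.Lex.right _ ?_
    have := Finset.card_erase_lt_of_mem hξ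
    simp only [MinState.tasks]
    omega
  | genNew ξ c η h₁ hξ hdiv hη =>
    refine Prod.Lex.left _ _ ?_
    rw [groebner_adjoin]
    exact hdiv.enlarges_lmSet ho hη

theorem acc_minStep (ho : P.IsLeftMonomialOrder ltE) (b : Fin r → ℕ) (T : MinState A r) :
    Acc (fun S T => P.MinStep b ltE T S) T := by
  have hwf : WellFounded fun S T : MinState A r =>
      Prod.Lex Enlarges (· < ·) (P.lmSet ltE S.groebner, S.tasks)
        (P.lmSet ltE T.groebner, T.tasks) :=
    InvImage.wf (fun T : MinState A r => (P.lmSet ltE T.groebner, T.tasks))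
      (WellFounded.prod_lex wellFounded_enlarges wellFounded_lt)
  exact Subrelation.accessible (fun h => MinStep.decreases ho h) (hwf.apply T)

theorem haltsWith_minOutput (ho : P.IsLeftMonomialOrder ltE) (hU : ∀ ξ ∈ U, P.IsHomog b ξ) :
    HaltsWith (P.MinStep b ltE) (P.MinOutput b ltE U) (MinState.init U) := by
  refine ⟨acc_minStep ho b _, fun T hT hstuck => ?_⟩
  obtain ⟨q, hq⟩ := MinInv.of_reachable ho hU hT
  exact hq.minOutput ho hU (hq.done_of_stuck ho hU hstuck)

end GradedSolvablePolynomialAlgebra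

/-! ### The syzygies of the minimal generators -/

namespace GradedSolvablePolynomialAlgebra

variable {K A : Type*} [Field K] [Ring A] [Algebra K A] {n : ℕ}
  {P : GradedSolvablePolynomialAlgebra K A n}

theorem HomogRow.truncate_mem {r : ℕ} {b : Fin r → ℕ} {L : List (Fin r → A)} {d t : ℕ}
    {c : ℕ →₀ A} (h : P.HomogRow b L d c) {b' : Fin t → ℕ}
    (hb : ∀ l : Fin t, b' l = P.degOf b (L.getD l 0)) : truncate A t c ∈ P.freePart b' d :=
  (P.mem_freePart b').2 fun p hp => by
    rw [hb]
    exact (h p.2 p.1 hp).2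

theorem hom_eq_linearCombination {t : ℕ} {M : Type*} [AddCommGroup M] [Module A M]
    (φ : (Fin t → A) →ₗ[A] M) : φ = Fintype.linearCombination A fun k => φ (Pi.single k 1) := by
  refine LinearMap.pi_ext' fun k => LinearMap.ext_ring ?_
  simp

variable {X : Stage A} {ltE : (Fin n → ℕ) × Fin X.rank → (Fin n → ℕ) × Fin X.rank → Prop}
  {T : MinState A X.rank}

theorem exists_syzStep (ho : P.IsLeftMonomialOrder ltE) (hX : ∀ ξ ∈ X.gens, P.IsHomog X.deg ξ)
    (hT : P.IsMinResult X ltE T) : ∃ Y φ, P.SyzStep X ltE T Y φ := by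
  obtain ⟨q, hq⟩ := MinInv.of_reachable ho hX hT.1
  have hgb := hq.isLeftGroebner ho hT.2
  have hQ : ∀ k : Fin T.umin.length, ∃ Q, P.DivL ltE T.groebner T.umin[k] Q 0 := fun k => by
    obtain ⟨Q, η, hd⟩ := DivL.exists_divL ho T.groebner T.umin[k]
    have := hd.eq_zero_of_groebner hgb (Submodule.subset_span (List.getElem_mem k.2))
    exact ⟨Q, this ▸ hd⟩
  choose Q hQ using hQ
  have hfin : {ξ : Fin T.umin.length → A |
      ξ ≠ 0 ∧ ((∃ σ ∈ T.syz, ξ = fun j : Fin T.umin.length => T.rowMul σ (j : ℕ)) ∨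
        ∃ k : Fin T.umin.length, ξ = fun j : Fin T.umin.length =>
          T.rowMul (Q k) (j : ℕ) - Finsupp.single (k : ℕ) (1 : A) (j : ℕ))}.Finite := by
    refine Set.Finite.subset ((hq.syz_finite.image
      fun σ => fun j : Fin T.umin.length => T.rowMul σ (j : ℕ)).union
      (Set.finite_range fun k : Fin T.umin.length => fun j : Fin T.umin.length =>
          T.rowMul (Q k) (j : ℕ) - Finsupp.single (k : ℕ) (1 : A) (j : ℕ))) ?_
    rintro ξ ⟨-, ⟨σ, hσ, rfl⟩ | ⟨k, rfl⟩⟩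
    · exact Or.inl ⟨σ, hσ, rfl⟩
    · exact Or.inr ⟨k, rfl⟩
  have hφ : ∀ k : Fin T.umin.length,
      Fintype.linearCombination A (fun k : Fin T.umin.length => T.umin[k]) (Pi.single k 1) =
        T.umin[k] := fun k => by simp
  refine ⟨⟨T.umin.length, fun k => P.degOf X.deg T.umin[k], hfin.toFinset⟩,
    Fintype.linearCombination A fun k : Fin T.umin.length => T.umin[k], rfl, fun k => ?_, Q,
    fun k => ?_, ?_⟩
  · rw [hφ k]
    exact ⟨List.getElem?_eq_getElem k.2,
      (hX _ (hq.umin_mem _ (List.getElem_mem k.2)).1).mem_degOf⟩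
  · rw [hφ k]
    exact hQ k
  · simp

/-- With `U_min = QG` and `G = V U_min`, a syzygy `y` of `U_min` gives the syzygy `yQ` of `G`. The
latter is a combination of the recorded ones, and `y = (yQ)V - y(QV - 1)`. -/
theorem syzStep_spec (ho : P.IsLeftMonomialOrder ltE) (hX : ∀ ξ ∈ X.gens, P.IsHomog X.deg ξ)
    (hT : P.IsMinResult X ltE T) {Y : Stage A} {φ : (Fin Y.rank → A) →ₗ[A] (Fin X.rank → A)}
    (h : P.SyzStep X ltE T Y φ) :
    (∀ ξ ∈ Y.gens, P.IsHomog Y.deg ξ) ∧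
      LinearMap.range φ = Submodule.span A (X.gens : Set (Fin X.rank → A)) ∧
      LinearMap.ker φ = Submodule.span A (Y.gens : Set (Fin Y.rank → A)) ∧
      IsMinGen (Submodule.span A (X.gens : Set (Fin X.rank → A)))
        (fun k => φ (Pi.single k 1)) ∧
      ∀ ξ ∈ LinearMap.ker φ, ∀ k, P.basis.repr (ξ k) 0 = 0 := by
  obtain ⟨q, hq⟩ := MinInv.of_reachable ho hX hT.1
  obtain ⟨yr, yd, yg⟩ := Y
  obtain ⟨hr, hφ, Q, hQ, hg⟩ := h
  dsimp only at hr φ hφ Q hQ hg ⊢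
  subst hr
  have hφk : ∀ k : Fin T.umin.length, φ (Pi.single k 1) = T.umin[k] := fun k => by
    have := (hφ k).1
    rw [List.getElem?_eq_getElem k.2] at this
    exact (Option.some.inj this).symm
  have hφeq : φ = Fintype.linearCombination A fun k : Fin T.umin.length => T.umin[k] := by
    rw [hom_eq_linearCombination φ]
    simp only [hφk]
  have hφrow : ∀ c, φ (truncate A _ c) = rowEval T.umin c := fun c => by
    rw [hφeq, ← rowEval_eq_truncate T.umin rfl]
  have hUhom : ∀ k : Fin T.umin.length, P.IsHomog X.deg T.umin[k] := fun k =>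
    hX _ (hq.umin_mem _ (List.getElem_mem k.2)).1
  have hGhom : ∀ g ∈ T.groebner, P.IsHomog X.deg g := fun g hg => (hq.homog g hg).1
  have hgetD : ∀ k : Fin T.umin.length, T.umin.getD k 0 = T.umin[k] := fun k => by
    rw [List.getD_eq_getElem?_getD, List.getElem?_eq_getElem k.2, Option.getD_some]
    rfl
  have hdeg : ∀ k : Fin T.umin.length, yd k = P.degOf X.deg (T.umin.getD k 0) := fun k => by
    rw [hgetD]
    refine (degOf_eq (hUhom k).1 ?_).symm
    rw [← hφk k]
    exact (hφ k).2
  have hQeval : ∀ k, rowEval T.groebner (Q k) = T.umin[k] := fun k => by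
    have := (hQ k).eval
    rwa [add_zero, hφk] at this
  have hrow : ∀ k : Fin T.umin.length, (fun j : Fin T.umin.length =>
      T.rowMul (Q k) (j : ℕ) - Finsupp.single (k : ℕ) (1 : A) (j : ℕ)) =
      truncate A _ (T.rowMul (Q k) - Finsupp.single (k : ℕ) 1) := fun k => rfl
  have hgmem : ∀ ξ, ξ ∈ yg ↔ ξ ≠ 0 ∧ ((∃ σ ∈ T.syz, ξ = truncate A _ (T.rowMul σ)) ∨
      ∃ k : Fin T.umin.length,
        ξ = truncate A _ (T.rowMul (Q k) - Finsupp.single (k : ℕ) 1)) := fun ξ => by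
    rw [← Finset.mem_coe, hg]
    rfl
  have hspan : Submodule.span A (Set.range fun l : Fin T.umin.length => T.umin[l]) =
      Submodule.span A (X.gens : Set (Fin X.rank → A)) :=
    (MinInv.span_range_umin T).trans (hq.span_umin hT.2)
  refine ⟨fun ξ hξ => ?_, ?_, le_antisymm (fun y hy => ?_) (Submodule.span_le.2 fun ξ hξ => ?_),
    ?_, ?_⟩
  · obtain ⟨h0, ⟨σ, hσ, rfl⟩ | ⟨k, rfl⟩⟩ := (hgmem ξ).1 hξ
    · obtain ⟨d, hd⟩ := (hq.syz σ hσ).2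
      exact ⟨h0, d, (hq.homogRow_rowMul hd).truncate_mem hdeg⟩
    · have h1 := ((hQ k).homog ho hGhom (hφ k).2).2
      refine ⟨h0, yd k, ((hq.homogRow_rowMul h1).sub ?_).truncate_mem hdeg⟩
      exact HomogRow.single (List.getElem?_eq_getElem k.2) P.one_mem_part
        (by rw [zero_add, hdeg, hgetD]; rfl)
  · rw [hφeq, Fintype.range_linearCombination, hspan]
  · set c : ℕ →₀ A := ∑ k, y k • Q k with hc
    have h1 : rowEval T.groebner c = 0 := by
      rw [hc, map_sum]
      simp only [map_smul, hQeval]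
      rw [LinearMap.mem_ker, hφeq] at hy
      exact hy
    have h2 := hq.mem_span_syz ho hT.2 h1
    have hrowlen : (T.basis.map Prod.snd).length = T.groebner.length := by
      simp [MinState.groebner]
    -- Multiplication by `V` on rows of the exact length, to which generation of the syzygies
    -- applies.
    let W : (Fin T.groebner.length → A) →ₗ[A] (Fin T.umin.length → A) :=
      (truncate A T.umin.length).comp
        (Fintype.linearCombination A fun l : Fin T.groebner.length =>
          (T.basis.map Prod.snd)[(l : ℕ)]'(hrowlen.symm ▸ l.2))
    have hW : ∀ σ, W (truncate A _ σ) = truncate A _ (T.rowMul σ) := fun σ => by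
      rw [rowMul_eq_rowEval, rowEval_eq_truncate (T.basis.map Prod.snd) hrowlen]
      rfl
    have hsub : ∀ ξ, ((∃ σ ∈ T.syz, ξ = truncate A _ (T.rowMul σ)) ∨
        ∃ k : Fin T.umin.length, ξ = truncate A _ (T.rowMul (Q k) - Finsupp.single (k : ℕ) 1)) →
        ξ ∈ Submodule.span A (yg : Set (Fin T.umin.length → A)) := fun ξ hξ => by
      rcases eq_or_ne ξ 0 with rfl | h0
      · exact zero_mem _
      · exact Submodule.subset_span ((hgmem ξ).2 ⟨h0, hξ⟩)
    have h3 : truncate A _ (T.rowMul c) ∈ Submodule.span A (yg : Set (Fin T.umin.length → A)) := by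
      rw [← hW]
      refine (Submodule.span_le (p := (Submodule.span A
        (yg : Set (Fin T.umin.length → A))).comap W)).2 ?_ h2
      rintro z ⟨σ, hσ, rfl⟩
      change W (truncate A _ σ) ∈ Submodule.span A (yg : Set (Fin T.umin.length → A))
      rw [hW]
      exact hsub _ (Or.inl ⟨σ, hσ, rfl⟩)
    have h4 : y = truncate A _ (T.rowMul c) - ∑ k : Fin T.umin.length,
        y k • truncate A _ (T.rowMul (Q k) - Finsupp.single (k : ℕ) 1) := by
      have h5 : T.rowMul c = ∑ k, y k • T.rowMul (Q k) := by
        simp only [rowMul_eq_rowEval, hc, map_sum, map_smul]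
      rw [h5]
      simp only [map_sub, smul_sub, map_sum, map_smul, Finset.sum_sub_distrib, sub_sub_cancel]
      ext j
      rw [Finset.sum_apply, Finset.sum_eq_single j]
      · simp
      · intro k _ hkj
        have : (k : ℕ) ≠ j := fun h => hkj (Fin.ext h)
        simp [this]
      · simp
    rw [h4]
    exact sub_mem h3 (Submodule.sum_mem _ fun k _ =>
      Submodule.smul_mem _ _ (hsub _ (Or.inr ⟨k, rfl⟩)))
  · change φ ξ = 0
    obtain ⟨-, ⟨σ, hσ, rfl⟩ | ⟨k, rfl⟩⟩ := (hgmem ξ).1 hξ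
    · rw [hφrow, hq.rowEval_rowMul]
      exact (hq.syz σ hσ).1
    · rw [hφrow, map_sub, hq.rowEval_rowMul, hQeval, rowEval_single (List.getElem?_eq_getElem k.2),
        one_smul]
      exact sub_self _
  · simp only [hφk]
    exact isMinGen_of_ker (P := P) hspan fun f hf k => hq.constant_eq_zero hX hf k
  · intro ξ hξ k
    rw [LinearMap.mem_ker, hφeq] at hξ
    exact hq.constant_eq_zero hX hξ k

end GradedSolvablePolynomialAlgebra

/-! ### Minimal generating sets of quotient modules -/

namespace GradedSolvablePolynomialAlgebra

variable {K A : Type*} [Field K] [Ring A] [Algebra K A] {n : ℕ}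
  (P : GradedSolvablePolynomialAlgebra K A n)

/-- A product of two monomials is homogeneous of the sum of their degrees, so it has a constant term
only if both are `1`. Taking constant terms is thus multiplicative. -/
theorem repr_mul_zero (f g : A) :
    P.basis.repr (f * g) 0 = P.basis.repr f 0 * P.basis.repr g 0 := by
  classical
  let B : A →ₗ[K] A →ₗ[K] K := (LinearMap.mul K A).compr₂ (P.basis.coord 0)
  let C : A →ₗ[K] A →ₗ[K] K := (LinearMap.mul K K).compl₁₂ (P.basis.coord 0) (P.basis.coord 0)
  have hBC : B = C := by
    refine P.basis.ext fun α => P.basis.ext fun β => ?_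
    change P.basis.repr (P.basis α * P.basis β) 0 =
      P.basis.repr (P.basis α) 0 * P.basis.repr (P.basis β) 0
    by_cases h : α = 0 ∧ β = 0
    · obtain ⟨rfl, rfl⟩ := h
      simp [basis_zero, repr_one_zero]
    · have h1 : P.basis.repr (P.basis α * P.basis β) 0 = 0 := by
        by_contra h0
        have h2 := P.mem_part.1 (P.mul_mem_part (P.basis_mem_part α) (P.basis_mem_part β)) 0 h0
        rw [weight_zero] at h2
        exact h ⟨P.weight_eq_zero (by omega), P.weight_eq_zero (by omega)⟩
      rw [h1, Module.Basis.repr_self, Module.Basis.repr_self]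
      rcases not_and_or.1 h with h | h <;> simp [h]
  exact LinearMap.congr_fun₂ hBC f g

/-- The elements of `A^r` none of whose coordinates has a constant term. -/
def constFree (r : ℕ) : Submodule A (Fin r → A) where
  carrier := {x | ∀ i, P.basis.repr (x i) 0 = 0}
  zero_mem' := by simp
  add_mem' hx hy i := by simp [hx i, hy i]
  smul_mem' f x hx i := by
    change P.basis.repr (f * x i) 0 = 0
    rw [P.repr_mul_zero, hx i, mul_zero]

variable {P}

/-- A constant term at `i` forces the degree of `ξ` to be `b i`. The whole entry then has degree
zero and is a nonzero scalar, which is excluded. -/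
theorem mem_constFree_of_isHomog {r : ℕ} {b : Fin r → ℕ} {ξ : Fin r → A} (h : P.IsHomog b ξ)
    (h' : ∀ i, ∀ c : K, c ≠ 0 → ξ i ≠ algebraMap K A c) : ξ ∈ P.constFree r := fun i => by
  obtain ⟨-, q, hq⟩ := h
  by_contra h0
  have hb := (P.mem_freePart b).1 hq (0, i) h0
  rw [weight_zero, zero_add] at hb
  have h1 := P.apply_mem_part b hq hb.le
  rw [hb, Nat.sub_self] at h1
  exact h' i _ h0 (P.eq_algebraMap_of_mem_part_zero h1)

theorem algebraMap_ne_zero (P : GradedSolvablePolynomialAlgebra K A n) {c : K} (hc : c ≠ 0) :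
    algebraMap K A c ≠ 0 := fun h => hc (by
  have := P.repr_algebraMap_zero c
  rw [h] at this
  simpa using this.symm)

variable {s : ℕ} {M : Type*} [AddCommGroup M] [Module A M] {b : Fin s → ℕ} {v : Fin s → M}
  {U : Finset (Fin s → A)} {X : Finset (Fin s) × Finset (Fin s → A)}

variable (P b v U) in
/-- The invariant of the computation of a minimal generating set of a quotient module. -/
structure QuotInv (X : Finset (Fin s) × Finset (Fin s → A)) : Prop where
  homog : ∀ ξ ∈ X.2, P.IsHomog b ξ
  outside : ∀ ξ ∈ X.2, ∀ i ∉ X.1, ξ i = 0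
  mem_span : ∀ ξ ∈ X.2, ξ ∈ Submodule.span A (U : Set (Fin s → A))
  ker : ∀ x : Fin s → A, (∀ i ∉ X.1, x i = 0) → Fintype.linearCombination A v x = 0 →
    x ∈ Submodule.span A (X.2 : Set (Fin s → A))
  gen : ∀ i, v i ∈ Submodule.span A (v '' X.1)

namespace QuotInv

theorem init (hU : ∀ ξ ∈ U, P.IsHomog b ξ)
    (hker : Submodule.span A (U : Set (Fin s → A)) =
      LinearMap.ker (Fintype.linearCombination A v)) : P.QuotInv b v U (Finset.univ, U) where
  homog := hU
  outside := by simp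
  mem_span ξ hξ := Submodule.subset_span hξ
  ker x _ hx := by
    change x ∈ Submodule.span A (U : Set (Fin s → A))
    rw [hker]
    exact hx
  gen i := Submodule.subset_span ⟨i, by simp, rfl⟩

theorem step (hker : Submodule.span A (U : Set (Fin s → A)) =
      LinearMap.ker (Fintype.linearCombination A v)) (hX : P.QuotInv b v U X)
    {Y : Finset (Fin s) × Finset (Fin s → A)} (h : QuotStep K X Y) : P.QuotInv b v U Y := by
  classical
  obtain ⟨w, hw, i, hi, c, hc, hwi, -, hY1, hY2⟩ := h
  have hmem : ∀ ξ, ξ ∈ Y.2 ↔ ξ ≠ 0 ∧ ∃ u ∈ X.2.erase w, u - (c⁻¹ • u i) • w = ξ := fun ξ => by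
    rw [hY2, Finset.mem_erase, Finset.mem_image]
  -- Scalars are central, so the multiplier `c⁻¹ u_i` on the left does cancel the entry at `i`.
  have hcancel : ∀ a : A, (c⁻¹ • a) * w i = a := fun a => by
    rw [hwi, smul_mul_assoc, ← Algebra.commutes, ← Algebra.smul_def, smul_smul,
      inv_mul_cancel₀ hc, one_smul]
  have hout : ∀ ξ ∈ Y.2, ∀ k ∉ Y.1, ξ k = 0 := by
    intro ξ hξ k hk
    obtain ⟨h0, u, hu, rfl⟩ := (hmem ξ).1 hξ
    rw [hY1, Finset.mem_erase, not_and_or, not_not] at hk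
    rcases hk with rfl | hk
    · change u k - (c⁻¹ • u k) * w k = 0
      rw [hcancel, sub_self]
    · simp [hX.outside u (Finset.mem_of_mem_erase hu) k hk, hX.outside w hw k hk]
  constructor
  · intro ξ hξ
    obtain ⟨h0, u, hu, rfl⟩ := (hmem ξ).1 hξ
    obtain ⟨-, q, hq⟩ := hX.homog u (Finset.mem_of_mem_erase hu)
    obtain ⟨-, q', hq'⟩ := hX.homog w hw
    refine ⟨h0, q, sub_mem hq ?_⟩
    -- The scalar entry of `w` at `i` fixes its degree as `b i`, so `u_i w` has the degree of `u`.
    have hb : b i = q' := by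
      have := (P.mem_freePart b).1 hq' (0, i) (by
        change P.basis.repr (w i) 0 ≠ 0
        rwa [hwi, repr_algebraMap_zero])
      rwa [weight_zero, zero_add] at this
    by_cases hle : b i ≤ q
    · have h1 := P.smul_mem_freePart (Submodule.smul_mem _ c⁻¹ (P.apply_mem_part b hq hle)) hq'
      rwa [← hb, Nat.sub_add_cancel hle] at h1
    · rw [P.apply_eq_zero b hq (not_le.1 hle)]
      simp
  · exact hout
  · intro ξ hξ
    obtain ⟨h0, u, hu, rfl⟩ := (hmem ξ).1 hξ
    exact sub_mem (hX.mem_span u (Finset.mem_of_mem_erase hu))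
      (Submodule.smul_mem _ _ (hX.mem_span w hw))
  · intro x hx hΦ
    have hiY : i ∉ Y.1 := by simp [hY1]
    have h1 : x ∈ Submodule.span A {w} ⊔ Submodule.span A (Y.2 : Set (Fin s → A)) := by
      refine Submodule.span_le.2 (fun u hu => ?_) (hX.ker x (fun k hk => hx k fun h => hk ?_) hΦ)
      · rcases eq_or_ne u w with rfl | huw
        · exact Submodule.mem_sup_left (Submodule.mem_span_singleton_self _)
        · have h2 : u - (c⁻¹ • u i) • w ∈ Submodule.span A (Y.2 : Set (Fin s → A)) := by
            by_cases h0 : u - (c⁻¹ • u i) • w = 0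
            · rw [h0]; exact zero_mem _
            · exact Submodule.subset_span
                ((hmem _).2 ⟨h0, u, Finset.mem_erase.2 ⟨huw, hu⟩, rfl⟩)
          have h3 := add_mem (Submodule.mem_sup_right (S := Submodule.span A {w}) h2)
            (Submodule.mem_sup_left (Submodule.smul_mem _ (c⁻¹ • u i)
              (Submodule.mem_span_singleton_self w)))
          rwa [sub_add_cancel] at h3
      · rw [hY1] at h
        exact Finset.mem_of_mem_erase h
    obtain ⟨y, hy, z, hz, rfl⟩ := Submodule.mem_sup.1 h1
    obtain ⟨f, rfl⟩ := Submodule.mem_span_singleton.1 hy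
    -- All new relations vanish at the eliminated index. A relation `f w + z` without entry at `i`
    -- thus has `f w_i = 0`, and `f = 0` as `w_i` is invertible.
    have hzi : z i = 0 := by
      refine (Submodule.span_le (p := LinearMap.ker (LinearMap.proj (R := A) i))).2 ?_ hz
      exact fun ξ hξ => hout ξ hξ i hiY
    have hf : f = 0 := by
      have h2 := hx i hiY
      have h3 := hcancel (c • f)
      rw [smul_smul, inv_mul_cancel₀ hc, one_smul] at h3
      rw [Pi.add_apply, hzi, add_zero, Pi.smul_apply, smul_eq_mul, h3] at h2
      rw [← one_smul K f, ← inv_mul_cancel₀ hc, mul_smul, h2, smul_zero]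
    rwa [hf, zero_smul, zero_add]
  -- Solving the relation `w` for `v i` expresses it through the remaining generators.
  · have hvi : v i ∈ Submodule.span A (v '' Y.1) := by
      have h1 : Fintype.linearCombination A v w = 0 := by
        have := hX.mem_span w hw
        rwa [hker] at this
      rw [Fintype.linearCombination_apply, ← Finset.add_sum_erase _ _ (Finset.mem_univ i)] at h1
      have h2 : w i • v i ∈ Submodule.span A (v '' Y.1) := by
        rw [eq_neg_of_add_eq_zero_left h1]
        refine Submodule.neg_mem _ (Submodule.sum_mem _ fun k hk => ?_)
        by_cases hkX : k ∈ X.1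
        · refine Submodule.smul_mem _ _ (Submodule.subset_span ⟨k, ?_, rfl⟩)
          rw [hY1]
          exact Finset.mem_coe.2 (Finset.mem_erase.2 ⟨Finset.ne_of_mem_erase hk, hkX⟩)
        · rw [hX.outside w hw k hkX, zero_smul]
          exact zero_mem _
      have h3 := Submodule.smul_mem _ (c⁻¹ • (1 : A)) h2
      rwa [smul_smul, hcancel, one_smul] at h3
    intro k
    refine Submodule.span_le.2 ?_ (hX.gen k)
    rintro _ ⟨j, hj, rfl⟩
    rcases eq_or_ne j i with rfl | hji
    · exact hvi
    · refine Submodule.subset_span ⟨j, ?_, rfl⟩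
      rw [hY1]
      exact Finset.mem_coe.2 (Finset.mem_erase.2 ⟨hji, hj⟩)

theorem of_reachable (hU : ∀ ξ ∈ U, P.IsHomog b ξ)
    (hker : Submodule.span A (U : Set (Fin s → A)) =
      LinearMap.ker (Fintype.linearCombination A v))
    (h : Relation.ReflTransGen (QuotStep K) (Finset.univ, U) X) : P.QuotInv b v U X := by
  induction h with
  | refl => exact init hU hker
  | tail _ h ih => exact ih.step hker h

end QuotInv

theorem acc_quotStep (X : Finset (Fin s) × Finset (Fin s → A)) :
    Acc (fun Y X => QuotStep K X Y) X := by
  refine Subrelation.accessible (r := InvImage (· < ·) fun X : Finset (Fin s) × Finset (Fin s → A) =>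
    X.1.card) (fun {Y X} h => ?_) ((InvImage.wf _ wellFounded_lt).apply X)
  obtain ⟨w, hw, i, hi, c, hc, hwi, -, hY1, hY2⟩ := h
  change Y.1.card < X.1.card
  rw [hY1]
  exact Finset.card_erase_lt_of_mem hi

theorem linearCombination_eq_quotMap (E : Finset (Fin s)) {x : Fin s → A}
    (hx : ∀ i ∉ E, x i = 0) :
    Fintype.linearCombination A v x = quotMap v E fun k => x (E.orderEmbOfFin rfl k) := by
  rw [quotMap, Fintype.linearCombination_apply, Fintype.linearCombination_apply,
    ← Finset.sum_subset (Finset.subset_univ E) fun i _ hi => by rw [hx i hi, zero_smul]]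
  conv_lhs => rw [← E.map_orderEmbOfFin_univ rfl]
  rw [Finset.sum_map]
  rfl

/-- Extension by zero of an element of the free module on the basis vectors in `E`. -/
noncomputable def extendZero (E : Finset (Fin s)) (y : Fin E.card → A) : Fin s → A :=
  Function.extend (E.orderEmbOfFin rfl) y 0

theorem extendZero_apply (E : Finset (Fin s)) (y : Fin E.card → A) (k : Fin E.card) :
    extendZero E y (E.orderEmbOfFin rfl k) = y k :=
  (E.orderEmbOfFin rfl).injective.extend_apply _ _ _

theorem extendZero_outside (E : Finset (Fin s)) (y : Fin E.card → A) {i : Fin s} (hi : i ∉ E) :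
    extendZero E y i = 0 := by
  refine Function.extend_apply' _ _ _ ?_
  rintro ⟨k, rfl⟩
  exact hi (E.orderEmbOfFin_mem rfl k)

namespace QuotInv

/-- Entries outside `E` vanish, so a scalar entry lies in `E`. The first such entry would permit
another elimination. -/
theorem notUnit (hX : P.QuotInv b v U X) (hstuck : ∀ Y, ¬ QuotStep K X Y) {ξ : Fin s → A}
    (hξ : ξ ∈ X.2) (i : Fin s) (c : K) (hc : c ≠ 0) : ξ i ≠ algebraMap K A c := by
  classical
  intro h
  let S := X.1.filter fun i => ∃ c : K, c ≠ 0 ∧ ξ i = algebraMap K A c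
  have hi : i ∈ X.1 := by
    by_contra hi
    rw [hX.outside ξ hξ i hi] at h
    exact algebraMap_ne_zero P hc h.symm
  have hS : S.Nonempty := ⟨i, Finset.mem_filter.2 ⟨hi, c, hc, h⟩⟩
  obtain ⟨h1, c', hc', h2⟩ := Finset.mem_filter.1 (S.min'_mem hS)
  refine hstuck (_, _) ⟨ξ, hξ, S.min' hS, h1, c', hc', h2, fun k hk hlt c'' hc'' h3 => ?_, rfl, rfl⟩
  exact absurd (S.min'_le k (Finset.mem_filter.2 ⟨hk, c'', hc'', h3⟩)) (not_le.2 hlt)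

theorem ker_quotMap (hX : P.QuotInv b v U X)
    (hker : Submodule.span A (U : Set (Fin s → A)) =
      LinearMap.ker (Fintype.linearCombination A v)) :
    LinearMap.ker (quotMap (A := A) v X.1) =
      Submodule.span A ((quotStage b X).gens : Set (Fin (quotStage b X).rank → A)) := by
  classical
  let ρ : (Fin s → A) →ₗ[A] (Fin X.1.card → A) := LinearMap.funLeft A A (X.1.orderEmbOfFin rfl)
  have hgens : ((X.2.image fun ξ k => ξ (X.1.orderEmbOfFin rfl k) : Finset (Fin X.1.card → A)) :
      Set (Fin X.1.card → A)) = ρ '' X.2 := Finset.coe_image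
  change _ = Submodule.span A ((X.2.image fun ξ k => ξ (X.1.orderEmbOfFin rfl k) :
    Finset (Fin X.1.card → A)) : Set (Fin X.1.card → A))
  rw [hgens, ← Submodule.map_span]
  refine le_antisymm (fun y hy => ?_) (Submodule.map_le_iff_le_comap.2 (Submodule.span_le.2
    fun ξ hξ => ?_))
  · refine ⟨extendZero X.1 y, hX.ker _ (fun i hi => extendZero_outside X.1 y hi) ?_, ?_⟩
    · rw [linearCombination_eq_quotMap X.1 fun i hi => extendZero_outside X.1 y hi]
      simp only [extendZero_apply]
      exact hy
    · exact funext fun k => extendZero_apply X.1 y k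
  · change quotMap v X.1 (fun k => ξ (X.1.orderEmbOfFin rfl k)) = 0
    rw [← linearCombination_eq_quotMap X.1 (hX.outside ξ hξ)]
    have := hX.mem_span ξ hξ
    rwa [hker] at this

theorem homog_gens (hX : P.QuotInv b v U X) :
    ∀ ξ ∈ (quotStage b X).gens, P.IsHomog (quotStage b X).deg ξ := by
  classical
  intro y hy
  obtain ⟨ξ, hξ, rfl⟩ := Finset.mem_image.1 hy
  obtain ⟨h0, q, hq⟩ := hX.homog ξ hξ
  refine ⟨fun h => h0 (funext fun i => ?_), q, (P.mem_freePart _).2 fun p hp => ?_⟩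
  · by_cases hi : i ∈ X.1
    · obtain ⟨k, rfl⟩ : i ∈ Set.range (X.1.orderEmbOfFin rfl) := by
        rwa [Finset.range_orderEmbOfFin]
      exact congrFun h k
    · exact hX.outside ξ hξ i hi
  · exact (P.mem_freePart b).1 hq (p.1, X.1.orderEmbOfFin rfl p.2) hp

theorem span_gens_le (hX : P.QuotInv b v U X) (hstuck : ∀ Y, ¬ QuotStep K X Y) :
    Submodule.span A ((quotStage b X).gens : Set (Fin (quotStage b X).rank → A)) ≤
      P.constFree _ := by
  classical
  refine Submodule.span_le.2 fun y hy => ?_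
  obtain ⟨ξ, hξ, rfl⟩ := Finset.mem_image.1 (Finset.mem_coe.1 hy)
  exact fun k => mem_constFree_of_isHomog (hX.homog ξ hξ)
    (fun i c hc => hX.notUnit hstuck hξ i c hc) (X.1.orderEmbOfFin rfl k)

theorem surjective_quotMap (hX : P.QuotInv b v U X)
    (hv : Submodule.span A (Set.range v) = ⊤) :
    Function.Surjective (quotMap (A := A) v X.1) := by
  rw [← LinearMap.range_eq_top, quotMap, Fintype.range_linearCombination, eq_top_iff, ← hv]
  refine Submodule.span_le.2 ?_
  rintro _ ⟨i, rfl⟩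
  refine Submodule.span_mono ?_ (hX.gen i)
  rintro _ ⟨j, hj, rfl⟩
  obtain ⟨k, rfl⟩ : j ∈ Set.range (X.1.orderEmbOfFin rfl) := by
    rwa [Finset.range_orderEmbOfFin]
  exact ⟨k, rfl⟩

theorem ker_le_constFree (hX : P.QuotInv b v U X) (hstuck : ∀ Y, ¬ QuotStep K X Y)
    (hker : Submodule.span A (U : Set (Fin s → A)) =
      LinearMap.ker (Fintype.linearCombination A v)) :
    LinearMap.ker (quotMap (A := A) v X.1) ≤ P.constFree _ := by
  rw [hX.ker_quotMap hker]
  exact hX.span_gens_le hstuck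

theorem quotOutput (hX : P.QuotInv b v U X) (hstuck : ∀ Y, ¬ QuotStep K X Y)
    (hv : Submodule.span A (Set.range v) = ⊤)
    (hker : Submodule.span A (U : Set (Fin s → A)) =
      LinearMap.ker (Fintype.linearCombination A v)) : P.QuotOutput b v U X := by
  refine ⟨fun ξ hξ => ⟨hX.mem_span ξ hξ, hX.homog ξ hξ, hX.outside ξ hξ, hX.notUnit hstuck hξ⟩,
    isMinGen_of_ker (P := P) ?_ fun f hf i => ?_, hX.surjective_quotMap hv, hX.ker_quotMap hker⟩
  · rw [eq_top_iff, ← hv]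
    refine Submodule.span_le.2 ?_
    rintro _ ⟨i, rfl⟩
    refine Submodule.span_mono ?_ (hX.gen i)
    rintro _ ⟨j, hj, rfl⟩
    exact ⟨⟨j, hj⟩, rfl⟩
  · obtain ⟨k, hk⟩ : (i : Fin s) ∈ Set.range (X.1.orderEmbOfFin rfl) := by
      rw [Finset.range_orderEmbOfFin]
      exact i.2
    let e := X.1.orderIsoOfFin rfl
    have h1 : quotMap (A := A) v X.1 (fun k => f (e k)) = 0 := by
      rw [← hf, quotMap, Fintype.linearCombination_apply, Fintype.linearCombination_apply]
      exact Fintype.sum_equiv e.toEquiv _ _ fun k => rfl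
    have h2 := hX.ker_le_constFree hstuck hker h1 k
    have h3 : e k = i := Subtype.ext hk
    simpa only [h3] using h2

end QuotInv

theorem haltsWith_quotOutput (hU : ∀ ξ ∈ U, P.IsHomog b ξ)
    (hv : Submodule.span A (Set.range v) = ⊤)
    (hker : Submodule.span A (U : Set (Fin s → A)) =
      LinearMap.ker (Fintype.linearCombination A v)) :
    HaltsWith (QuotStep K) (P.QuotOutput b v U) (Finset.univ, U) :=
  ⟨acc_quotStep _, fun _ hX hstuck =>
    (QuotInv.of_reachable hU hker hX).quotOutput hstuck hv hker⟩

end GradedSolvablePolynomialAlgebra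

/-! ### Finite Gröbner bases -/

namespace GradedSolvablePolynomialAlgebra

variable {K A : Type*} [Field K] [Ring A] [Algebra K A] {n : ℕ}
  {P : GradedSolvablePolynomialAlgebra K A n} {r : ℕ}
  {ltE : (Fin n → ℕ) × Fin r → (Fin n → ℕ) × Fin r → Prop}

/-- By well-foundedness some finite list from `N` cannot be extended so as to enlarge its set of
reducible monomials; such a list is a Gröbner basis. -/
theorem exists_groebner (ho : P.IsLeftMonomialOrder ltE) (N : Submodule A (Fin r → A)) :
    ∃ G, P.IsLeftGroebner ltE N G := by
  obtain ⟨G, hG, hmin⟩ := (InvImage.wf (P.lmSet ltE) wellFounded_enlarges).has_min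
    {G : List (Fin r → A) | ∀ g ∈ G, g ∈ N ∧ g ≠ 0} ⟨[], by simp⟩
  refine ⟨G, hG, fun ξ hξ h0 => ?_⟩
  obtain ⟨u, hu⟩ := exists_isLM ho h0
  by_contra hno
  refine hmin (G ++ [ξ]) ?_ (enlarges_lmSet ho hu ?_)
  · intro g hg
    rcases List.mem_append.1 hg with h | h
    · exact hG g h
    · rw [List.mem_singleton.1 h]
      exact ⟨hξ, h0⟩
  · rintro ⟨g, hg, p, hp, hdvd⟩
    exact hno ⟨g, hg, p, u, hp, hu, hdvd⟩

theorem IsLeftGroebner.span_eq (ho : P.IsLeftMonomialOrder ltE) {N : Submodule A (Fin r → A)}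
    {G : List (Fin r → A)} (hG : P.IsLeftGroebner ltE N G) :
    Submodule.span A {x | x ∈ G} = N := by
  refine le_antisymm (Submodule.span_le.2 fun g hg => (hG.1 g hg).1) fun ξ hξ => ?_
  obtain ⟨q, η, hd⟩ := DivL.exists_divL ho G ξ
  rw [← hd.eval, hd.eq_zero_of_groebner hG hξ, add_zero]
  exact rowEval_mem_span _ _

theorem submodule_fg (P : GradedSolvablePolynomialAlgebra K A n) (N : Submodule A (Fin r → A)) :
    N.FG := by
  obtain ⟨ltE, ho⟩ := exists_isLeftMonomialOrder P r
  obtain ⟨G, hG⟩ := exists_groebner ho N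
  rw [← hG.span_eq ho]
  exact Submodule.fg_span (List.finite_toSet G)

/-! ### Leading monomials that do not depend on the first variables -/

/-- Erase the exponents of the first `k` variables. -/
def eraseBelow (k : ℕ) (u : (Fin n → ℕ) × Fin r) : (Fin n → ℕ) × Fin r :=
  (fun i => if (i : ℕ) < k then 0 else u.1 i, u.2)

theorem eraseBelow_le (k : ℕ) (u : (Fin n → ℕ) × Fin r) : (eraseBelow k u).1 ≤ u.1 := fun i => by
  simp only [eraseBelow]
  split_ifs
  · exact Nat.zero_le _
  · exact le_rfl

variable (P ltE) in
/-- The leading monomials of the nonzero elements of `N` remain such when the first `k` variables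
are omitted. -/
def LeadingFree (k : ℕ) (N : Submodule A (Fin r → A)) : Prop :=
  ∀ ξ ∈ N, ∀ u, P.IsLM ltE ξ u → ∃ ξ' ∈ N, P.IsLM ltE ξ' (eraseBelow k u)

theorem leadingFree_zero (N : Submodule A (Fin r → A)) : P.LeadingFree ltE 0 N :=
  fun ξ hξ u hu => ⟨ξ, hξ, by simpa [eraseBelow] using hu⟩

/-- Each member of a Gröbner basis may be replaced by an element of `N` whose leading monomial is
the old one with the first `k` variables erased, since the new one divides the old one. The result
is then sorted by the exponent of the next variable. -/
theorem exists_sorted_groebner (ho : P.IsLeftMonomialOrder ltE) {k : ℕ} (hk : k < n)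
    {N : Submodule A (Fin r → A)} (hN : P.LeadingFree ltE k N) :
    ∃ (t : ℕ) (g : Fin t → Fin r → A) (m : Fin t → (Fin n → ℕ) × Fin r),
      (∀ l, P.IsLM ltE (g l) (m l)) ∧ P.IsLeftGroebner ltE N (List.ofFn g) ∧
      (∀ l (i : Fin n), (i : ℕ) < k → (m l).1 i = 0) ∧
      Monotone fun l => (m l).1 ⟨k, hk⟩ := by
  obtain ⟨G, hG⟩ := exists_groebner ho N
  have h1 : ∀ l : Fin G.length, ∃ u g, g ∈ N ∧ P.IsLM ltE g u ∧
      (∀ i : Fin n, (i : ℕ) < k → u.1 i = 0) ∧ ∀ p, P.IsLM ltE G[l] p → P.LeftDvd ltE u p := by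
    intro l
    obtain ⟨hl, hl0⟩ := hG.1 G[l] (List.getElem_mem l.2)
    obtain ⟨p, hp⟩ := exists_isLM ho hl0
    obtain ⟨g, hg, hgu⟩ := hN _ hl p hp
    refine ⟨_, g, hg, hgu, fun i hi => by simp [eraseBelow, hi], fun p' hp' => ?_⟩
    rw [hp'.eq ho hp, leftDvd_iff_le ho]
    exact ⟨rfl, eraseBelow_le k p⟩
  choose m g hgN hgm hm hdvd using h1
  let σ := Tuple.sort fun l => (m l).1 ⟨k, hk⟩
  refine ⟨G.length, g ∘ σ, m ∘ σ, fun l => hgm _, ⟨?_, fun ξ hξ h0 => ?_⟩, fun l => hm _,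
    Tuple.monotone_sort fun l => (m l).1 ⟨k, hk⟩⟩
  · intro x hx
    obtain ⟨l, rfl⟩ := (List.mem_ofFn' _ _).1 hx
    exact ⟨hgN _, (hgm _).ne_zero⟩
  · obtain ⟨x, hx, p, u, hp, hu, hpu⟩ := hG.2 ξ hξ h0
    obtain ⟨l, hl, rfl⟩ := List.getElem_of_mem hx
    refine ⟨g ⟨l, hl⟩, ?_, m ⟨l, hl⟩, u, hgm _, hu, ?_⟩
    · exact (List.mem_ofFn' _ _).2 ⟨σ.symm ⟨l, hl⟩, by simp⟩
    · have h2 := hdvd ⟨l, hl⟩ p hp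
      rw [leftDvd_iff_le ho] at h2 hpu ⊢
      exact ⟨h2.1.trans hpu.1, h2.2.trans hpu.2⟩

theorem groebner_quotient (ho : P.IsLeftMonomialOrder ltE) {t : ℕ} {g : Fin t → Fin r → A}
    {m : Fin t → (Fin n → ℕ) × Fin r} (hm : ∀ l, P.IsLM ltE (g l) (m l))
    {N : Submodule A (Fin r → A)} (hG : P.IsLeftGroebner ltE N (List.ofFn g)) {ξ : Fin r → A}
    (hξ : ξ ∈ N) : ∃ f : Fin t → A, Fintype.linearCombination A g f = ξ ∧
      ∀ u, ξ ∈ P.supportedIn {p | ltE p u} →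
        ∀ v, P.coeff f v ≠ 0 → ltE (shift v.1 (m v.2)) u := by
  obtain ⟨q, η, hd⟩ := DivL.exists_divL ho (List.ofFn g) ξ
  have hη := hd.eq_zero_of_groebner hG hξ
  subst hη
  refine ⟨truncate A t q, ?_, fun u hu v hv => ?_⟩
  · have h1 := hd.eval
    rw [add_zero, rowEval_eq_truncate _ (List.length_ofFn (f := g))] at h1
    simpa using h1
  · obtain ⟨x, p, h1, h2, h3⟩ := (hd.bound ho hu).2 v.2 v.1 hv
    have h4 : x = g v.2 := by simpa [eq_comm] using h1
    rw [h4] at h2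
    rwa [(hm v.2).eq ho h2]

/-- The leading term of a syzygy must be cancelled by a term of smaller index. With the basis sorted
by the exponent of variable `k`, the divisibility behind this needs no power of that variable, so a
syzygy leading at the erased monomial exists as well. -/
theorem leadingFree_ker (ho : P.IsLeftMonomialOrder ltE) {k : ℕ} (hk : k < n) {t : ℕ}
    {g : Fin t → Fin r → A} {m : Fin t → (Fin n → ℕ) × Fin r}
    (hm : ∀ l, P.IsLM ltE (g l) (m l)) {N : Submodule A (Fin r → A)}
    (hG : P.IsLeftGroebner ltE N (List.ofFn g))
    (hzero : ∀ l (i : Fin n), (i : ℕ) < k → (m l).1 i = 0)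
    (hmono : Monotone fun l => (m l).1 ⟨k, hk⟩) :
    P.LeadingFree (schreyer ltE m) (k + 1)
      (LinearMap.ker (Fintype.linearCombination A g)) := by
  intro f hf u hu
  have hgN : ∀ l, g l ∈ N := fun l => (hG.1 _ ((List.mem_ofFn' _ _).2 ⟨l, rfl⟩)).1
  obtain ⟨v, hv, hlt, heq⟩ : ∃ v, P.coeff f v ≠ 0 ∧ v.2 < u.2 ∧
      shift v.1 (m v.2) = shift u.1 (m u.2) := by
    by_contra! hno
    exact (isLM_linearCombination ho hm hu hno).ne_zero hf
  set w := eraseBelow (k + 1) u with hw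
  obtain ⟨δ, hδ⟩ : ∃ δ, shift w.1 (m u.2) = shift δ (m v.2) := by
    rw [← leftDvd_iff ho, leftDvd_iff_le ho]
    have h1 := (leftDvd_iff_le ho).1 ((leftDvd_iff ho).2 ⟨v.1, heq.symm⟩)
    refine ⟨h1.1, fun i => ?_⟩
    have h2 : (m v.2).1 i ≤ u.1 i + (m u.2).1 i := h1.2 i
    change (m v.2).1 i ≤ w.1 i + (m u.2).1 i
    -- Below `k` the exponents of `m v.2` vanish; at `k` sorting gives `m v.2 ≤ m u.2`; above `k`
    -- nothing has been erased.
    rcases lt_trichotomy (i : ℕ) k with hi | hi | hi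
    · rw [hzero _ i hi]
      exact Nat.zero_le _
    · obtain rfl : i = ⟨k, hk⟩ := Fin.ext hi
      exact (hmono hlt.le).trans (Nat.le_add_left _ _)
    · have : w.1 i = u.1 i := by
        simp only [hw, eraseBelow]
        rw [if_neg (by omega)]
      rwa [this]
  have h3 := (hm u.2).smul ho w.1
  have h4 := isLM_multiplier ho (hm v.2) hδ.symm h3.1
  set c := (P.coeff (P.basis δ • g v.2) (shift w.1 (m u.2)))⁻¹ *
    P.coeff (P.basis w.1 • g u.2) (shift w.1 (m u.2)) with hc
  have h5 := h3.sub_mem_below h4.1 h4.2.symm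
  obtain ⟨y, hy, hbound⟩ := groebner_quotient ho hm hG
    (ξ := P.basis w.1 • g u.2 - c • P.basis δ • g v.2)
    (sub_mem (N.smul_mem _ (hgN _)) (by
      rw [← smulK_smul]
      exact N.smul_mem _ (hgN _)))
  -- The syzygy of the critical pair at `w`. The term at `v.2` has the same image but smaller index,
  -- and `y` evaluates strictly below, so `w` leads.
  refine ⟨P.monE w + -(c • P.monE (δ, v.2) + y), ?_, ?_⟩
  · have h6 : Fintype.linearCombination A g (c • P.monE (δ, v.2)) = c • P.basis δ • g v.2 := by
      rw [← linearCombination_monE g (δ, v.2)]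
      exact (restrictK (K := K) (Fintype.linearCombination A g)).map_smul c _
    rw [LinearMap.mem_ker, map_add, map_neg, map_add, hy, h6, linearCombination_monE]
    change P.basis w.1 • g u.2 + _ = 0
    abel
  · refine (isLM_monE w).add (schreyer_isLeftMonomialOrder ho m)
      (neg_mem (add_mem (Submodule.smul_mem _ _ (P.monE_mem_supportedIn ?_)) fun z hz => ?_))
    · exact Or.inr ⟨hδ.symm, hlt⟩
    · exact Or.inl (hbound _ h5 z hz)

theorem range_linearCombination_eq (ho : P.IsLeftMonomialOrder ltE) {t : ℕ}
    {g : Fin t → Fin r → A} {N : Submodule A (Fin r → A)}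
    (hG : P.IsLeftGroebner ltE N (List.ofFn g)) :
    LinearMap.range (Fintype.linearCombination A g) = N := by
  rw [Fintype.range_linearCombination, ← hG.span_eq ho]
  congr 1
  ext x
  rw [Set.mem_ofPred_eq, List.mem_ofFn']

/-- The quotient by a submodule whose leading monomials depend on no variable is projective. -/
theorem projective_quotient (ho : P.IsLeftMonomialOrder ltE) {N : Submodule A (Fin r → A)}
    (hN : P.LeadingFree ltE n N) : Module.Projective A ((Fin r → A) ⧸ N) := by
  let S : Set (Fin r) := {i | ∃ ξ ∈ N, ∃ α, P.IsLM ltE ξ (α, i)}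
  let C : Submodule A (Fin r → A) :=
    { carrier := {x | ∀ i ∈ S, x i = 0}
      zero_mem' := by simp
      add_mem' := fun hx hy i hi => by simp [hx i hi, hy i hi]
      smul_mem' := fun f x hx i hi => by simp [hx i hi] }
  have herase : ∀ u : (Fin n → ℕ) × Fin r, (eraseBelow n u).1 = 0 := fun u =>
    funext fun i => by simp [eraseBelow]
  -- Division by elements with leading monomials `e_i`, `i ∈ S`, leaves a remainder without entries
  -- in `S`; conversely a nonzero element of `N` has its leading term in `S`. So the coordinate
  -- submodule `C`, a direct summand of `A^r`, represents the quotient.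
  have hcompl : IsCompl N C := by
    constructor
    · rw [Submodule.disjoint_def]
      intro x hx hxC
      by_contra h0
      obtain ⟨u, hu⟩ := exists_isLM ho h0
      exact hu.1 (by simp [coeff, hxC u.2 ⟨x, hx, u.1, hu⟩])
    · rw [codisjoint_iff, eq_top_iff]
      intro x _
      have hex : ∀ i, ∃ g ∈ N, i ∈ S → P.IsLM ltE g (0, i) := fun i => by
        by_cases hi : i ∈ S
        · obtain ⟨ξ, hξ, α, hα⟩ := hi
          obtain ⟨g, hg, hgu⟩ := hN ξ hξ _ hα
          have h2 : eraseBelow n (α, i) = (0, i) := Prod.ext (herase _) rfl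
          exact ⟨g, hg, fun _ => h2 ▸ hgu⟩
        · exact ⟨0, zero_mem _, fun h => absurd h hi⟩
      choose G hGN hGS using hex
      obtain ⟨q, η, hd⟩ := DivL.exists_divL ho (List.ofFn G) x
      rw [← hd.eval]
      refine Submodule.add_mem_sup ?_ fun i hi => ?_
      · refine Submodule.span_le.2 ?_ (rowEval_mem_span (List.ofFn G) q)
        intro y hy
        obtain ⟨i, rfl⟩ := (List.mem_ofFn' _ _).1 hy
        exact hGN i
      · by_contra h0
        obtain ⟨α, hα⟩ := Finsupp.ne_iff.1 fun h' => h0 (P.basis.repr.map_eq_zero_iff.1 h')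
        refine hd.irreducible (α, i) hα (G i) ((List.mem_ofFn' _ _).2 ⟨i, rfl⟩) _ (hGS i hi) ?_
        rw [leftDvd_iff_le ho]
        exact ⟨rfl, fun _ => Nat.zero_le _⟩
  have hC : Module.Projective A C :=
    Module.Projective.of_split C.subtype (C.projectionOnto N hcompl.symm) (by
      ext x : 1
      exact Submodule.projectionOnto_apply_left hcompl.symm x)
  exact Module.Projective.of_equiv (Submodule.quotientEquivOfIsCompl N C hcompl).symm

end GradedSolvablePolynomialAlgebra

/-! ### Projective dimension -/

-- Dimension shifting along `0 → range Φ → A^r → A^r / range Φ → 0`, combined with `range Φ ≅ A^t /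
-- ker Φ`.
open CategoryTheory in
theorem hasProjectiveDimensionLT_quotient_iff {A : Type*} [Ring A] {t r : ℕ}
    (Φ : (Fin t → A) →ₗ[A] (Fin r → A)) (j : ℕ) :
    HasProjectiveDimensionLT (ModuleCat.of A ((Fin r → A) ⧸ LinearMap.range Φ)) (j + 2) ↔
      HasProjectiveDimensionLT (ModuleCat.of A ((Fin t → A) ⧸ LinearMap.ker Φ)) (j + 1) := by
  let S := (LinearMap.range Φ).mkQ.shortComplexKer
  have hS : S.ShortExact := LinearMap.shortExact_shortComplexKer (Submodule.mkQ_surjective _)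
  have h2 : Projective S.X₂ :=
    inferInstanceAs (Projective (ModuleCat.of A (Fin r → A)))
  let e : S.X₁ ≅ ModuleCat.of A ((Fin t → A) ⧸ LinearMap.ker Φ) :=
    ((LinearEquiv.ofEq _ _ (Submodule.ker_mkQ (LinearMap.range Φ))).trans
      Φ.quotKerEquivRange.symm).toModuleIso
  refine (hS.hasProjectiveDimensionLT_X₃_iff j h2).trans ⟨fun h => ?_, fun h => ?_⟩
  · exact hasProjectiveDimensionLT_of_iso e _
  · exact hasProjectiveDimensionLT_of_iso e.symm _

namespace GradedSolvablePolynomialAlgebra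

open CategoryTheory

variable {K A : Type*} [Field K] [Ring A] [Algebra K A] {n : ℕ}
  {P : GradedSolvablePolynomialAlgebra K A n}

/-- Here `j` counts the variables still occurring in leading monomials. Each syzygy step removes one
variable and one unit of the bound; at `j = 0` the quotient is projective. -/
theorem hasProjectiveDimensionLT_of_leadingFree (j : ℕ) : ∀ (k r : ℕ)
    (ltE : (Fin n → ℕ) × Fin r → (Fin n → ℕ) × Fin r → Prop) (N : Submodule A (Fin r → A)),
    k + j = n → P.IsLeftMonomialOrder ltE → P.LeadingFree ltE k N →
    HasProjectiveDimensionLT (ModuleCat.of A ((Fin r → A) ⧸ N)) (j + 1) := by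
  induction j with
  | zero =>
    rintro k r ltE N rfl ho hN
    have := projective_quotient ho hN
    have : Projective (ModuleCat.of A ((Fin r → A) ⧸ N)) :=
      (IsProjective.iff_projective _).1 this
    infer_instance
  | succ j ih =>
    intro k r ltE N hk ho hN
    have hkn : k < n := by omega
    obtain ⟨t, g, m, hm, hG, hzero, hmono⟩ := exists_sorted_groebner ho hkn hN
    obtain rfl := range_linearCombination_eq ho hG
    rw [hasProjectiveDimensionLT_quotient_iff]
    exact ih (k + 1) t _ _ (by omega) (schreyer_isLeftMonomialOrder ho m)
      (leadingFree_ker ho hkn hm hG hzero hmono)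

theorem hasProjectiveDimensionLT_quotient (P : GradedSolvablePolynomialAlgebra K A n) {r : ℕ}
    (N : Submodule A (Fin r → A)) :
    HasProjectiveDimensionLT (ModuleCat.of A ((Fin r → A) ⧸ N)) (n + 1) := by
  obtain ⟨ltE, ho⟩ := exists_isLeftMonomialOrder P r
  exact hasProjectiveDimensionLT_of_leadingFree (P := P) n 0 r ltE N (by omega) ho (leadingFree_zero N)

/-- In an exact sequence of free modules, the `n`-th kernel has a projective quotient. -/
theorem projective_quotient_of_exact (P : GradedSolvablePolynomialAlgebra K A n) {r : ℕ → ℕ}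
    (φ : ∀ i, (Fin (r (i + 1)) → A) →ₗ[A] (Fin (r i) → A))
    (N : ∀ i, Submodule A (Fin (r i) → A)) (hrange : ∀ i, LinearMap.range (φ i) = N i)
    (hker : ∀ i, LinearMap.ker (φ i) = N (i + 1)) :
    Module.Projective A ((Fin (r n) → A) ⧸ N n) := by
  have h : ∀ i j, i + j = n →
      HasProjectiveDimensionLT (ModuleCat.of A ((Fin (r i) → A) ⧸ N i)) (j + 1) := by
    intro i
    induction i with
    | zero =>
      intro j hj
      obtain rfl : j = n := by omega
      exact P.hasProjectiveDimensionLT_quotient (N 0)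
    | succ i ih =>
      intro j hj
      have h1 := ih (j + 1) (by omega)
      rw [← hrange i, hasProjectiveDimensionLT_quotient_iff, hker i] at h1
      exact h1
  have := h n 0 (by omega)
  rw [IsProjective.iff_projective, projective_iff_hasProjectiveDimensionLT_one]
  exact this

/-! ### The graded Nakayama lemma -/

variable (P) in
/-- The elements of `A` all of whose monomials have degree at least `q`. -/
def highDegree (q : ℕ) : Submodule K A := Submodule.span K (P.basis '' {α | q ≤ P.weight α})

theorem mem_highDegree {q : ℕ} {f : A} :
    f ∈ P.highDegree q ↔ ∀ α, P.basis.repr f α ≠ 0 → q ≤ P.weight α := by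
  rw [highDegree, Module.Basis.mem_span_image]
  simp [Set.subset_def]

theorem mul_mem_highDegree {p q : ℕ} {f g : A} (hf : f ∈ P.highDegree p)
    (hg : g ∈ P.highDegree q) : f * g ∈ P.highDegree (p + q) := by
  have h : P.highDegree p * P.highDegree q ≤ P.highDegree (p + q) := by
    rw [highDegree, highDegree, Submodule.span_mul_span, Submodule.span_le]
    rintro _ ⟨_, ⟨α, hα, rfl⟩, _, ⟨β, hβ, rfl⟩, rfl⟩
    refine mem_highDegree.2 fun δ hδ => ?_
    rw [P.mem_part.1 (P.mul_mem_part (P.basis_mem_part α) (P.basis_mem_part β)) δ hδ]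
    exact add_le_add hα hβ
  exact h (Submodule.mul_mem_mul hf hg)

/-- A submodule of `A^r` without constant terms whose quotient is projective vanishes. -/
theorem eq_bot_of_projective {r : ℕ} {N : Submodule A (Fin r → A)} (hN : N ≤ P.constFree r)
    [Module.Projective A ((Fin r → A) ⧸ N)] : N = ⊥ := by
  obtain ⟨σ, hσ⟩ := Module.projective_lifting_property N.mkQ LinearMap.id N.mkQ_surjective
  -- A section of the quotient map yields a projection of `A^r` onto `N`.
  let π : (Fin r → A) →ₗ[A] (Fin r → A) := LinearMap.id - σ ∘ₗ N.mkQ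
  have hπ : ∀ x, π x ∈ N := fun x => by
    rw [← Submodule.Quotient.mk_eq_zero]
    have := LinearMap.congr_fun hσ (N.mkQ x)
    change N.mkQ (x - σ (N.mkQ x)) = 0
    rw [map_sub, sub_eq_zero]
    exact this.symm
  have hid : ∀ x ∈ N, π x = x := fun x hx => by
    change x - σ (N.mkQ x) = x
    rw [Submodule.mkQ_apply, (Submodule.Quotient.mk_eq_zero N).2 hx, map_zero, sub_zero]
  have h : ∀ q, ∀ x ∈ N, ∀ j, x j ∈ P.highDegree q := by
    intro q
    induction q with
    | zero => exact fun x _ j => mem_highDegree.2 fun _ _ => Nat.zero_le _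
    | succ q ih =>
      intro x hx j
      -- Here `x = Σ x_i π(e_i)`. The `x_i` have no constant term and so raise the degree by at
      -- least one, while `π(e_i) ∈ N` is already in degrees at least `q`.
      rw [← hid x hx, hom_eq_linearCombination π, Fintype.linearCombination_apply,
        Finset.sum_apply]
      refine sum_mem fun i _ => ?_
      rw [add_comm]
      refine mul_mem_highDegree (mem_highDegree.2 fun α hα => ?_) (ih _ (hπ _) j)
      by_contra h0
      obtain rfl := P.weight_eq_zero (by omega : P.weight α = 0)
      exact hα (hN hx i)
  refine (Submodule.eq_bot_iff N).2 fun x hx => funext fun j => P.basis.ext_elem fun α => ?_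
  by_contra h0
  rw [Pi.zero_apply, map_zero, Finsupp.zero_apply] at h0
  exact absurd (mem_highDegree.1 (h (P.weight α + 1) x hx j) α h0) (by omega)

end GradedSolvablePolynomialAlgebra

/-! ### The construction of the resolution -/

theorem exists_stuck_of_acc {σ : Type*} {R : σ → σ → Prop} {x : σ}
    (h : Acc (fun y z => R z y) x) : ∃ y, Relation.ReflTransGen R x y ∧ ∀ z, ¬ R y z := by
  induction h with
  | intro x _ ih =>
    by_cases hx : ∃ y, R x y
    · obtain ⟨y, hy⟩ := hx
      obtain ⟨z, hz, hz'⟩ := ih y hy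
      exact ⟨z, hz.head hy, hz'⟩
    · exact ⟨x, .refl, not_exists.1 hx⟩

namespace GradedSolvablePolynomialAlgebra

variable {K A : Type*} [Field K] [Ring A] [Algebra K A] {n : ℕ}
  {P : GradedSolvablePolynomialAlgebra K A n}

theorem span_range_single {M : Type*} [AddCommGroup M] [Module A M] {t : ℕ}
    (φ : (Fin t → A) →ₗ[A] M) :
    Submodule.span A (Set.range fun k => φ (Pi.single k 1)) = LinearMap.range φ := by
  conv_rhs => rw [hom_eq_linearCombination φ, Fintype.range_linearCombination]

/-! ### Finite homogeneous presentations of graded modules -/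

namespace IsGradedModule

variable {M : Type*} [AddCommGroup M] [Module A M] {ℳ : ℕ → AddSubgroup M}

theorem map_mem (hℳ : P.IsGradedModule ℳ) {r : ℕ} {b : Fin r → ℕ} {ε : (Fin r → A) →ₗ[A] M}
    (hε : ∀ k, ε (Pi.single k 1) ∈ ℳ (b k)) {q : ℕ} {ξ : Fin r → A} (hξ : ξ ∈ P.freePart b q) :
    ε ξ ∈ ℳ q := by
  rw [hom_eq_linearCombination ε, Fintype.linearCombination_apply]
  refine sum_mem fun k _ => ?_
  by_cases hle : b k ≤ q
  · have := hℳ.smul_mem _ _ _ _ (P.apply_mem_part b hξ hle) (hε k)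
    rwa [Nat.sub_add_cancel hle] at this
  · rw [P.apply_eq_zero b hξ (not_le.1 hle), zero_smul]
    exact zero_mem _

theorem eq_zero_of_sum (hℳ : P.IsGradedModule ℳ) {s : Finset ℕ} {x : ℕ → M}
    (hx : ∀ q, x q ∈ ℳ q) (h : ∑ q ∈ s, x q = 0) {q : ℕ} (hq : q ∈ s) : x q = 0 := by
  have h1 : ∑ q ∈ s, DirectSum.of (fun i => ℳ i) q ⟨x q, hx q⟩ = 0 := by
    refine hℳ.internal.1 ?_
    rw [map_sum, map_zero]
    simpa only [DirectSum.coeAddMonoidHom_of] using h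
  have h2 := DFunLike.congr_fun h1 q
  rw [DFinsupp.finsetSum_apply, Finset.sum_eq_single_of_mem q hq fun p _ hp => ?_] at h2
  · rw [DirectSum.of_eq_same] at h2
    exact congrArg Subtype.val h2
  · exact DirectSum.of_eq_of_ne _ _ _ hp.symm

theorem exists_generators [Module.Finite A M] (hℳ : P.IsGradedModule ℳ) :
    ∃ (s : ℕ) (b : Fin s → ℕ) (v : Fin s → M),
      (∀ i, v i ∈ ℳ (b i)) ∧ Submodule.span A (Set.range v) = ⊤ := by
  have h : Submodule.span A {x | ∃ q, x ∈ ℳ q} = ⊤ := by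
    refine eq_top_iff.2 fun x _ => ?_
    obtain ⟨y, rfl⟩ := hℳ.internal.2 x
    induction y using DirectSum.induction_on with
    | zero => simp
    | of q y =>
      rw [DirectSum.coeAddMonoidHom_of]
      exact Submodule.subset_span ⟨q, y.2⟩
    | add y z hy hz =>
      rw [map_add]
      exact add_mem (hy trivial) (hz trivial)
  obtain ⟨S, hS, hS'⟩ := (Submodule.fg_span_iff_fg_span_finset_subset _).1
    (h.symm ▸ Module.Finite.fg_top)
  choose b hb using fun i : Fin S.card => hS (S.equivFin.symm i).2
  refine ⟨S.card, b, fun i => S.equivFin.symm i, hb, ?_⟩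
  rw [← h, hS']
  congr 1
  ext x
  refine ⟨?_, fun hx => ⟨S.equivFin ⟨x, hx⟩, by simp⟩⟩
  rintro ⟨i, rfl⟩
  exact (S.equivFin.symm i).2

/-- Homogeneous components of a relation are relations because the sum of the parts of `M` is
direct. As the relation module is finitely generated, finitely many homogeneous ones suffice. -/
theorem exists_relations (hℳ : P.IsGradedModule ℳ) {s : ℕ} {b : Fin s → ℕ} {v : Fin s → M}
    (hv : ∀ i, v i ∈ ℳ (b i)) :
    ∃ U : Finset (Fin s → A), (∀ ξ ∈ U, P.IsHomog b ξ) ∧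
      Submodule.span A (U : Set (Fin s → A)) = LinearMap.ker (Fintype.linearCombination A v) := by
  have h : Submodule.span A {ξ | P.IsHomog b ξ ∧ Fintype.linearCombination A v ξ = 0} =
      LinearMap.ker (Fintype.linearCombination A v) := by
    refine le_antisymm (Submodule.span_le.2 fun ξ hξ => hξ.2) fun ξ hξ => ?_
    obtain ⟨S, hS⟩ := P.exists_sum_component (b := b) ξ
    have h1 := hS S subset_rfl
    rw [← h1]
    refine sum_mem fun q hq => ?_
    by_cases h0 : P.component b q ξ = 0
    · rw [h0]
      exact zero_mem _
    · refine Submodule.subset_span ⟨⟨h0, q, P.component_mem ξ q⟩, ?_⟩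
      refine hℳ.eq_zero_of_sum (s := S)
        (x := fun q => Fintype.linearCombination A v (P.component b q ξ)) (fun q => ?_) ?_ hq
      · refine hℳ.map_mem (fun k => ?_) (P.component_mem ξ q)
        simpa using hv k
      · rw [← map_sum, h1]
        exact hξ
  obtain ⟨U, hU, hU'⟩ := (Submodule.fg_span_iff_fg_span_finset_subset _).1
    (h.symm ▸ submodule_fg P (LinearMap.ker (Fintype.linearCombination A v)))
  exact ⟨U, fun ξ hξ => (hU hξ).1, hU'.symm.trans h⟩

end IsGradedModule

variable {X Y : Stage A} {φ : (Fin Y.rank → A) →ₗ[A] (Fin X.rank → A)}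

/-! ### Properties of a single round -/

namespace ResStep

theorem exists_resStep (hX : ∀ ξ ∈ X.gens, P.IsHomog X.deg ξ) : ∃ Y φ, P.ResStep X Y φ := by
  obtain ⟨ltE, ho⟩ := exists_isLeftMonomialOrder P X.rank
  obtain ⟨T, hT, hstuck⟩ := exists_stuck_of_acc (acc_minStep ho X.deg (MinState.init X.gens))
  have hdone := ((haltsWith_minOutput ho hX).2 T hT hstuck).1
  obtain ⟨Y, φ, h⟩ := exists_syzStep ho hX ⟨hT, hdone⟩
  exact ⟨Y, φ, ltE, ho, T, ⟨hT, hdone⟩, h⟩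

theorem homog (h : P.ResStep X Y φ) (hX : ∀ ξ ∈ X.gens, P.IsHomog X.deg ξ) :
    ∀ ξ ∈ Y.gens, P.IsHomog Y.deg ξ := by
  obtain ⟨ltE, ho, T, hT, h⟩ := h
  exact (syzStep_spec ho hX hT h).1

theorem range_eq (h : P.ResStep X Y φ) (hX : ∀ ξ ∈ X.gens, P.IsHomog X.deg ξ) :
    LinearMap.range φ = Submodule.span A (X.gens : Set (Fin X.rank → A)) := by
  obtain ⟨ltE, ho, T, hT, h⟩ := h
  exact (syzStep_spec ho hX hT h).2.1

theorem ker_eq (h : P.ResStep X Y φ) (hX : ∀ ξ ∈ X.gens, P.IsHomog X.deg ξ) :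
    LinearMap.ker φ = Submodule.span A (Y.gens : Set (Fin Y.rank → A)) := by
  obtain ⟨ltE, ho, T, hT, h⟩ := h
  exact (syzStep_spec ho hX hT h).2.2.1

theorem isMinGen (h : P.ResStep X Y φ) (hX : ∀ ξ ∈ X.gens, P.IsHomog X.deg ξ) :
    IsMinGen (Submodule.span A (X.gens : Set (Fin X.rank → A)))
      fun k => φ (Pi.single k 1) := by
  obtain ⟨ltE, ho, T, hT, h⟩ := h
  exact (syzStep_spec ho hX hT h).2.2.2.1

theorem ker_le_constFree (h : P.ResStep X Y φ) (hX : ∀ ξ ∈ X.gens, P.IsHomog X.deg ξ) :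
    LinearMap.ker φ ≤ P.constFree _ := by
  obtain ⟨ltE, ho, T, hT, h⟩ := h
  exact (syzStep_spec ho hX hT h).2.2.2.2

theorem graded (h : P.ResStep X Y φ) (q : ℕ) {ξ : Fin Y.rank → A}
    (hξ : ξ ∈ P.freePart Y.deg q) : φ ξ ∈ P.freePart X.deg q := by
  obtain ⟨ltE, ho, T, hT, h⟩ := h
  exact map_mem_freePart _ φ (fun k => (h.2.1 k).2) hξ

/-- Homogeneous generators are nonzero by definition, and a minimal generating family of the zero
module is empty. -/
theorem rank_eq_zero_iff (h : P.ResStep X Y φ) (hX : ∀ ξ ∈ X.gens, P.IsHomog X.deg ξ) :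
    Y.rank = 0 ↔ X.gens = ∅ := by
  refine ⟨fun h0 => ?_, fun h0 => ?_⟩
  · have : IsEmpty (Fin Y.rank) := by rw [h0]; infer_instance
    refine Finset.eq_empty_of_forall_notMem fun ξ hξ => (hX ξ hξ).1 ?_
    have h1 : ξ ∈ LinearMap.range φ := by
      rw [h.range_eq hX]
      exact Submodule.subset_span hξ
    obtain ⟨y, rfl⟩ := h1
    rw [Subsingleton.elim y 0, map_zero]
  · by_contra hne
    have : Nonempty (Fin Y.rank) := ⟨⟨0, Nat.pos_of_ne_zero hne⟩⟩
    refine (h.isMinGen hX).2 ∅ Set.empty_ne_univ ?_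
    rw [Set.image_empty, h0, Finset.coe_empty]

end ResStep

theorem homog_of_reachable {X₀ : Stage A} (h₀ : ∀ ξ ∈ X₀.gens, P.IsHomog X₀.deg ξ)
    (h : Relation.ReflTransGen (fun X Y : Stage A => ∃ φ, P.ResStep X Y φ) X₀ X) :
    ∀ ξ ∈ X.gens, P.IsHomog X.deg ξ := by
  induction h with
  | refl => exact h₀
  | tail _ h ih =>
    obtain ⟨φ, h⟩ := h
    exact h.homog ih

/-! ### Iterated rounds and the length of the resolution -/

section Sequence

variable {X : ℕ → Stage A} {φ : ∀ i, (Fin (X (i + 1)).rank → A) →ₗ[A] (Fin (X i).rank → A)}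

theorem homog_stage (h₀ : ∀ ξ ∈ (X 0).gens, P.IsHomog (X 0).deg ξ)
    (h : ∀ i, P.ResStep (X i) (X (i + 1)) (φ i)) (i : ℕ) :
    ∀ ξ ∈ (X i).gens, P.IsHomog (X i).deg ξ := by
  induction i with
  | zero => exact h₀
  | succ i ih => exact (h i).homog ih

theorem exists_length (h₀ : ∀ ξ ∈ (X 0).gens, P.IsHomog (X 0).deg ξ)
    (hconst : Submodule.span A ((X 0).gens : Set (Fin (X 0).rank → A)) ≤ P.constFree _)
    (h : ∀ i, P.ResStep (X i) (X (i + 1)) (φ i)) :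
    ∃ d ≤ n, (∀ i, (X i).gens = ∅ ↔ d ≤ i) ∧ HasLength (fun i => (X i).rank) d := by
  classical
  have hX := homog_stage h₀ h
  have hrank : ∀ i, (X (i + 1)).rank = 0 ↔ (X i).gens = ∅ := fun i =>
    (h i).rank_eq_zero_iff (hX i)
  have hsucc : ∀ i, (X i).gens = ∅ → (X (i + 1)).gens = ∅ := fun i hi => by
    have h1 := (hrank i).2 hi
    have : IsEmpty (Fin (X (i + 1)).rank) := by rw [h1]; infer_instance
    exact Finset.eq_empty_of_forall_notMem fun ξ hξ =>
      (hX (i + 1) ξ hξ).1 (Subsingleton.elim _ _)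
  have hfree : ∀ i,
      Submodule.span A ((X i).gens : Set (Fin (X i).rank → A)) ≤ P.constFree _ := by
    rintro (_ | i)
    · exact hconst
    · rw [← (h i).ker_eq (hX i)]
      exact (h i).ker_le_constFree (hX i)
  -- The `n`-th syzygy module has a projective quotient and no constant terms, so it is zero.
  have hn : (X n).gens = ∅ := by
    have := projective_quotient_of_exact P φ
      (fun i => Submodule.span A ((X i).gens : Set (Fin (X i).rank → A)))
      (fun i => (h i).range_eq (hX i)) (fun i => (h i).ker_eq (hX i))
    have hbot := eq_bot_of_projective (hfree n)
    exact Finset.eq_empty_of_forall_notMem fun ξ hξ =>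
      (hX n ξ hξ).1 (Submodule.span_eq_bot.1 hbot ξ hξ)
  have hex : ∃ i, (X i).gens = ∅ := ⟨n, hn⟩
  have hiff : ∀ i, (X i).gens = ∅ ↔ Nat.find hex ≤ i := fun i => by
    refine ⟨fun hi => Nat.find_min' hex hi, fun hi => ?_⟩
    induction i, hi using Nat.le_induction with
    | base => exact Nat.find_spec hex
    | succ i _ ih => exact hsucc i ih
  refine ⟨Nat.find hex, Nat.find_min' hex hn, hiff, fun i hi => ?_, fun hd hr => ?_⟩
  · obtain ⟨j, rfl⟩ := Nat.exists_eq_add_of_lt hi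
    exact (hrank _).2 ((hiff _).2 (Nat.le_add_right _ j))
  -- The rank at stage `d = j + 1` counts minimal generators of the module at stage `j`, which is
  -- nonzero by the choice of `d`.
  · obtain ⟨j, hj⟩ := Nat.exists_eq_succ_of_ne_zero hd
    rw [hj] at hr
    have := (hiff j).1 ((hrank j).1 hr)
    omega

theorem isMinimalGradedFreeResolution {M : Type*} [AddCommGroup M] [Module A M]
    {ℳ : ℕ → AddSubgroup M} (hℳ : P.IsGradedModule ℳ)
    (h₀ : ∀ ξ ∈ (X 0).gens, P.IsHomog (X 0).deg ξ)
    (h : ∀ i, P.ResStep (X i) (X (i + 1)) (φ i)) {ε : (Fin (X 0).rank → A) →ₗ[A] M}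
    (hε : ∀ k, ε (Pi.single k 1) ∈ ℳ ((X 0).deg k)) (hsurj : Function.Surjective ε)
    (hker : LinearMap.ker ε = Submodule.span A ((X 0).gens : Set (Fin (X 0).rank → A)))
    (hmin : IsMinGen (⊤ : Submodule A M) fun k => ε (Pi.single k 1)) :
    P.IsMinimalGradedFreeResolution ℳ (fun i => (X i).rank) (fun i => (X i).deg) ε φ := by
  have hX := homog_stage h₀ h
  refine ⟨fun q ξ hξ => hℳ.map_mem hε hξ, fun i q ξ hξ => (h i).graded q hξ, hsurj, ?_,
    fun i => ?_, hmin, ?_, fun i => ?_⟩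
  · rw [hker, (h 0).range_eq h₀]
  · rw [(h i).ker_eq (hX i), (h (i + 1)).range_eq (hX (i + 1))]
  · rw [hker]
    exact (h 0).isMinGen h₀
  · rw [(h i).ker_eq (hX i)]
    exact (h (i + 1)).isMinGen (hX (i + 1))

theorem exists_sequence {X₀ : Stage A} (h₀ : ∀ ξ ∈ X₀.gens, P.IsHomog X₀.deg ξ) :
    ∃ (X : ℕ → Stage A) (φ : ∀ i, (Fin (X (i + 1)).rank → A) →ₗ[A] (Fin (X i).rank → A)),
      X 0 = X₀ ∧ ∀ i, P.ResStep (X i) (X (i + 1)) (φ i) := by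
  choose F φ hF using fun X : {X : Stage A // ∀ ξ ∈ X.gens, P.IsHomog X.deg ξ} =>
    ResStep.exists_resStep X.2
  let Z : ℕ → {X : Stage A // ∀ ξ ∈ X.gens, P.IsHomog X.deg ξ} := fun i =>
    Nat.rec ⟨X₀, h₀⟩ (fun _ X => ⟨F X, (hF X).homog X.2⟩) i
  exact ⟨fun i => (Z i).1, fun i => φ (Z i), rfl, fun i => hF (Z i)⟩

end Sequence

/-- Stated for a stage known only up to equality, since the first stage of a given sequence is
prescribed by an equation; this is the reason for the cast. -/
theorem exists_augmentation {s : ℕ} {M : Type*} [AddCommGroup M] [Module A M]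
    {ℳ : ℕ → AddSubgroup M} {b : Fin s → ℕ} {v : Fin s → M} (hv : ∀ i, v i ∈ ℳ (b i))
    (hspan : Submodule.span A (Set.range v) = ⊤) {U : Finset (Fin s → A)}
    (hker : Submodule.span A (U : Set (Fin s → A)) =
      LinearMap.ker (Fintype.linearCombination A v))
    {Z : Finset (Fin s) × Finset (Fin s → A)} (hZ : P.QuotInv b v U Z)
    (hstuck : ∀ Z', ¬ QuotStep K Z Z') {X : Stage A} (hX : X = quotStage b Z) :
    ∃ ε : (Fin X.rank → A) →ₗ[A] M,
      (∀ k : Fin X.rank, ε (Pi.single k 1) =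
        v (Z.1.orderEmbOfFin rfl (Fin.cast (congrArg Stage.rank hX) k))) ∧
      (∀ k, ε (Pi.single k 1) ∈ ℳ (X.deg k)) ∧ Function.Surjective ε ∧
      LinearMap.ker ε = Submodule.span A (X.gens : Set (Fin X.rank → A)) ∧
      IsMinGen (⊤ : Submodule A M) fun k => ε (Pi.single k 1) := by
  subst hX
  have hval : ∀ k : Fin Z.1.card, quotMap (A := A) v Z.1 (Pi.single k 1) =
      v (Z.1.orderEmbOfFin rfl k) := fun k => by simp [quotMap]
  have hsurj := hZ.surjective_quotMap hspan
  refine ⟨quotMap v Z.1, hval, fun k => ?_, hsurj, hZ.ker_quotMap hker, ?_⟩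
  · exact (hval k).symm ▸ hv _
  · refine isMinGen_of_ker (P := P) ?_ fun f hf => ?_
    · exact (span_range_single _).trans (LinearMap.range_eq_top.2 hsurj)
    · refine hZ.ker_le_constFree hstuck hker ?_
      exact (LinearMap.congr_fun (hom_eq_linearCombination (quotMap v Z.1)) f).trans hf

end GradedSolvablePolynomialAlgebra

/-! ### The main theorem -/

theorem theorem4p4p1 {K A : Type*} [Field K] [Ring A] [Algebra K A] {n : ℕ}
    (P : GradedSolvablePolynomialAlgebra K A n)
    {M : Type*} [AddCommGroup M] [Module A M] [Module.Finite A M]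
    (ℳ : ℕ → AddSubgroup M) (hℳ : P.IsGradedModule ℳ) :
    -- existence of a minimal graded free resolution of length at most `n`
    (∃ d ≤ n, ∃ (r : ℕ → ℕ) (b : ∀ i, Fin (r i) → ℕ) (ε : (Fin (r 0) → A) →ₗ[A] M)
      (φ : ∀ i, (Fin (r (i + 1)) → A) →ₗ[A] (Fin (r i) → A)),
      P.IsMinimalGradedFreeResolution ℳ r b ε φ ∧ HasLength r d) ∧
    -- its construction from any finite homogeneous presentation of `M`
    ∀ (s : ℕ) (b : Fin s → ℕ) (v : Fin s → M),
      (∀ i, v i ∈ ℳ (b i)) → Submodule.span A (Set.range v) = ⊤ →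
      ∀ U : Finset (Fin s → A), (∀ ξ ∈ U, P.IsHomog b ξ) →
      Submodule.span A (U : Set (Fin s → A)) = LinearMap.ker (Fintype.linearCombination A v) →
      -- a minimal homogeneous generating set of `M` is computed
      HaltsWith (GradedSolvablePolynomialAlgebra.QuotStep K) (P.QuotOutput b v U)
        (Finset.univ, U) ∧
      ∀ Z, Relation.ReflTransGen (GradedSolvablePolynomialAlgebra.QuotStep K)
          (Finset.univ, U) Z →
        (∀ Z', ¬ GradedSolvablePolynomialAlgebra.QuotStep K Z Z') →
        -- each round can be carried out, with any choices, and computes what it should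
        (∀ X, Relation.ReflTransGen (fun X Y : Stage A => ∃ φ, P.ResStep X Y φ)
            (GradedSolvablePolynomialAlgebra.quotStage b Z) X →
          (∃ ltE : (Fin n → ℕ) × Fin X.rank → (Fin n → ℕ) × Fin X.rank → Prop,
            P.IsLeftMonomialOrder ltE) ∧
          ∀ ltE : (Fin n → ℕ) × Fin X.rank → (Fin n → ℕ) × Fin X.rank → Prop,
            P.IsLeftMonomialOrder ltE →
            HaltsWith (P.MinStep X.deg ltE) (P.MinOutput X.deg ltE X.gens)
              (MinState.init X.gens) ∧
            ∀ T, P.IsMinResult X ltE T →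
              (∃ Y φ, P.SyzStep X ltE T Y φ) ∧
              ∀ Y φ, P.SyzStep X ltE T Y φ →
                (∀ ξ ∈ Y.gens, P.IsHomog Y.deg ξ) ∧
                LinearMap.range φ = Submodule.span A (X.gens : Set (Fin X.rank → A)) ∧
                LinearMap.ker φ = Submodule.span A (Y.gens : Set (Fin Y.rank → A))) ∧
        -- after `d ≤ n` rounds no syzygies are left, and the result is a minimal resolution
        ∀ (X : ℕ → Stage A) (φ : ∀ i, (Fin (X (i + 1)).rank → A) →ₗ[A] (Fin (X i).rank → A))
          (h₀ : X 0 = GradedSolvablePolynomialAlgebra.quotStage b Z),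
          (∀ i, P.ResStep (X i) (X (i + 1)) (φ i)) →
          ∃ d ≤ n, (∀ i, (X i).gens = ∅ ↔ d ≤ i) ∧
            HasLength (fun i => (X i).rank) d ∧
            ∃ ε : (Fin (X 0).rank → A) →ₗ[A] M,
              (∀ k : Fin (X 0).rank, ε (Pi.single k 1) =
                v (Z.1.orderEmbOfFin rfl (Fin.cast (congrArg Stage.rank h₀) k))) ∧
              P.IsMinimalGradedFreeResolution ℳ (fun i => (X i).rank) (fun i => (X i).deg) ε φ := by
  -- Existence follows from the construction: a finite homogeneous presentation exists, and each
  -- procedure has a terminating run.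
  refine (and_iff_right_of_imp fun hmain => ?_).2 ?_
  · obtain ⟨s, b, v, hv, hspan⟩ := hℳ.exists_generators
    obtain ⟨U, hU, hker⟩ := hℳ.exists_relations hv
    obtain ⟨hhalt, hmain⟩ := hmain s b v hv hspan U hU hker
    obtain ⟨Z, hZ, hstuck⟩ := exists_stuck_of_acc hhalt.1
    obtain ⟨X, φ, h₀, h⟩ := GradedSolvablePolynomialAlgebra.exists_sequence
      (GradedSolvablePolynomialAlgebra.QuotInv.of_reachable hU hker hZ).homog_gens
    obtain ⟨d, hd, -, hlen, ε, -, hres⟩ := (hmain Z hZ hstuck).2 X φ h₀ h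
    exact ⟨d, hd, _, _, ε, φ, hres, hlen⟩
  · intro s b v hv hspan U hU hker
    refine ⟨GradedSolvablePolynomialAlgebra.haltsWith_quotOutput hU hspan hker,
      fun Z hZ hstuck => ?_⟩
    have hinv := GradedSolvablePolynomialAlgebra.QuotInv.of_reachable hU hker hZ
    refine ⟨fun X hX => ?_, fun X φ h₀ h => ?_⟩
    · have hhom := GradedSolvablePolynomialAlgebra.homog_of_reachable hinv.homog_gens hX
      refine ⟨GradedSolvablePolynomialAlgebra.exists_isLeftMonomialOrder P X.rank,
        fun ltE ho => ⟨GradedSolvablePolynomialAlgebra.haltsWith_minOutput ho hhom,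
          fun T hT => ⟨GradedSolvablePolynomialAlgebra.exists_syzStep ho hhom hT,
            fun Y φ hY => ?_⟩⟩⟩
      obtain ⟨h1, h2, h3, -⟩ := GradedSolvablePolynomialAlgebra.syzStep_spec ho hhom hT hY
      exact ⟨h1, h2, h3⟩
    · have hhom : ∀ ξ ∈ (X 0).gens, P.IsHomog (X 0).deg ξ := by
        rw [h₀]
        exact hinv.homog_gens
      have hconst : Submodule.span A ((X 0).gens : Set (Fin (X 0).rank → A)) ≤
          P.constFree _ := by
        rw [h₀]
        exact hinv.span_gens_le hstuck
      obtain ⟨d, hd, hgens, hlen⟩ :=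
        GradedSolvablePolynomialAlgebra.exists_length hhom hconst h
      obtain ⟨ε, hval, hε, hsurj, hkerε, hmin⟩ :=
        GradedSolvablePolynomialAlgebra.exists_augmentation hv hspan hker hinv hstuck h₀
      exact ⟨d, hd, hgens, hlen, ε, hval,
        GradedSolvablePolynomialAlgebra.isMinimalGradedFreeResolution hℳ hhom h hε hsurj
          hkerε hmin⟩
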